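/- Consider positive constants $m_u,m_c,m_b,\mathcal I_u,\mathcal I_b,L,d_G,g,U_{max},T_{max},F_{max}$, put $M=\frac{m_bd_G}{L}+m_u$, $\mathcal I_0=\frac{m_bd_G^2+\mathcal I_b}{L}+m_uL$, and the planar UAV–object–UGV model $$m_c\ddot x=u_3,\qquad M(-\sin\alpha\,\ddot x+g\cos\alpha)+\mathcal I_0\ddot\alpha=u_1\sin(\beta-\alpha),\qquad \mathcal I_u\ddot\beta=u_2 ,$$ with the actuator saturations $0\le u_1\le U_{max}$, $|u_2|\le T_{max}$, $|u_3|\le F_{max}$: each input is the command below clipped to its interval. With $\sigma_\lambda(y)=\mathrm{sign}(y)\min(|y|,\lambda)$, the commands are $$u_3=-\sigma_{\lambda_1}\big(k_{d,x}\dot x+\sigma_{\lambda_2}(k_{p,x}(x-\bar x))\big),\qquad u_1=\frac{f_t}{\sin\bar\theta}\ \Big(=\frac1{\gamma\epsilon}\text{ at } f_t=0\Big),\qquad u_2=-k_{p,\beta}(\beta-\bar\beta(t))-k_{d,\beta}\dot\beta,$$ $$f_t=-k_{p,\alpha}(\alpha-\bar\alpha)-k_{d,\alpha}\dot\alpha+Mg\cos\alpha,\quad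 \bar\theta=\sigma_{\pi/2}(\gamma\arctan(\epsilon f_t)),\quad \gamma=\frac{\pi}{2\arctan(\epsilon U_{max})},\quad \bar\beta(t)=\alpha+\bar\theta,$$ where all gains and $\epsilon,\lambda_1,\lambda_2$ are positive, $\lambda_1\le F_{max}$ and $\lambda_2<\frac12\lambda_1k_{d,x}$. Let $\alpha_{min}=\arccos\frac{U_{max}}{Mg}$, $\alpha_{max}=\arccos\frac{-U_{max}}{Mg}$ if $U_{max}<Mg$, and $\alpha_{min}=0$, $\alpha_{max}=\pi$ otherwise. Let $\mu>0$, $\bar x\in\mathbb R$, $\bar\alpha\in[\alpha_{min}+\mu,\alpha_{max}-\mu]$, and let $\bar\beta=\bar\alpha+\sigma_{\pi/2}(\gamma\arctan(\epsilon Mg\cos\bar\alpha))$ be the resulting steady-state attitude. Write $\tilde\theta=\beta-\bar\beta(t)$ and $\tilde\alpha=\alpha-\bar\alpha$. Let $\gamma_{in}$ be the $L^1$ norm of the impulse response of the (unsaturated) inner loop $\dot{\tilde\beta}=\dot\beta-\dot{\bar\beta}$, $\mathcal I_u\ddot\beta=-k_{p,\beta}\tilde\beta-k_{d,\beta}\dot\beta$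 from $\dot{\bar\beta}$ to $\tilde\beta$. For $\tilde\theta_{max}\in(0,\pi/2)$ let $\gamma_{out}$ be the asymptotic gain from $\tilde\theta$ to $\dot{\bar\beta}$ (the least $\gamma\geq 0$ with $\limsup|\dot{\bar\beta}|\le\gamma\limsup|\tilde\theta|$ along all solutions) of the unsaturated outer loop $\mathcal I_0\ddot\alpha=u_1\sin(\bar\theta+\tilde\theta)-Mg\cos\alpha$ with continuous inputs $|\tilde\theta|\le\tilde\theta_{max}$. The small-gain bound is $$\sqrt{\tilde\theta(0)^2+\dot{\tilde\theta}(0)^2}+\gamma_{in}\sqrt{\tilde\alpha(0)^2+\dot\alpha(0)^2}<(1-\gamma_{in}\gamma_{out})\,\tilde\theta_{max}.\qquad(\ast)$$ Then there are $\theta_0\in(0,\pi/2)$ and $\gamma_0>0$ such that $\gamma_{out}$ is finite for all $\tilde\theta_{max}\in(0,\theta_0]$, there are arbitrarily large $k_{p,\beta},k_{d,\beta}$ with $\gamma_{in}<\gamma_0$, and for all $k_{p,\beta},k_{d,\beta}>0$ with $\gamma_{in}<\gamma_0$, in presence of the saturations: 1. $\gamma_{in}\gamma_{out}<1$ for all $\tilde\theta_{max}\in(0,\theta_0]$;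 2. the point of equilibrium $[\bar x,\bar\alpha,\bar\beta]^T$ (with zero velocities) is asymptotically stable for the saturated closed loop (solutions exist for all $t\ge0$ and all initial states, and the point is Lyapunov stable and locally attractive); 3. for all $\tilde\theta_{max}\in(0,\theta_0]$, every solution whose initial condition satisfies $(\ast)$ and along which no command exceeds its saturation limits converges to the equilibrium; 4. there are $\theta_1\in(0,\theta_0]$ and $r>0$ such that for all $\tilde\theta_{max}\in(0,\theta_1]$, every solution whose initial condition satisfies $(\ast)$, $|x(0)-\bar x|<r$ and $|\dot x(0)|<r$ never exceeds the saturation limits and converges to the equilibrium. -/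

import Mathlib

open Set Filter Topology

noncomputable section

namespace UavUgv

/-! ### Saturation functions -/

/-- The saturation `sign(x) min(|x|, l)`. -/
def sat (l x : ℝ) : ℝ := Real.sign x * min |x| l

/-- The positive saturation: it takes its values in `[0, l]`. -/
def posSat (l x : ℝ) : ℝ := if 0 ≤ x then sat l x else 0

/-! ### Physical data and controller parameters -/

/-- Physical data of the UAV (mass `mu`, inertia `Iu`), the UGV (mass `mc`), the object
(mass `mb`, inertia `Ib`, length `L`, distance `dG` of its centre of mass from the UGV), the
gravity acceleration, and the actuator limits. -/
structure Plant where
  mu : ℝ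
  mc : ℝ
  mb : ℝ
  Iu : ℝ
  Ib : ℝ
  L : ℝ
  dG : ℝ
  g : ℝ
  Umax : ℝ
  Tmax : ℝ
  Fmax : ℝ
  mu_pos : 0 < mu
  mc_pos : 0 < mc
  mb_pos : 0 < mb
  Iu_pos : 0 < Iu
  Ib_pos : 0 < Ib
  L_pos : 0 < L
  dG_pos : 0 < dG
  g_pos : 0 < g
  Umax_pos : 0 < Umax
  Tmax_pos : 0 < Tmax
  Fmax_pos : 0 < Fmax

/-- Apparent mass `M` of the UAV and the object. -/
def Plant.M (p : Plant) : ℝ := p.mb * p.dG / p.L + p.mu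

/-- Moment of inertia of UAV and object divided by the length of the object. -/
def Plant.I0 (p : Plant) : ℝ := (p.mb * p.dG ^ 2 + p.Ib) / p.L + p.mu * p.L

/-- Smallest attainable equilibrium inclination. -/
def Plant.alphaMin (p : Plant) : ℝ :=
  if p.Umax < p.M * p.g then Real.arccos (p.Umax / (p.M * p.g)) else 0

/-- Largest attainable equilibrium inclination. -/
def Plant.alphaMax (p : Plant) : ℝ :=
  if p.Umax < p.M * p.g then Real.arccos (-p.Umax / (p.M * p.g)) else Real.pi

/-- Parameters of the UGV controller (`l1`, `l2`, `kpx`, `kdx`) and of the outer loop of the UAV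
controller (`kpa`, `kda`, `eps`). -/
structure Gains (p : Plant) where
  l1 : ℝ
  l2 : ℝ
  kpx : ℝ
  kdx : ℝ
  kpa : ℝ
  kda : ℝ
  eps : ℝ
  l1_pos : 0 < l1
  l2_pos : 0 < l2
  kpx_pos : 0 < kpx
  kdx_pos : 0 < kdx
  kpa_pos : 0 < kpa
  kda_pos : 0 < kda
  eps_pos : 0 < eps
  l1_le : l1 ≤ p.Fmax
  l2_lt : l2 < 1 / 2 * l1 * kdx

variable {p : Plant}

/-! ### Outer-loop control law -/

/-- The constant `γ = π / (2 arctan (ε Umax))` of the attitude mapping. -/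
def Gains.gam (c : Gains p) : ℝ := Real.pi / (2 * Real.arctan (c.eps * p.Umax))

/-- The desired relative attitude as a function of the desired tangential force. -/
def Gains.thetaRef (c : Gains p) (f : ℝ) : ℝ :=
  sat (Real.pi / 2) (c.gam * Real.arctan (c.eps * f))

/-- The commanded thrust `f / sin (thetaRef f)`, continuously extended to `f = 0`. -/
def Gains.thrust (c : Gains p) (f : ℝ) : ℝ :=
  if f = 0 then 1 / (c.gam * c.eps) else f / Real.sin (c.thetaRef f)

/-- The desired tangential force: PD with gravity compensation. Here `ab` is the desired
inclination, `a` the inclination and `v` its rate. -/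
def Gains.force (c : Gains p) (ab a v : ℝ) : ℝ :=
  -c.kpa * (a - ab) - c.kda * v + p.M * p.g * Real.cos a

/-- The desired UAV attitude `a + thetaRef f`. -/
def Gains.betaRef (c : Gains p) (ab a v : ℝ) : ℝ := a + c.thetaRef (c.force ab a v)

/-- Time derivative of the desired UAV attitude when the inclination, its rate and its
acceleration are `a`, `v`, `w` (chain rule; `thetaRef` is differentiable except where
`|f| = Umax`). -/
def Gains.betaRefRate (c : Gains p) (ab a v w : ℝ) : ℝ :=
  v + deriv c.thetaRef (c.force ab a v) *
    (-c.kpa * v - c.kda * w - p.M * p.g * Real.sin a * v)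

/-- The steady-state attitude belonging to the desired inclination `ab`. -/
def Gains.betaEq (c : Gains p) (ab : ℝ) : ℝ := c.betaRef ab ab 0

/-! ### The closed loop with actuator saturations

A state is `s = (x, x', α, α', β, β')`. The references are `xb` and `ab`; the gains of the
attitude PD controller are `kp` and `kd`. -/

/-- Commanded thrust. -/
def cmd1 (c : Gains p) (ab : ℝ) (s : Fin 6 → ℝ) : ℝ := c.thrust (c.force ab (s 2) (s 3))

/-- Commanded torque. -/
def cmd2 (c : Gains p) (ab kp kd : ℝ) (s : Fin 6 → ℝ) : ℝ :=
  -kp * (s 4 - c.betaRef ab (s 2) (s 3)) - kd * s 5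

/-- Commanded force of the UGV. -/
def cmd3 (c : Gains p) (xb : ℝ) (s : Fin 6 → ℝ) : ℝ :=
  -sat c.l1 (c.kdx * s 1 + sat c.l2 (c.kpx * (s 0 - xb)))

/-- The commands respect the actuator limits, i.e. no saturation is active at the state `s`. -/
def Unsaturated (c : Gains p) (xb ab kp kd : ℝ) (s : Fin 6 → ℝ) : Prop :=
  (0 ≤ cmd1 c ab s ∧ cmd1 c ab s ≤ p.Umax) ∧ |cmd2 c ab kp kd s| ≤ p.Tmax ∧
    |cmd3 c xb s| ≤ p.Fmax

/-- Acceleration of the UGV. -/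
def accX (c : Gains p) (xb : ℝ) (s : Fin 6 → ℝ) : ℝ := sat p.Fmax (cmd3 c xb s) / p.mc

/-- Angular acceleration of the object. -/
def accA (c : Gains p) (xb ab : ℝ) (s : Fin 6 → ℝ) : ℝ :=
  (posSat p.Umax (cmd1 c ab s) * Real.sin (s 4 - s 2)
    - p.M * (-Real.sin (s 2) * accX c xb s + Real.cos (s 2) * p.g)) / p.I0

/-- Angular acceleration of the UAV. -/
def accB (c : Gains p) (ab kp kd : ℝ) (s : Fin 6 → ℝ) : ℝ :=
  sat p.Tmax (cmd2 c ab kp kd s) / p.Iu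

/-- The vector field of the closed loop with saturated actuators. -/
def closedLoop (c : Gains p) (xb ab kp kd : ℝ) (s : Fin 6 → ℝ) : Fin 6 → ℝ :=
  ![s 1, accX c xb s, s 3, accA c xb ab s, s 5, accB c ab kp kd s]

/-- The equilibrium `(xb, 0, ab, 0, betaEq ab, 0)`. -/
def eqState (c : Gains p) (xb ab : ℝ) : Fin 6 → ℝ := ![xb, 0, ab, 0, c.betaEq ab, 0]

/-! ### Solutions and asymptotic stability -/

/-- `φ` solves `φ' = F φ` on `[0, ∞)`. -/
def IsSolution {n : ℕ} (F : (Fin n → ℝ) → Fin n → ℝ) (φ : ℝ → Fin n → ℝ) : Prop :=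
  ∀ t, 0 ≤ t → HasDerivWithinAt φ (F (φ t)) (Ici 0) t

/-- Asymptotic stability of the point `e` for `φ' = F φ`: solutions exist for all positive times,
`e` is stable in the sense of Lyapunov, and it attracts all solutions starting near it. -/
def AsymptoticallyStable {n : ℕ} (F : (Fin n → ℝ) → Fin n → ℝ) (e : Fin n → ℝ) : Prop :=
  (∀ s, ∃ φ, IsSolution F φ ∧ φ 0 = s) ∧
  (∀ r > 0, ∃ δ > 0, ∀ φ, IsSolution F φ → ‖φ 0 - e‖ < δ → ∀ t, 0 ≤ t → ‖φ t - e‖ < r) ∧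
  (∃ δ > 0, ∀ φ, IsSolution F φ → ‖φ 0 - e‖ < δ → Tendsto φ atTop (𝓝 e))

/-! ### Gains of the inner and the outer loop -/

/-- State matrix of the inner loop, with state (attitude error, attitude rate). -/
def innerMatrix (p : Plant) (kp kd : ℝ) : Matrix (Fin 2) (Fin 2) ℝ :=
  !![0, 1; -kp / p.Iu, -kd / p.Iu]

/-- The gain of the inner loop from the rate of the desired attitude to the attitude error:
the `L¹` norm of the impulse response. -/
def gammaIn (p : Plant) (kp kd : ℝ) : ℝ :=
  ∫ t in Ioi (0 : ℝ), |(NormedSpace.exp (t • innerMatrix p kp kd)) 0 0|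

/-- Angular acceleration of the object in the outer loop (no actuator limit, no UGV acceleration)
when the attitude error is `b`. -/
def Gains.outerAcc (c : Gains p) (ab a v b : ℝ) : ℝ :=
  (c.thrust (c.force ab a v) * Real.sin (c.thetaRef (c.force ab a v) + b)
    - p.M * p.g * Real.cos a) / p.I0

/-- `γ` is an asymptotic gain of the outer loop from the attitude error `b`, restricted to
`[-θm, θm]`, to the rate of the desired attitude: the upper limit of the latter is at most
`γ` times that of `|b|`. -/
def Gains.IsOuterGain (c : Gains p) (ab θm γ : ℝ) : Prop :=
  0 ≤ γ ∧ ∀ a v b : ℝ → ℝ, ContinuousOn b (Ici 0) → (∀ t, 0 ≤ t → |b t| ≤ θm) →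
    (∀ t, 0 ≤ t → HasDerivWithinAt a (v t) (Ici 0) t) →
    (∀ t, 0 ≤ t → HasDerivWithinAt v (c.outerAcc ab (a t) (v t) (b t)) (Ici 0) t) →
    ∀ k, (∀ᶠ t in atTop, |b t| ≤ k) → ∀ η > 0, ∀ᶠ t in atTop,
      |c.betaRefRate ab (a t) (v t) (c.outerAcc ab (a t) (v t) (b t))| ≤ γ * k + η

/-- The asymptotic gain of the outer loop (meaningful when some finite gain exists). -/
def Gains.gammaOut (c : Gains p) (ab θm : ℝ) : ℝ := sInf {γ | c.IsOuterGain ab θm γ}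

/-! ### The small-gain bound on the initial condition -/

/-- Attitude error at the state `s`. -/
def attErr (c : Gains p) (ab : ℝ) (s : Fin 6 → ℝ) : ℝ := s 4 - c.betaRef ab (s 2) (s 3)

/-- Rate of the attitude error at the state `s`. -/
def attErrRate (c : Gains p) (xb ab : ℝ) (s : Fin 6 → ℝ) : ℝ :=
  s 5 - c.betaRefRate ab (s 2) (s 3) (accA c xb ab s)

/-- The small-gain bound at the state `s`. -/
def SmallGain (c : Gains p) (xb ab kp kd θm : ℝ) (s : Fin 6 → ℝ) : Prop :=
  √(attErr c ab s ^ 2 + attErrRate c xb ab s ^ 2)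
      + gammaIn p kp kd * √((s 2 - ab) ^ 2 + s 3 ^ 2)
    < (1 - gammaIn p kp kd * c.gammaOut ab θm) * |θm|

end UavUgv

end

namespace UavUgv

/-! ### Differential inequalities on the half-line -/

/-! The attitude mapping is built so that `thrust f * sin (thetaRef f) = f`
(`Gains.thrust_mul_sin`). With exact attitude tracking and a UGV that does not accelerate, gravity
cancels and the inclination is a linear damped oscillator. An attitude error b changes the
tangential force by at most (|f| + Umax) min(|b|, 2), so the outer loop is input-to-state stable
(`second_order_bound`) with a linear gain from b to the rate of the desired attitude. The inner loop
is linear; variation of constants gives it the gain `gammaIn` (`inner_bound`), which becomes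
arbitrarily small as its poles move to the left (`gammaIn_le_two_div`). The outer constants do not
depend on `kp` and `kd`, so γ₀ can be fixed before the attitude gains, and a small-gain argument
closes the loop.

Two facts keep the argument from being circular. By concavity of arctan and Jordan's inequality, the
commanded thrust is at most Umax exactly when |f| ≤ Umax. Hence along an unsaturated solution the
perturbation is at most 2 Umax min(|b|, 2) however large b is: boundedness comes for free, and
limsup |b| ≤ γ_in Γ limsup |b| with γ_in Γ < 1 forces b → 0 (`exists_tendsto_of_unsaturated`).
Moreover the UGV acceleration, which also perturbs the outer loop, vanishes asymptotically, because
the saturated double integrator converges globally (`SatIntegrator.tendsto_zero`).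

For local stability, the margin μ gives |M g cos ᾱ| < Umax, so no saturation is active near the
equilibrium. The same gains applied to maxima over [0, T] yield a linear bound with a constant
independent of T (`exists_linear_bound`), and a continuity argument keeps the solution in that
neighbourhood. Such solutions are unsaturated for all time and therefore converge. For small θ̃_max
and a UGV close to its target, the bound (∗) confines the initial state to this neighbourhood
(`exists_norm_lt_of_smallGain`). Solutions exist globally because the saturated vector field is
globally Lipschitz. -/

/-- `f'` is the derivative of `f` on `[0, ∞)`, one-sided at `0`. -/
def HasFwdDeriv (f f' : ℝ → ℝ) : Prop :=
  ∀ t, 0 ≤ t → HasDerivWithinAt f (f' t) (Ici 0) t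

theorem HasFwdDeriv.continuousOn {f f' : ℝ → ℝ} (h : HasFwdDeriv f f') {s T : ℝ} (hs : 0 ≤ s) :
    ContinuousOn f (Icc s T) := fun t ht =>
  ((h t (hs.trans ht.1)).continuousWithinAt).mono fun _ hx => hs.trans hx.1

theorem HasFwdDeriv.right {f f' : ℝ → ℝ} (h : HasFwdDeriv f f') {t : ℝ} (ht : 0 ≤ t) :
    HasDerivWithinAt f (f' t) (Ici t) t := (h t ht).mono (Ici_subset_Ici.2 ht)

/-- Grönwall's inequality: with the integrating factor, (V − D/c) e^{c(t−s)} is nonincreasing. -/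
theorem le_exp_mul_add_of_deriv_le {V V' : ℝ → ℝ} (hV : HasFwdDeriv V V') {c D s T : ℝ}
    (hc : 0 < c) (hD : 0 ≤ D) (hs : 0 ≤ s)
    (h : ∀ t ∈ Icc s T, V' t ≤ -c * V t + D) {t : ℝ} (ht : t ∈ Icc s T) :
    V t ≤ Real.exp (-c * (t - s)) * V s + D / c := by
  have hE : ∀ x : ℝ, HasDerivAt (fun y => Real.exp (c * (y - s))) (Real.exp (c * (x - s)) * c) x := by
    intro x
    have := (((hasDerivAt_id x).sub_const s).const_mul c).exp
    simpa using this
  have key := image_le_of_deriv_right_le_deriv_boundary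
    (f := fun y => (V y - D / c) * Real.exp (c * (y - s)))
    (f' := fun y => V' y * Real.exp (c * (y - s)) + (V y - D / c) * (Real.exp (c * (y - s)) * c))
    (a := s) (b := T) (B := fun _ => V s - D / c) (B' := fun _ => 0)
    (((hV.continuousOn hs).sub continuousOn_const).mul (by fun_prop))
    (fun x hx => (((hV.right (hs.trans hx.1)).sub_const _).mul (hE x).hasDerivWithinAt))
    (by simp) continuousOn_const (fun x _ => hasDerivWithinAt_const _ _ _)
    (by
      intro x hx
      have h1 := h x ⟨hx.1, hx.2.le⟩
      have h2 : V' x * Real.exp (c * (x - s)) + (V x - D / c) * (Real.exp (c * (x - s)) * c)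
        = (V' x - (-c * V x + D)) * Real.exp (c * (x - s)) := by field_simp; ring
      rw [h2]
      exact mul_nonpos_of_nonpos_of_nonneg (by linarith) (Real.exp_pos _).le) ht
  have h3 : (V t - D / c) * Real.exp (c * (t - s)) * Real.exp (-c * (t - s)) = V t - D / c := by
    rw [mul_assoc, ← Real.exp_add]; simp
  have h4 := mul_le_mul_of_nonneg_right key (Real.exp_pos (-c * (t - s))).le
  rw [h3] at h4
  have h5 : 0 ≤ D / c * Real.exp (-c * (t - s)) := by positivity
  nlinarith

/-! ### The damped oscillator and its quadratic Lyapunov function. -/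

theorem abs_add_abs_sq_le (x y : ℝ) : (|x| + |y|) ^ 2 ≤ 2 * (x ^ 2 + y ^ 2) := by
  rw [← sq_abs x, ← sq_abs y]; nlinarith [sq_nonneg (|x| - |y|)]

theorem sq_le_abs_add_abs_sq (x y : ℝ) : x ^ 2 ≤ (|x| + |y|) ^ 2 := by
  rw [← sq_abs x]; nlinarith [abs_nonneg x, abs_nonneg y]

/-- A quadratic Lyapunov function of the damped oscillator `a'' + Q a' + P a = 0`. -/
noncomputable def oscEnergy (P Q a v : ℝ) : ℝ :=
  v ^ 2 / 2 + P / 2 * a ^ 2 + Q / 2 * (a * v) + Q ^ 2 / 4 * a ^ 2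

theorem oscEnergy_lower {P Q m : ℝ} (hm : 0 < m) (h1 : 2 * m ≤ 1 / 4) (h2 : 2 * m ≤ P / 2)
    (a v : ℝ) : m * (|a| + |v|) ^ 2 ≤ oscEnergy P Q a v := by
  have e1 : oscEnergy P Q a v = v ^ 2 / 4 + P / 2 * a ^ 2 + (v + Q * a) ^ 2 / 4 := by
    unfold oscEnergy; ring
  have e2 : m * (|a| + |v|) ^ 2 ≤ m * (2 * (a ^ 2 + v ^ 2)) := by
    gcongr; exact abs_add_abs_sq_le a v
  have e3 : 2 * m * v ^ 2 ≤ 1 / 4 * v ^ 2 := by gcongr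
  have e4 : 2 * m * a ^ 2 ≤ P / 2 * a ^ 2 := by gcongr
  have e5 := sq_nonneg (v + Q * a)
  rw [e1]
  linarith

theorem oscEnergy_upper {P Q : ℝ} (hP : 0 < P) (a v : ℝ) :
    oscEnergy P Q a v ≤ (3 / 4 + P / 2 + Q ^ 2 / 2) * (|a| + |v|) ^ 2 := by
  have h1 := sq_le_abs_add_abs_sq a v
  have h2 := sq_le_abs_add_abs_sq v a
  rw [add_comm |v|] at h2
  have h3 : oscEnergy P Q a v ≤ 3 / 4 * v ^ 2 + (P / 2 + Q ^ 2 / 2) * a ^ 2 := by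
    unfold oscEnergy; nlinarith [sq_nonneg (v - Q * a)]
  have h4 : (P / 2 + Q ^ 2 / 2) * a ^ 2 ≤ (P / 2 + Q ^ 2 / 2) * (|a| + |v|) ^ 2 := by gcongr
  linarith

/-- The left side is the derivative of `oscEnergy` when d is the deviation from the oscillator
equation. The quadratic terms give −(n/2)S² with S = |a| + |v|; the linear part of d costs (n/8)S²,
and Young's inequality for D costs another (n/8)S². -/
theorem oscEnergy_dissipation {P Q n D d a v : ℝ} (hQ : 0 < Q) (hn : 0 < n)
    (h1 : n ≤ Q / 2) (h2 : n ≤ P * Q / 2)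
    (hd : |d| ≤ n / (8 * (1 + Q)) * (|a| + |v|) + D) :
    -(Q / 2) * v ^ 2 - P * Q / 2 * a ^ 2 + (v + Q / 2 * a) * d
      ≤ -(n / 4) * (|a| + |v|) ^ 2 + 2 * (1 + Q) ^ 2 / n * D ^ 2 := by
  have e5 := abs_add_abs_sq_le a v
  have ea : |v + Q / 2 * a| ≤ (1 + Q) * (|a| + |v|) := by
    calc _ ≤ |v| + |Q / 2 * a| := abs_add_le _ _
      _ = |v| + Q / 2 * |a| := by rw [abs_mul, abs_of_pos (by positivity : 0 < Q / 2)]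
      _ ≤ _ := by nlinarith [abs_nonneg a, abs_nonneg v]
  obtain ⟨S, hS⟩ : ∃ S, S = |a| + |v| := ⟨_, rfl⟩
  rw [← hS] at hd e5 ea ⊢
  have hS0 : 0 ≤ S := by rw [hS]; positivity
  have e2 : (v + Q / 2 * a) * d ≤ (1 + Q) * S * (n / (8 * (1 + Q)) * S + D) :=
    (le_abs_self _).trans ((abs_mul _ _).le.trans
      (mul_le_mul ea hd (abs_nonneg _) (by positivity)))
  have e3 : (1 + Q) * S * (n / (8 * (1 + Q)) * S + D) = n / 8 * S ^ 2 + S * ((1 + Q) * D) := by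
    field_simp
  have e4 : n / 8 * S ^ 2 + 2 * (1 + Q) ^ 2 / n * D ^ 2 - S * ((1 + Q) * D)
      = n / 8 * (S - 4 / n * ((1 + Q) * D)) ^ 2 := by field_simp; ring
  have e6 : 0 ≤ n / 8 * (S - 4 / n * ((1 + Q) * D)) ^ 2 := by positivity
  have e7 : n * v ^ 2 ≤ Q / 2 * v ^ 2 := by gcongr
  have e8 : n * a ^ 2 ≤ P * Q / 2 * a ^ 2 := by gcongr
  have e9 : n * S ^ 2 ≤ n * (2 * (a ^ 2 + v ^ 2)) := by gcongr
  linarith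

theorem HasFwdDeriv.oscEnergy {a v v' : ℝ → ℝ} (ha : HasFwdDeriv a v) (hv : HasFwdDeriv v v')
    (P Q : ℝ) : HasFwdDeriv (fun t => oscEnergy P Q (a t) (v t)) (fun t =>
      -(Q / 2) * v t ^ 2 - P * Q / 2 * a t ^ 2
        + (v t + Q / 2 * a t) * (v' t + P * a t + Q * v t)) := by
  intro t ht
  have h1 := ha t ht
  have h2 := hv t ht
  refine (((((h2.fun_pow 2).div_const 2).fun_add ((h1.fun_pow 2).const_mul (P / 2))).fun_add
    ((h1.fun_mul h2).const_mul (Q / 2))).fun_add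
      ((h1.fun_pow 2).const_mul (Q ^ 2 / 4))).congr_deriv ?_
  push_cast
  ring

/-- Square roots of the coefficients are avoided: C = 1 + A + B dominates both √A and √B. -/
theorem le_of_sq_le_combination {S S₀ D A B C e : ℝ} (hS₀ : 0 ≤ S₀) (hD : 0 ≤ D) (he : 0 ≤ e)
    (hA : 0 ≤ A) (hB : 0 ≤ B) (hC : C = 1 + A + B)
    (h : S ^ 2 ≤ A * (e * S₀) ^ 2 + B * D ^ 2) : S ≤ C * e * S₀ + C * D := by
  have hC0 : 0 ≤ C := by linarith
  have f3 : A ≤ C ^ 2 := by nlinarith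
  have f4 : B ≤ C ^ 2 := by nlinarith
  have f5 : S ^ 2 ≤ (C * e * S₀ + C * D) ^ 2 := by
    have g1 : A * (e * S₀) ^ 2 ≤ C ^ 2 * (e * S₀) ^ 2 := by gcongr
    have g2 : B * D ^ 2 ≤ C ^ 2 * D ^ 2 := by gcongr
    have g3 : 0 ≤ C * e * S₀ * (C * D) := by positivity
    nlinarith
  exact (le_abs_self S).trans (abs_le_of_sq_le_sq f5 (by positivity))

/-- The damped oscillator is input-to-state stable, also under perturbations with a small linear
gain. -/
theorem second_order_bound {P Q : ℝ} (hP : 0 < P) (hQ : 0 < Q) :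
    ∃ κ > 0, ∃ c > 0, ∃ C > 0, ∀ a v v' : ℝ → ℝ, HasFwdDeriv a v → HasFwdDeriv v v' →
      ∀ s T D : ℝ, 0 ≤ s → 0 ≤ D →
      (∀ t ∈ Icc s T, |v' t + P * a t + Q * v t| ≤ κ * (|a t| + |v t|) + D) →
      ∀ t ∈ Icc s T,
        |a t| + |v t| ≤ C * Real.exp (-c * (t - s)) * (|a s| + |v s|) + C * D := by
  obtain ⟨n, hn, hn1, hn2⟩ : ∃ n > 0, n ≤ Q / 2 ∧ n ≤ P * Q / 2 :=
    ⟨min (Q / 2) (P * Q / 2), by positivity, min_le_left _ _, min_le_right _ _⟩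
  obtain ⟨m, hm, hm1, hm2⟩ : ∃ m > 0, 2 * m ≤ 1 / 4 ∧ 2 * m ≤ P / 2 := by
    refine ⟨min (1 / 4) (P / 2) / 2, by positivity, ?_, ?_⟩
    · linarith [min_le_left (1 / 4) (P / 2)]
    · linarith [min_le_right (1 / 4) (P / 2)]
  obtain ⟨N, hN⟩ : ∃ N, N = 3 / 4 + P / 2 + Q ^ 2 / 2 := ⟨_, rfl⟩
  have hN0 : 0 < N := by rw [hN]; positivity
  obtain ⟨c, hc⟩ : ∃ c, c = n / (4 * N) := ⟨_, rfl⟩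
  have hc0 : 0 < c := by rw [hc]; positivity
  obtain ⟨E, hE⟩ : ∃ E, E = 2 * (1 + Q) ^ 2 / n := ⟨_, rfl⟩
  have hE0 : 0 < E := by rw [hE]; positivity
  -- The energy is quadratic in |a| + |v|, so its decay rate c becomes c / 2 for the state.
  refine ⟨n / (8 * (1 + Q)), by positivity, c / 2, by positivity,
    1 + N / m + E / (c * m), by positivity, ?_⟩
  intro a v v' ha hv s T D hs hD hd t ht
  have key := le_exp_mul_add_of_deriv_le (ha.oscEnergy hv P Q) (c := c) (D := E * D ^ 2)
    (s := s) (T := T) hc0 (by positivity) hs (by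
      intro t ht
      have e1 := oscEnergy_dissipation hQ hn hn1 hn2 (hd t ht)
      have e2 : c * oscEnergy P Q (a t) (v t) ≤ n / 4 * (|a t| + |v t|) ^ 2 := by
        calc _ ≤ c * (N * (|a t| + |v t|) ^ 2) := by
              gcongr; rw [hN]; exact oscEnergy_upper hP _ _
          _ = _ := by rw [hc]; field_simp
      rw [← hE] at e1
      linarith) ht
  have hlo := oscEnergy_lower (Q := Q) hm hm1 hm2 (a t) (v t)
  have hhi := oscEnergy_upper (Q := Q) hP (a s) (v s)
  rw [← hN] at hhi
  obtain ⟨e, he⟩ : ∃ e, e = Real.exp (-(c / 2) * (t - s)) := ⟨_, rfl⟩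
  have he0 : 0 < e := he ▸ Real.exp_pos _
  have hee : Real.exp (-c * (t - s)) = e ^ 2 := by
    rw [he, ← Real.exp_nat_mul]; congr 1; push_cast; ring
  rw [hee] at key
  rw [← he]
  refine le_of_sq_le_combination (by positivity) hD he0.le (by positivity : 0 ≤ N / m)
    (by positivity : 0 ≤ E / (c * m)) rfl ?_
  have f1 : m * (|a t| + |v t|) ^ 2 ≤ e ^ 2 * (N * (|a s| + |v s|) ^ 2) + E * D ^ 2 / c :=
    hlo.trans (key.trans (by gcongr))
  rw [← mul_le_mul_iff_right₀ hm]
  refine f1.trans (le_of_eq ?_)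
  field_simp

/-- With u = w' + Q w, completing the square gives (w²)' = 2w(u − Qw) ≤ −Q w² + D²/Q. -/
theorem first_order_bound {Q : ℝ} (hQ : 0 < Q) {w w' : ℝ → ℝ} (hw : HasFwdDeriv w w')
    {s T D : ℝ} (hs : 0 ≤ s) (hD : 0 ≤ D) (h : ∀ t ∈ Icc s T, |w' t + Q * w t| ≤ D)
    {t : ℝ} (ht : t ∈ Icc s T) :
    |w t| ≤ Real.exp (-(Q / 2) * (t - s)) * |w s| + D / Q := by
  have hV : HasFwdDeriv (fun t => w t ^ 2) (fun t => 2 * w t * w' t) := by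
    intro t ht
    simpa using (hw t ht).fun_pow 2
  have key := le_exp_mul_add_of_deriv_le hV (c := Q) (D := D ^ 2 / Q) (s := s) (T := T) hQ
    (by positivity) hs (by
      intro t ht
      set u := w' t + Q * w t with hu
      have e1 : w' t = u - Q * w t := by rw [hu]; ring
      have e2 : u ^ 2 ≤ D ^ 2 := sq_le_sq' (abs_le.1 (h t ht)).1 (abs_le.1 (h t ht)).2
      have e3 : D ^ 2 / Q - u ^ 2 / Q ≥ 0 := by
        rw [← sub_div]; exact div_nonneg (by linarith) hQ.le
      have e4 : Q * w t ^ 2 - 2 * w t * u + u ^ 2 / Q = Q * (w t - u / Q) ^ 2 := by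
        field_simp; ring
      have e5 : 0 ≤ Q * (w t - u / Q) ^ 2 := by positivity
      rw [e1]
      nlinarith) ht
  set e := Real.exp (-(Q / 2) * (t - s)) with he
  have he0 : 0 < e := Real.exp_pos _
  have hee : Real.exp (-Q * (t - s)) = e ^ 2 := by
    rw [he, ← Real.exp_nat_mul]; congr 1; push_cast; ring
  simp only [hee] at key
  have h1 : D ^ 2 / Q / Q = (D / Q) ^ 2 := by field_simp
  rw [h1] at key
  have h2 : |w t| ^ 2 ≤ (e * |w s| + D / Q) ^ 2 := by
    rw [sq_abs]
    rw [← sq_abs (w s)] at key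
    have : 0 ≤ e * |w s| * (D / Q) := by positivity
    nlinarith
  exact (pow_le_pow_iff_left₀ (abs_nonneg _) (by positivity) (by norm_num)).1 h2

/-! ### Asymptotic bounds, contraction and a compactness lemma. -/

theorem eventually_le_of_exp_bound {f : ℝ → ℝ} {A c B s : ℝ} (hc : 0 < c)
    (h : ∀ t, s ≤ t → f t ≤ A * Real.exp (-c * (t - s)) + B) {η : ℝ} (hη : 0 < η) :
    ∀ᶠ t in atTop, f t ≤ B + η := by
  have h1 : Tendsto (fun t => A * Real.exp (-c * (t - s))) atTop (𝓝 (A * 0)) := by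
    refine Tendsto.const_mul _ (Real.tendsto_exp_atBot.comp ?_)
    exact (tendsto_atTop_add_const_right _ (-s) tendsto_id).const_mul_atTop_of_neg (by linarith)
  rw [mul_zero] at h1
  filter_upwards [h1.eventually (gt_mem_nhds hη), eventually_ge_atTop s] with t h2 h3
  linarith [h t h3]

/-- The infimum of the eventual bounds of |y| plays the role of limsup |y|. It is at most γ times
itself, hence zero. -/
theorem tendsto_zero_of_contraction {y : ℝ → ℝ} {γ : ℝ} (hγ : 0 ≤ γ) (hγ1 : γ < 1)
    (hb : ∃ k, ∀ᶠ t in atTop, |y t| ≤ k)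
    (h : ∀ k, (∀ᶠ t in atTop, |y t| ≤ k) → ∀ η > 0, ∀ᶠ t in atTop, |y t| ≤ γ * k + η) :
    Tendsto y atTop (𝓝 0) := by
  set S := {k | ∀ᶠ t in atTop, |y t| ≤ k} with hS
  have hpos : ∀ k ∈ S, 0 ≤ k := fun k hk => by
    obtain ⟨t, ht⟩ := hk.exists
    exact (abs_nonneg _).trans ht
  have hbdd : BddBelow S := ⟨0, fun k hk => hpos k hk⟩
  have h0 : 0 ≤ sInf S := le_csInf hb hpos
  have hle : sInf S ≤ 0 := by
    by_contra! hlt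
    obtain ⟨k, hk, hk2⟩ := exists_lt_of_csInf_lt (s := S) hb
      (show sInf S < sInf S + (1 - γ) * sInf S / 2 by nlinarith)
    have := csInf_le hbdd (h k hk ((1 - γ) * sInf S / 4) (by nlinarith))
    have : γ * k ≤ γ * (sInf S + (1 - γ) * sInf S / 2) := by gcongr
    nlinarith [mul_pos (sub_pos.2 hγ1) hlt]
  rw [Metric.tendsto_atTop']
  intro ε hε
  obtain ⟨k, hk, hk2⟩ := exists_lt_of_csInf_lt (s := S) hb (show sInf S < ε by linarith)
  obtain ⟨N, hN⟩ := eventually_atTop.1 hk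
  exact ⟨N, fun t ht => by simpa using (hN t ht.le).trans_lt hk2⟩

/-- The open sets where p < n|q| increase with n and cover K, so a single n serves all of K; the
maximum of p − nq on K is then negative. This turns "p < 0 wherever the dissipation q vanishes" into
a strict Lyapunov function. -/
theorem exists_sub_mul_le_neg {X : Type*} [TopologicalSpace X] {K : Set X} (hK : IsCompact K)
    {p q : X → ℝ} (hpc : Continuous p) (hqc : Continuous q) (hq : ∀ x ∈ K, 0 ≤ q x)
    (hp : ∀ x ∈ K, q x = 0 → p x < 0) :
    ∃ A, 0 ≤ A ∧ ∃ η > 0, ∀ x ∈ K, p x - A * q x ≤ -η := by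
  obtain ⟨n, hn⟩ := hK.elim_directed_cover (fun n : ℕ => {x | p x - n * |q x| < 0})
    (fun n => isOpen_lt (by fun_prop) continuous_const)
    (by
      intro x hx
      rw [mem_iUnion]
      rcases (hq x hx).eq_or_lt with h | h
      · exact ⟨0, by simpa using hp x hx h.symm⟩
      · obtain ⟨n, hn⟩ := exists_nat_gt (p x / q x)
        refine ⟨n, ?_⟩
        rw [div_lt_iff₀ h] at hn
        simp only [mem_ofPred_eq, abs_of_pos h]; linarith)
    (directed_of_isDirected_le fun i j hij x hx => by
      simp only [mem_ofPred_eq] at hx ⊢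
      have : (i : ℝ) * |q x| ≤ j * |q x| := by gcongr
      linarith)
  refine ⟨n, n.cast_nonneg, ?_⟩
  rcases K.eq_empty_or_nonempty with rfl | hne
  · exact ⟨1, one_pos, by simp⟩
  · obtain ⟨x, hx, hmax⟩ := hK.exists_isMaxOn hne
      (f := fun x => p x - n * q x) (by fun_prop)
    refine ⟨-(p x - n * q x), ?_, fun y hy => by simpa using hmax hy⟩
    have := hn hx
    simp only [mem_ofPred_eq, abs_of_nonneg (hq x hx)] at this
    linarith

/-! ### Global existence for Lipschitz vector fields -/

theorem exists_local_solution {E : Type*} [NormedAddCommGroup E] [NormedSpace ℝ E]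
    [CompleteSpace E] {F : E → E} {K : NNReal} (hF : LipschitzWith K F) (x : E) :
    ∃ α : ℝ → E, α 0 = x ∧ ∀ t ∈ Icc (0 : ℝ) (1 / (K + 1)),
      HasDerivWithinAt α (F (α t)) (Icc 0 (1 / (K + 1))) t := by
  have hT : (0 : ℝ) ≤ 1 / (K + 1) := by positivity
  -- On the ball of radius ‖F x‖ the field is bounded by (K + 1)‖F x‖, so the solution cannot leave
  -- it before time 1/(K + 1). This existence time does not depend on x, which makes concatenation
  -- possible.
  have hpl : IsPicardLindelof (fun _ => F) (tmin := 0) (tmax := 1 / (K + 1))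
      ⟨0, le_rfl, hT⟩ x ‖F x‖₊ 0 ((K + 1) * ‖F x‖₊) K := by
    refine IsPicardLindelof.of_time_independent ?_ hF.lipschitzOnWith ?_
    · intro y hy
      have h1 := hF.dist_le_mul y x
      rw [dist_eq_norm] at h1
      have h2 : (K : ℝ) * dist y x ≤ K * ‖F x‖ := by
        gcongr
        simpa using hy
      have h3 : ‖F y‖ ≤ ‖F y - F x‖ + ‖F x‖ := by simpa using norm_add_le (F y - F x) (F x)
      push_cast
      linarith
    · have : max ((1 : ℝ) / (K + 1) - 0) (0 - 0) = 1 / (K + 1) := by simp; positivity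
      simp only [this]
      push_cast
      field_simp
      simp
  exact hpl.exists_eq_forall_mem_Icc_hasDerivWithinAt₀

theorem exists_global_solution {E : Type*} [NormedAddCommGroup E] [NormedSpace ℝ E]
    [CompleteSpace E] {F : E → E} {K : NNReal} (hF : LipschitzWith K F) (x : E) :
    ∃ φ : ℝ → E, φ 0 = x ∧ ∀ t, 0 ≤ t → HasDerivWithinAt φ (F (φ t)) (Ici 0) t := by
  choose α hα0 hα using exists_local_solution hF
  obtain ⟨T, hT⟩ : ∃ T : ℝ, T = 1 / (K + 1) := ⟨_, rfl⟩
  rw [← hT] at hα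
  have hT0 : 0 < T := by rw [hT]; positivity
  set pt : ℕ → E := fun n => Nat.rec x (fun _ y => α y T) n with hpt
  have hpt1 : ∀ n, pt (n + 1) = α (pt n) T := fun n => rfl
  -- The pieces of length T are concatenated: `pt n` is the state reached at time n T.
  set φ : ℝ → E := fun t => α (pt ⌊t / T⌋₊) (t - ⌊t / T⌋₊ * T) with hφ
  have hpiece : ∀ n : ℕ, ∀ t ∈ Icc (n * T) (n * T + T), φ t = α (pt n) (t - n * T) := by
    intro n t ht
    rcases ht.2.lt_or_eq with h | h
    · have : ⌊t / T⌋₊ = n := by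
        rw [Nat.floor_eq_iff (div_nonneg (le_trans (by positivity) ht.1) hT0.le)]
        rw [le_div_iff₀ hT0, div_lt_iff₀ hT0]
        exact ⟨ht.1, by linarith⟩
      simp only [hφ, this]
    · have : ⌊t / T⌋₊ = n + 1 := by
        have : t / T = (n + 1 : ℕ) := by rw [h]; push_cast; field_simp
        rw [this, Nat.floor_natCast]
      simp only [hφ, this, hpt1]
      rw [h]
      push_cast
      rw [show (n : ℝ) * T + T - (n + 1) * T = 0 by ring, hα0,
        show (n : ℝ) * T + T - n * T = T by ring]
  have hder : ∀ n : ℕ, ∀ t ∈ Icc (n * T) (n * T + T),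
      HasDerivWithinAt φ (F (φ t)) (Icc (n * T) (n * T + T)) t := by
    intro n t ht
    rw [hpiece n t ht]
    have h1 := hα (pt n) (t - n * T) ⟨by linarith [ht.1], by linarith [ht.2]⟩
    have h2 : HasDerivWithinAt (fun s : ℝ => s - n * T) 1 (Icc (n * T) (n * T + T)) t :=
      (hasDerivWithinAt_id _ _).sub_const _
    have h3 := h1.scomp t h2 (t' := Icc 0 T)
      (fun s hs => ⟨by linarith [hs.1], by linarith [hs.2]⟩)
    rw [one_smul] at h3
    exact h3.congr (fun s hs => hpiece n s hs) (hpiece n t ht)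
  refine ⟨φ, ?_, fun t ht => ?_⟩
  · rw [hpiece 0 0 (by simp [hT0.le])]
    simp [hα0, hpt]
  · obtain ⟨n, hn⟩ : ∃ n : ℕ, n = ⌊t / T⌋₊ := ⟨_, rfl⟩
    have hn' := hn.symm
    rw [Nat.floor_eq_iff (div_nonneg ht hT0.le), le_div_iff₀ hT0, div_lt_iff₀ hT0] at hn'
    have hlt : t < n * T + T := by linarith [hn'.2]
    have hd := hder n t ⟨hn'.1, hlt.le⟩
    rcases hn'.1.lt_or_eq with h | h
    · exact (hd.hasDerivAt (Icc_mem_nhds h hlt)).hasDerivWithinAt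
    -- At a junction the one-sided derivatives of the two adjacent pieces agree; at t = 0 only the
    -- right one is needed.
    · rcases n with _ | m
      · refine hd.mono_of_mem_nhdsWithin ?_
        have : t = 0 := by simpa using h.symm
        subst this
        simpa using Icc_mem_nhdsGE (show (0 : ℝ) < 0 + T by linarith)
      · have ht' : t = m * T + T := by rw [← h]; push_cast; ring
        have hd2 := hder m t ⟨by linarith, by linarith⟩
        have ht2 : ((m + 1 : ℕ) : ℝ) * T = m * T + T := by push_cast; ring
        rw [ht2] at hd hlt
        have hu := hd2.union hd
        refine (hu.hasDerivAt ?_).hasDerivWithinAt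
        rw [Icc_union_Icc_eq_Icc (by linarith) (by linarith)]
        exact Icc_mem_nhds (by linarith) hlt

/-! ### Real-valued Lipschitz functions -/

/-- `f` is Lipschitz continuous with some constant. -/
def IsLip {X : Type*} [PseudoMetricSpace X] (f : X → ℝ) : Prop :=
  ∃ K : ℝ, 0 ≤ K ∧ ∀ x y, |f x - f y| ≤ K * dist x y

namespace IsLip

variable {X : Type*} [PseudoMetricSpace X] {f g : X → ℝ}

theorem continuous (hf : IsLip f) : Continuous f := by
  obtain ⟨K, hK, h⟩ := hf
  refine (LipschitzWith.of_dist_le_mul (K := K.toNNReal) fun x y => ?_).continuous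
  rw [Real.dist_eq, Real.coe_toNNReal _ hK]
  exact h x y

theorem const (c : ℝ) : IsLip (fun _ : X => c) := ⟨0, le_rfl, by simp⟩

theorem add (hf : IsLip f) (hg : IsLip g) : IsLip (fun x => f x + g x) := by
  obtain ⟨K, hK, h⟩ := hf
  obtain ⟨L, hL, h'⟩ := hg
  refine ⟨K + L, by positivity, fun x y => ?_⟩
  rw [add_sub_add_comm, add_mul]
  exact (abs_add_le _ _).trans (add_le_add (h x y) (h' x y))

theorem const_mul (hf : IsLip f) (c : ℝ) : IsLip (fun x => c * f x) := by
  obtain ⟨K, hK, h⟩ := hf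
  refine ⟨|c| * K, by positivity, fun x y => ?_⟩
  rw [← mul_sub, abs_mul, mul_assoc]
  exact mul_le_mul_of_nonneg_left (h x y) (abs_nonneg c)

theorem neg (hf : IsLip f) : IsLip (fun x => -f x) := by
  simpa using hf.const_mul (-1)

theorem sub (hf : IsLip f) (hg : IsLip g) : IsLip (fun x => f x - g x) := by
  simpa [sub_eq_add_neg] using hf.add hg.neg

theorem div_const (hf : IsLip f) (c : ℝ) : IsLip (fun x => f x / c) := by
  simpa [div_eq_inv_mul] using hf.const_mul c⁻¹

theorem comp {φ : ℝ → ℝ} (hφ : IsLip φ) (hf : IsLip f) : IsLip (fun x => φ (f x)) := by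
  obtain ⟨K, hK, h⟩ := hf
  obtain ⟨L, hL, h'⟩ := hφ
  refine ⟨L * K, by positivity, fun x y => ?_⟩
  refine (h' _ _).trans ?_
  rw [mul_assoc, Real.dist_eq]
  exact mul_le_mul_of_nonneg_left (h x y) hL

theorem mul (hf : IsLip f) (hg : IsLip g) {A B : ℝ} (hA : ∀ x, |f x| ≤ A) (hB : ∀ x, |g x| ≤ B) :
    IsLip (fun x => f x * g x) := by
  obtain ⟨K, hK, h⟩ := hf
  obtain ⟨L, hL, h'⟩ := hg
  rcases isEmpty_or_nonempty X with hX | ⟨⟨x₀⟩⟩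
  · exact ⟨0, le_rfl, fun x => (hX.false x).elim⟩
  have hA0 : 0 ≤ A := (abs_nonneg _).trans (hA x₀)
  have hB0 : 0 ≤ B := (abs_nonneg _).trans (hB x₀)
  refine ⟨A * L + B * K, by positivity, fun x y => ?_⟩
  have e : f x * g x - f y * g y = f x * (g x - g y) + g y * (f x - f y) := by ring
  rw [e, add_mul, mul_assoc, mul_assoc]
  refine (abs_add_le _ _).trans (add_le_add ?_ ?_)
  · rw [abs_mul]; exact mul_le_mul (hA x) (h' x y) (abs_nonneg _) hA0
  · rw [abs_mul]; exact mul_le_mul (hB y) (h x y) (abs_nonneg _) hB0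

theorem of_deriv_le {φ φ' : ℝ → ℝ} (h : ∀ x, HasDerivAt φ (φ' x) x) {K : ℝ} (hK : 0 ≤ K)
    (hb : ∀ x, |φ' x| ≤ K) : IsLip φ := by
  refine ⟨K, hK, fun x y => ?_⟩
  have := Convex.norm_image_sub_le_of_norm_hasDerivWithin_le (f := φ) (f' := φ') (s := univ)
    (C := K) (fun x _ => (h x).hasDerivWithinAt) (fun x _ => hb x) convex_univ
    (mem_univ y) (mem_univ x)
  simpa [Real.dist_eq] using this

theorem sin : IsLip Real.sin :=
  of_deriv_le Real.hasDerivAt_sin zero_le_one Real.abs_cos_le_one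

theorem cos : IsLip Real.cos :=
  of_deriv_le Real.hasDerivAt_cos zero_le_one fun x => by simpa using Real.abs_sin_le_one x

theorem arctan : IsLip Real.arctan :=
  of_deriv_le Real.hasDerivAt_arctan zero_le_one fun x => by
    rw [abs_of_pos (by positivity), div_le_one (by positivity)]; nlinarith [sq_nonneg x]

theorem inv_one_add_sq : IsLip (fun x : ℝ => 1 / (1 + x ^ 2)) := by
  refine ⟨1, zero_le_one, fun x y => ?_⟩
  have e : 1 / (1 + x ^ 2) - 1 / (1 + y ^ 2)
      = (y - x) * ((x + y) / ((1 + x ^ 2) * (1 + y ^ 2))) := by field_simp; ring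
  rw [e, abs_mul, one_mul, abs_sub_comm, Real.dist_eq]
  refine mul_le_of_le_one_right (abs_nonneg _) ?_
  rw [abs_div, abs_of_pos (by positivity : 0 < (1 + x ^ 2) * (1 + y ^ 2)), div_le_one (by positivity)]
  rw [abs_le]
  constructor <;> nlinarith [sq_nonneg (x - 1), sq_nonneg (x + 1), sq_nonneg (y - 1),
    sq_nonneg (y + 1), sq_nonneg (x * y)]

theorem coord {n : ℕ} (i : Fin n) : IsLip (fun s : Fin n → ℝ => s i) :=
  ⟨1, zero_le_one, fun x y => by rw [one_mul, ← Real.dist_eq]; exact dist_le_pi_dist x y i⟩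

theorem exists_lipschitzWith {n : ℕ} {F : X → Fin n → ℝ} (h : ∀ i, IsLip (fun x => F x i)) :
    ∃ K, LipschitzWith K F := by
  choose K hK hb using h
  have hs : 0 ≤ ∑ i, K i := Finset.sum_nonneg fun i _ => hK i
  refine ⟨(∑ i, K i).toNNReal, LipschitzWith.of_dist_le_mul fun x y => ?_⟩
  rw [Real.coe_toNNReal _ hs]
  rw [dist_pi_le_iff (mul_nonneg hs dist_nonneg)]
  intro i
  rw [Real.dist_eq]
  refine (hb i x y).trans ?_
  gcongr
  exact Finset.single_le_sum (fun i _ => hK i) (Finset.mem_univ i)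

end IsLip

/-- The difference quotients at `0` of a function with Lipschitz derivative are Lipschitz. -/
theorem abs_slope_sub_slope_le {S S' : ℝ → ℝ} (hS : ∀ x, HasDerivAt S (S' x) x) (h0 : S 0 = 0)
    {L : ℝ} (hL : 0 ≤ L) (hS' : ∀ x y, |S' x - S' y| ≤ L * |x - y|) (a b : ℝ) :
    |(if a = 0 then S' 0 else S a / a) - (if b = 0 then S' 0 else S b / b)| ≤ L * |a - b| := by
  -- The curve s ↦ S(s f)/f has derivative S'(s f), also in its extension to f = 0. Over s ∈ [0, 1]
  -- the mean value inequality compares the curves for a and b.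
  have hP : ∀ f s : ℝ, HasDerivAt (fun s => if f = 0 then s * S' 0 else S (s * f) / f)
      (S' (s * f)) s := by
    intro f s
    by_cases hf : f = 0
    · simpa [hf] using (hasDerivAt_id s).mul_const (S' 0)
    · simp only [hf, if_false]
      have h1 : HasDerivAt (fun s : ℝ => s * f) f s := by simpa using (hasDerivAt_id s).mul_const f
      have := ((hS (s * f)).comp s h1).div_const f
      simpa [Function.comp_def, mul_div_assoc, hf] using this
  have := Convex.norm_image_sub_le_of_norm_hasDerivWithin_le (s := Icc (0 : ℝ) 1) (C := L * |a - b|)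
    (fun s _ => ((hP a s).fun_sub (hP b s)).hasDerivWithinAt)
    (by
      intro s hs
      refine (hS' _ _).trans ?_
      rw [← mul_sub, abs_mul, abs_of_nonneg hs.1]
      gcongr
      exact mul_le_of_le_one_left (abs_nonneg _) hs.2)
    (convex_Icc 0 1) (left_mem_Icc.2 zero_le_one) (right_mem_Icc.2 zero_le_one)
  simpa [h0] using this

/-! ### Saturations -/

theorem sat_eq {l : ℝ} (hl : 0 ≤ l) (x : ℝ) : sat l x = max (-l) (min l x) := by
  unfold sat
  rcases lt_trichotomy x 0 with h | rfl | h
  · rw [Real.sign_of_neg h, abs_of_neg h, min_eq_right (a := l) (by linarith), neg_one_mul,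
      ← max_neg_neg, neg_neg, max_comm]
  · simp [hl]
  · rw [Real.sign_of_pos h, abs_of_pos h, one_mul, min_comm,
      max_eq_right (le_trans (by linarith) (le_min hl h.le))]

theorem abs_sat_le {l : ℝ} (hl : 0 ≤ l) (x : ℝ) : |sat l x| ≤ l := by
  rw [sat_eq hl, abs_le]
  exact ⟨le_max_left _ _, max_le (by linarith) (min_le_left _ _)⟩

theorem sat_of_abs_le {l x : ℝ} (h : |x| ≤ l) : sat l x = x := by
  have hl := (abs_nonneg x).trans h
  rw [abs_le] at h
  rw [sat_eq hl, min_eq_right h.2, max_eq_right h.1]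

theorem sat_of_le {l x : ℝ} (hl : 0 ≤ l) (h : l ≤ x) : sat l x = l := by
  rw [sat_eq hl, min_eq_left h, max_eq_right (by linarith)]

theorem sat_of_le_neg {l x : ℝ} (hl : 0 ≤ l) (h : x ≤ -l) : sat l x = -l := by
  rw [sat_eq hl, min_eq_right (by linarith), max_eq_left h]

theorem sat_mono {l : ℝ} (hl : 0 ≤ l) : Monotone (sat l) := by
  intro x y h
  rw [sat_eq hl, sat_eq hl]
  gcongr

theorem sat_neg (l x : ℝ) : sat l (-x) = -sat l x := by
  rw [sat, sat, Real.sign_neg, abs_neg, neg_mul]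

theorem sat_zero (l : ℝ) : sat l 0 = 0 := by simp [sat]

theorem abs_sat_sub_le {l : ℝ} (hl : 0 ≤ l) (x y : ℝ) : |sat l x - sat l y| ≤ |x - y| := by
  rw [sat_eq hl, sat_eq hl]
  refine (abs_max_sub_max_le_max _ _ _ _).trans ?_
  rw [sub_self, abs_zero, max_eq_right (abs_nonneg _)]
  refine (abs_min_sub_min_le_max _ _ _ _).trans ?_
  rw [sub_self, abs_zero, max_eq_right (abs_nonneg _)]

theorem isLip_sat {l : ℝ} (hl : 0 ≤ l) : IsLip (sat l) :=
  ⟨1, zero_le_one, fun x y => by rw [one_mul, Real.dist_eq]; exact abs_sat_sub_le hl x y⟩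

theorem abs_sat_le_abs {l : ℝ} (hl : 0 ≤ l) (x : ℝ) : |sat l x| ≤ |x| := by
  simpa [sat_zero] using abs_sat_sub_le hl x 0

theorem posSat_of_nonneg {l x : ℝ} (hl : 0 ≤ l) (hx : 0 ≤ x) : posSat l x = min x l := by
  unfold posSat
  rw [if_pos hx, sat_eq hl, max_eq_right (le_trans (by linarith) (le_min hl hx)), min_comm]

/-! ### The attitude mapping and the thrust -/

variable {p : Plant}

theorem Plant.M_pos (p : Plant) : 0 < p.M := by
  have := p.mb_pos; have := p.dG_pos; have := p.L_pos; have := p.mu_pos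
  unfold Plant.M; positivity

theorem Plant.I0_pos (p : Plant) : 0 < p.I0 := by
  have := p.mb_pos; have := p.dG_pos; have := p.L_pos; have := p.mu_pos; have := p.Ib_pos
  unfold Plant.I0; positivity

theorem Gains.gam_pos (c : Gains p) : 0 < c.gam := by
  have := Real.arctan_pos.2 (mul_pos c.eps_pos p.Umax_pos)
  have := Real.pi_pos
  unfold Gains.gam; positivity

theorem Gains.gam_mul_arctan (c : Gains p) :
    c.gam * Real.arctan (c.eps * p.Umax) = Real.pi / 2 := by
  have := Real.arctan_pos.2 (mul_pos c.eps_pos p.Umax_pos)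
  unfold Gains.gam; field_simp

/-- The attitude mapping without its saturation. -/
noncomputable def Gains.thetaLin (c : Gains p) (f : ℝ) : ℝ := c.gam * Real.arctan (c.eps * f)

/-- The derivative of `thetaLin`. -/
noncomputable def Gains.thetaLinDeriv (c : Gains p) (f : ℝ) : ℝ :=
  c.gam * c.eps * (1 / (1 + (c.eps * f) ^ 2))

theorem Gains.hasDerivAt_thetaLin (c : Gains p) (f : ℝ) :
    HasDerivAt c.thetaLin (c.thetaLinDeriv f) f := by
  have h1 : HasDerivAt (fun f : ℝ => c.eps * f) c.eps f := by
    simpa using (hasDerivAt_id f).const_mul c.eps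
  refine (h1.arctan.const_mul c.gam).congr_deriv ?_
  unfold Gains.thetaLinDeriv; ring

theorem Gains.thetaLinDeriv_nonneg (c : Gains p) (f : ℝ) : 0 ≤ c.thetaLinDeriv f := by
  have := c.gam_pos; have := c.eps_pos
  unfold Gains.thetaLinDeriv; positivity

theorem Gains.thetaLinDeriv_le (c : Gains p) (f : ℝ) : c.thetaLinDeriv f ≤ c.gam * c.eps := by
  have := c.gam_pos; have := c.eps_pos
  unfold Gains.thetaLinDeriv
  refine mul_le_of_le_one_right (by positivity) ?_
  rw [div_le_one (by positivity)]
  nlinarith [sq_nonneg (c.eps * f)]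

theorem Gains.abs_thetaLin_sub_le (c : Gains p) (x y : ℝ) :
    |c.thetaLin x - c.thetaLin y| ≤ c.gam * c.eps * |x - y| :=
  Convex.norm_image_sub_le_of_norm_hasDerivWithin_le (f := c.thetaLin) (s := univ)
    (fun x _ => (c.hasDerivAt_thetaLin x).hasDerivWithinAt)
    (fun x _ => by
      rw [Real.norm_eq_abs, abs_of_nonneg (c.thetaLinDeriv_nonneg x)]; exact c.thetaLinDeriv_le x)
    convex_univ (mem_univ y) (mem_univ x)

theorem Gains.thetaRef_eq (c : Gains p) (f : ℝ) :
    c.thetaRef f = sat (Real.pi / 2) (c.thetaLin f) := rfl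

theorem Gains.abs_thetaRef_sub_le (c : Gains p) (x y : ℝ) :
    |c.thetaRef x - c.thetaRef y| ≤ c.gam * c.eps * |x - y| :=
  (abs_sat_sub_le (by positivity) _ _).trans (c.abs_thetaLin_sub_le x y)

theorem Gains.isLip_thetaRef (c : Gains p) : IsLip c.thetaRef :=
  ⟨c.gam * c.eps, (mul_pos c.gam_pos c.eps_pos).le, c.abs_thetaRef_sub_le⟩

/-- The Lipschitz bound also covers the points |f| = Umax, where `deriv` may take its default value
0. -/
theorem Gains.abs_deriv_thetaRef_le (c : Gains p) (f : ℝ) :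
    |deriv c.thetaRef f| ≤ c.gam * c.eps := by
  have h0 := (mul_pos c.gam_pos c.eps_pos).le
  have h : LipschitzWith (c.gam * c.eps).toNNReal c.thetaRef :=
    LipschitzWith.of_dist_le_mul fun x y => by
      rw [Real.coe_toNNReal _ h0]; exact c.abs_thetaRef_sub_le x y
  simpa [Real.coe_toNNReal _ h0] using norm_deriv_le_of_lipschitz (x₀ := f) h

theorem Gains.thetaLin_neg (c : Gains p) (f : ℝ) : c.thetaLin (-f) = -c.thetaLin f := by
  simp [Gains.thetaLin, Real.arctan_neg]

theorem Gains.thetaRef_neg (c : Gains p) (f : ℝ) : c.thetaRef (-f) = -c.thetaRef f := by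
  rw [c.thetaRef_eq, c.thetaLin_neg, sat_neg, ← c.thetaRef_eq]

theorem Gains.thetaLin_mono (c : Gains p) : Monotone c.thetaLin := by
  intro x y h
  have := c.gam_pos; have := c.eps_pos
  unfold Gains.thetaLin
  gcongr

theorem Gains.thetaLin_Umax (c : Gains p) : c.thetaLin p.Umax = Real.pi / 2 := c.gam_mul_arctan

theorem Gains.abs_thetaLin_le (c : Gains p) {f : ℝ} (hf : |f| ≤ p.Umax) :
    |c.thetaLin f| ≤ Real.pi / 2 := by
  rw [abs_le] at hf ⊢
  rw [← c.thetaLin_Umax, ← c.thetaLin_neg]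
  exact ⟨c.thetaLin_mono hf.1, c.thetaLin_mono hf.2⟩

theorem Gains.thetaRef_of_abs_le (c : Gains p) {f : ℝ} (hf : |f| ≤ p.Umax) :
    c.thetaRef f = c.thetaLin f := sat_of_abs_le (c.abs_thetaLin_le hf)

theorem Gains.thetaRef_of_le (c : Gains p) {f : ℝ} (hf : p.Umax ≤ f) :
    c.thetaRef f = Real.pi / 2 :=
  sat_of_le (by positivity) (by rw [← c.gam_mul_arctan]; exact c.thetaLin_mono hf)

theorem Gains.abs_thetaRef_le (c : Gains p) (f : ℝ) : |c.thetaRef f| ≤ Real.pi / 2 :=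
  abs_sat_le (by positivity) _

theorem Gains.thetaRef_zero (c : Gains p) : c.thetaRef 0 = 0 := by
  simp [c.thetaRef_eq, Gains.thetaLin, sat_zero]

theorem Gains.thetaRef_pos (c : Gains p) {f : ℝ} (hf : 0 < f) : 0 < c.thetaRef f := by
  have h1 : 0 < c.thetaLin f := mul_pos c.gam_pos (Real.arctan_pos.2 (mul_pos c.eps_pos hf))
  rw [c.thetaRef_eq, sat_eq (by positivity)]
  exact lt_max_of_lt_right (lt_min (by positivity) h1)

theorem Gains.sin_thetaRef_pos (c : Gains p) {f : ℝ} (hf : 0 < f) :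
    0 < Real.sin (c.thetaRef f) :=
  Real.sin_pos_of_pos_of_lt_pi (c.thetaRef_pos hf)
    (by linarith [(abs_le.1 (c.abs_thetaRef_le f)).2, Real.pi_pos])

theorem Gains.thrust_neg (c : Gains p) (f : ℝ) : c.thrust (-f) = c.thrust f := by
  unfold Gains.thrust
  rw [c.thetaRef_neg, Real.sin_neg, neg_div_neg_eq]
  simp

theorem Gains.thrust_abs (c : Gains p) (f : ℝ) : c.thrust |f| = c.thrust f := by
  rcases abs_choice f with h | h <;> rw [h]
  exact c.thrust_neg f

theorem Gains.thrust_pos (c : Gains p) (f : ℝ) : 0 < c.thrust f := by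
  rw [← c.thrust_abs]
  unfold Gains.thrust
  split_ifs with h
  · exact div_pos one_pos (mul_pos c.gam_pos c.eps_pos)
  · have h' : 0 < |f| := lt_of_le_of_ne (abs_nonneg f) (Ne.symm h)
    exact div_pos h' (c.sin_thetaRef_pos h')

theorem Gains.thrust_mul_sin (c : Gains p) (f : ℝ) :
    c.thrust f * Real.sin (c.thetaRef f) = f := by
  rcases lt_trichotomy f 0 with h | rfl | h
  · have h1 := c.sin_thetaRef_pos (neg_pos.2 h)
    rw [c.thetaRef_neg, Real.sin_neg] at h1
    rw [Gains.thrust, if_neg h.ne, div_mul_cancel₀ _ (by linarith)]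
  · simp [c.thetaRef_zero]
  · rw [Gains.thrust, if_neg h.ne', div_mul_cancel₀ _ (c.sin_thetaRef_pos h).ne']

theorem Gains.thrust_of_le (c : Gains p) {f : ℝ} (hf : p.Umax ≤ |f|) : c.thrust f = |f| := by
  rw [← c.thrust_abs, Gains.thrust, c.thetaRef_of_le hf,
    if_neg (p.Umax_pos.trans_le hf).ne', Real.sin_pi_div_two, div_one]

theorem Gains.abs_le_of_thrust_le (c : Gains p) {f : ℝ} (hf : c.thrust f ≤ p.Umax) :
    |f| ≤ p.Umax := by
  by_contra! h
  rw [c.thrust_of_le h.le] at hf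
  linarith

theorem concaveOn_arctan : ConcaveOn ℝ (Ici 0) Real.arctan := by
  refine AntitoneOn.concaveOn_of_deriv (convex_Ici 0) Real.continuous_arctan.continuousOn
    Real.differentiable_arctan.differentiableOn ?_
  rw [interior_Ici]
  intro x hx y hy hxy
  simp only [Real.deriv_arctan]
  have : (0 : ℝ) < x := hx
  gcongr

/-- Concavity places arctan above its chord on [0, ε Umax], so `thetaLin f` ≥ (f / Umax) π/2;
Jordan's inequality sin x ≥ 2x/π finishes. This is what keeps the thrust below Umax for |f| ≤ Umax.
-/
theorem Gains.div_le_sin_thetaRef (c : Gains p) {f : ℝ} (h0 : 0 ≤ f) (hf : f ≤ p.Umax) :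
    f / p.Umax ≤ Real.sin (c.thetaRef f) := by
  have hU := p.Umax_pos
  have hg := c.gam_pos
  have ha : |f| ≤ p.Umax := by rwa [abs_of_nonneg h0]
  have h1 : f / p.Umax * Real.arctan (c.eps * p.Umax) ≤ Real.arctan (c.eps * f) := by
    have := concaveOn_arctan.2 (mem_Ici.2 (mul_pos c.eps_pos hU).le) (mem_Ici.2 le_rfl)
      (div_nonneg h0 hU.le) (sub_nonneg.2 ((div_le_one hU).2 hf)) (by ring)
    simp only [smul_eq_mul, mul_zero, Real.arctan_zero, add_zero] at this
    rwa [show f / p.Umax * (c.eps * p.Umax) = c.eps * f by field_simp] at this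
  have h2 : f / p.Umax * (Real.pi / 2) ≤ c.thetaLin f := by
    rw [← c.gam_mul_arctan, Gains.thetaLin]
    calc _ = c.gam * (f / p.Umax * Real.arctan (c.eps * p.Umax)) := by ring
      _ ≤ _ := by gcongr
  have h3 : 0 ≤ f / p.Umax * (Real.pi / 2) := by positivity
  rw [c.thetaRef_of_abs_le ha]
  refine le_trans ?_ (Real.mul_le_sin (h3.trans h2) (abs_le.1 (c.abs_thetaLin_le ha)).2)
  calc f / p.Umax = 2 / Real.pi * (f / p.Umax * (Real.pi / 2)) := by field_simp
    _ ≤ _ := by gcongr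

/-- The reciprocal of the thrust in the absence of saturation. -/
noncomputable def Gains.slope (c : Gains p) (f : ℝ) : ℝ :=
  if f = 0 then c.gam * c.eps else Real.sin (c.thetaLin f) / f

/-- `slope` is the difference quotient at 0 of sin ∘ `thetaLin`, whose derivative is Lipschitz as a
product of bounded Lipschitz functions. -/
theorem Gains.exists_slope_lip (c : Gains p) :
    ∃ L, 0 ≤ L ∧ ∀ a b, |c.slope a - c.slope b| ≤ L * |a - b| := by
  have hg := c.gam_pos
  have he := c.eps_pos
  have hlin : IsLip c.thetaLin := ⟨c.gam * c.eps, by positivity, c.abs_thetaLin_sub_le⟩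
  have hid : IsLip (fun x : ℝ => x) := ⟨1, zero_le_one, fun x y => by simp [Real.dist_eq]⟩
  have hder : IsLip c.thetaLinDeriv :=
    (IsLip.inv_one_add_sq.comp (hid.const_mul c.eps)).const_mul (c.gam * c.eps)
  obtain ⟨L, hL, h⟩ := (IsLip.cos.comp hlin).mul hder (fun x => Real.abs_cos_le_one _)
    (fun x => by rw [abs_of_nonneg (c.thetaLinDeriv_nonneg x)]; exact c.thetaLinDeriv_le x)
  refine ⟨L, hL, fun a b => ?_⟩
  have := abs_slope_sub_slope_le (S := fun f => Real.sin (c.thetaLin f))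
    (fun x => (c.hasDerivAt_thetaLin x).sin) (by simp [Gains.thetaLin]) hL h a b
  simpa [Gains.slope, Gains.thetaLin, Gains.thetaLinDeriv] using this

theorem Gains.thrust_eq_inv_slope (c : Gains p) {f : ℝ} (hf : |f| ≤ p.Umax) :
    c.thrust f = (c.slope f)⁻¹ := by
  unfold Gains.thrust Gains.slope
  rw [c.thetaRef_of_abs_le hf]
  split_ifs <;> simp

theorem Gains.thrust_le (c : Gains p) {f : ℝ} (hf : |f| ≤ p.Umax) : c.thrust f ≤ p.Umax := by
  have hU := p.Umax_pos
  have key : ∀ g, 0 < g → g ≤ p.Umax → c.thrust g ≤ p.Umax := by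
    intro g h0 h1
    have := c.div_le_sin_thetaRef h0.le h1
    have hs := c.sin_thetaRef_pos h0
    rw [Gains.thrust, if_neg h0.ne', div_le_iff₀ hs]
    rwa [div_le_iff₀' hU] at this
  rcases eq_or_ne f 0 with rfl | h0
  · have hc : Continuous fun f => (c.slope f) := by
      obtain ⟨L, hL, h⟩ := c.exists_slope_lip
      exact IsLip.continuous ⟨L, hL, h⟩
    have h1 : Tendsto c.slope (𝓝[>] 0) (𝓝 (c.slope 0)) := (hc.tendsto 0).mono_left nhdsWithin_le_nhds
    have h2 : ∀ᶠ g in 𝓝[>] (0 : ℝ), p.Umax⁻¹ ≤ c.slope g := by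
      filter_upwards [Ioo_mem_nhdsGT hU] with g hg
      have hg' : |g| ≤ p.Umax := by rw [abs_of_pos hg.1]; exact hg.2.le
      have := key g hg.1 hg.2.le
      rw [inv_le_comm₀ hU, ← c.thrust_eq_inv_slope hg']
      · exact this
      · have := c.thrust_pos g
        rwa [c.thrust_eq_inv_slope hg', inv_pos] at this
    have h3 := ge_of_tendsto h1 h2
    rw [c.thrust_eq_inv_slope hf]
    exact inv_le_of_inv_le₀ hU h3
  · rw [← c.thrust_abs]
    exact key _ (abs_pos.2 h0) hf

/-- The bound holds for every f: beyond Umax the reference angle is ±π/2 and the cosine vanishes. -/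
theorem Gains.abs_thrust_mul_cos_le (c : Gains p) (f : ℝ) :
    |c.thrust f * Real.cos (c.thetaRef f)| ≤ p.Umax := by
  have hU := p.Umax_pos
  rcases le_total |f| p.Umax with h | h
  · rw [abs_mul, abs_of_pos (c.thrust_pos f)]
    exact (mul_le_of_le_one_right (c.thrust_pos f).le (Real.abs_cos_le_one _)).trans (c.thrust_le h)
  · have : Real.cos (c.thetaRef f) = 0 := by
      rcases abs_choice f with h' | h' <;> rw [h'] at h
      · rw [c.thetaRef_of_le h, Real.cos_pi_div_two]
      · rw [← neg_neg f, c.thetaRef_neg, c.thetaRef_of_le h, Real.cos_neg, Real.cos_pi_div_two]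
    simp [this, hU.le]

/-- Clipping the thrust amounts to clipping the force, because the thrust is |f| beyond Umax and at
most Umax below it. -/
theorem Gains.posSat_thrust (c : Gains p) (f : ℝ) :
    posSat p.Umax (c.thrust f) = c.thrust (sat p.Umax f) := by
  have hU := p.Umax_pos
  rw [posSat_of_nonneg hU.le (c.thrust_pos f).le]
  rcases le_total |f| p.Umax with h | h
  · rw [sat_of_abs_le h, min_eq_left (c.thrust_le h)]
  · have h2 : |sat p.Umax f| = p.Umax := by
      rcases abs_choice f with h' | h' <;> rw [h'] at h
      · rw [sat_of_le hU.le h, abs_of_pos hU]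
      · rw [sat_of_le_neg hU.le (by linarith), abs_neg, abs_of_pos hU]
    rw [c.thrust_of_le h, min_eq_right h, c.thrust_of_le h2.ge, h2]

/-- The saturated thrust is the reciprocal of a Lipschitz function that stays above 1/Umax, whence
the constant Umax² L. -/
theorem Gains.isLip_posSat_thrust (c : Gains p) :
    IsLip (fun f => posSat p.Umax (c.thrust f)) := by
  obtain ⟨L, hL, h⟩ := c.exists_slope_lip
  have hU := p.Umax_pos
  refine ⟨p.Umax ^ 2 * L, by positivity, fun x y => ?_⟩
  simp only [c.posSat_thrust, Real.dist_eq]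
  have hxy := abs_sat_sub_le hU.le x y
  obtain ⟨a, ha⟩ : ∃ a, a = sat p.Umax x := ⟨_, rfl⟩
  obtain ⟨b, hb⟩ : ∃ b, b = sat p.Umax y := ⟨_, rfl⟩
  have ha' : |a| ≤ p.Umax := ha ▸ abs_sat_le hU.le x
  have hb' : |b| ≤ p.Umax := hb ▸ abs_sat_le hU.le y
  rw [← ha, ← hb] at hxy ⊢
  have hpa := c.thrust_pos a
  have hpb := c.thrust_pos b
  have hla := c.thrust_le ha'
  have hlb := c.thrust_le hb'
  have e : c.thrust a - c.thrust b = c.thrust a * c.thrust b * (c.slope b - c.slope a) := by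
    have h1 := c.thrust_eq_inv_slope ha'
    have h2 := c.thrust_eq_inv_slope hb'
    have h3 : c.slope a = (c.thrust a)⁻¹ := by rw [h1, inv_inv]
    have h4 : c.slope b = (c.thrust b)⁻¹ := by rw [h2, inv_inv]
    rw [h3, h4]
    field_simp
  rw [e, abs_mul, abs_of_pos (mul_pos hpa hpb), sq, mul_assoc (p.Umax * p.Umax)]
  refine mul_le_mul (mul_le_mul hla hlb hpb.le hU.le) ?_ (abs_nonneg _) (by positivity)
  rw [abs_sub_comm]
  exact (h a b).trans (by gcongr)

/-! ### The closed-loop vector field -/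

theorem Gains.isLip_force (c : Gains p) (ab : ℝ) :
    IsLip (fun s : Fin 6 → ℝ => c.force ab (s 2) (s 3)) :=
  ((((IsLip.coord 2).sub (IsLip.const ab)).const_mul (-c.kpa)).sub
    ((IsLip.coord 3).const_mul c.kda)).add ((IsLip.cos.comp (IsLip.coord 2)).const_mul _)

theorem Gains.isLip_betaRef (c : Gains p) (ab : ℝ) :
    IsLip (fun s : Fin 6 → ℝ => c.betaRef ab (s 2) (s 3)) :=
  (IsLip.coord 2).add (c.isLip_thetaRef.comp (c.isLip_force ab))

theorem isLip_attErr (c : Gains p) (ab : ℝ) : IsLip (attErr c ab) :=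
  (IsLip.coord 4).sub (c.isLip_betaRef ab)

theorem cmd2_eq (c : Gains p) (ab kp kd : ℝ) (s : Fin 6 → ℝ) :
    cmd2 c ab kp kd s = -kp * attErr c ab s - kd * s 5 := rfl

theorem isLip_cmd2 (c : Gains p) (ab kp kd : ℝ) : IsLip (cmd2 c ab kp kd) :=
  ((isLip_attErr c ab).const_mul (-kp)).sub ((IsLip.coord 5).const_mul kd)

theorem isLip_cmd3 (c : Gains p) (xb : ℝ) : IsLip (cmd3 c xb) :=
  ((isLip_sat c.l1_pos.le).comp (((IsLip.coord 1).const_mul c.kdx).add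
    ((isLip_sat c.l2_pos.le).comp (((IsLip.coord 0).sub (IsLip.const xb)).const_mul c.kpx)))).neg

theorem abs_cmd3_le (c : Gains p) (xb : ℝ) (s : Fin 6 → ℝ) : |cmd3 c xb s| ≤ c.l1 := by
  unfold cmd3; rw [abs_neg]; exact abs_sat_le c.l1_pos.le _

theorem accX_eq (c : Gains p) (xb : ℝ) (s : Fin 6 → ℝ) : accX c xb s = cmd3 c xb s / p.mc := by
  unfold accX; rw [sat_of_abs_le ((abs_cmd3_le c xb s).trans c.l1_le)]

theorem isLip_accX (c : Gains p) (xb : ℝ) : IsLip (accX c xb) := by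
  have : accX c xb = fun s => cmd3 c xb s / p.mc := funext (accX_eq c xb)
  rw [this]; exact (isLip_cmd3 c xb).div_const _

theorem abs_accX_le (c : Gains p) (xb : ℝ) (s : Fin 6 → ℝ) : |accX c xb s| ≤ c.l1 / p.mc := by
  rw [accX_eq, abs_div, abs_of_pos p.mc_pos]
  exact div_le_div_of_nonneg_right (abs_cmd3_le c xb s) p.mc_pos.le

theorem isLip_accA (c : Gains p) (xb ab : ℝ) : IsLip (accA c xb ab) := by
  have h1 : IsLip (fun s : Fin 6 → ℝ =>
      posSat p.Umax (cmd1 c ab s) * Real.sin (s 4 - s 2)) := by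
    refine (c.isLip_posSat_thrust.comp (c.isLip_force ab)).mul
      (IsLip.sin.comp ((IsLip.coord 4).sub (IsLip.coord 2))) (A := p.Umax) (B := 1)
      (fun s => ?_) (fun s => Real.abs_sin_le_one _)
    rw [posSat_of_nonneg p.Umax_pos.le (c.thrust_pos _).le,
      abs_of_nonneg (le_min (c.thrust_pos _).le p.Umax_pos.le)]
    exact min_le_right _ _
  have h2 : IsLip (fun s : Fin 6 → ℝ => -Real.sin (s 2) * accX c xb s) :=
    (IsLip.sin.comp (IsLip.coord 2)).neg.mul (isLip_accX c xb)
      (fun s => by rw [abs_neg]; exact Real.abs_sin_le_one _) (abs_accX_le c xb)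
  have h3 : IsLip (fun s : Fin 6 → ℝ => Real.cos (s 2) * p.g) := by
    simpa [mul_comm] using (IsLip.cos.comp (IsLip.coord (n := 6) 2)).const_mul p.g
  exact (h1.sub ((h2.add h3).const_mul p.M)).div_const _

theorem exists_lipschitzWith_closedLoop (c : Gains p) (xb ab kp kd : ℝ) :
    ∃ K, LipschitzWith K (closedLoop c xb ab kp kd) := by
  refine IsLip.exists_lipschitzWith fun i => ?_
  fin_cases i
  · exact IsLip.coord 1
  · exact isLip_accX c xb
  · exact IsLip.coord 3
  · exact isLip_accA c xb ab
  · exact IsLip.coord 5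
  · exact ((isLip_sat p.Tmax_pos.le).comp (isLip_cmd2 c ab kp kd)).div_const _

theorem exists_isSolution (c : Gains p) (xb ab kp kd : ℝ) (s : Fin 6 → ℝ) :
    ∃ φ, IsSolution (closedLoop c xb ab kp kd) φ ∧ φ 0 = s := by
  obtain ⟨K, hK⟩ := exists_lipschitzWith_closedLoop c xb ab kp kd
  obtain ⟨φ, h0, h⟩ := exists_global_solution hK s
  exact ⟨φ, h, h0⟩

/-! ### The inner loop -/

/-- Both orders of the product are needed: right multiplication gives the adjoint equation used in
the variation of constants, left multiplication gives the oscillator equation used for decay. -/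
theorem hasDerivAt_exp_smul_apply (A : Matrix (Fin 2) (Fin 2) ℝ) (i j : Fin 2) (t : ℝ) :
    HasDerivAt (fun t : ℝ => NormedSpace.exp (t • A) i j) ((NormedSpace.exp (t • A) * A) i j) t ∧
    HasDerivAt (fun t : ℝ => NormedSpace.exp (t • A) i j)
      ((A * NormedSpace.exp (t • A)) i j) t := by
  let : NormedRing (Matrix (Fin 2) (Fin 2) ℝ) := Matrix.linftyOpNormedRing
  let : NormedAlgebra ℝ (Matrix (Fin 2) (Fin 2) ℝ) := Matrix.linftyOpNormedAlgebra
  let L := LinearMap.toContinuousLinearMap (Matrix.entryLinearMap ℝ ℝ i j)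
  have h1 := L.hasFDerivAt.comp_hasDerivAt t (hasDerivAt_exp_smul_const A t)
  have h2 := L.hasFDerivAt.comp_hasDerivAt t (hasDerivAt_exp_smul_const' A t)
  exact ⟨h1, h2⟩

/-- The entry `(i, j)` of the matrix exponential of the inner loop. -/
noncomputable def innerExp (p : Plant) (kp kd : ℝ) (i j : Fin 2) (t : ℝ) : ℝ :=
  NormedSpace.exp (t • innerMatrix p kp kd) i j

theorem gammaIn_eq (p : Plant) (kp kd : ℝ) :
    gammaIn p kp kd = ∫ t in Ioi (0 : ℝ), |innerExp p kp kd 0 0 t| := rfl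

theorem innerExp_zero (p : Plant) (kp kd : ℝ) (i j : Fin 2) :
    innerExp p kp kd i j 0 = if i = j then 1 else 0 := by
  simp [innerExp, Matrix.one_apply]

theorem hasDerivAt_innerExp_row (p : Plant) (kp kd t : ℝ) :
    HasDerivAt (innerExp p kp kd 0 0) (-(kp / p.Iu) * innerExp p kp kd 0 1 t) t ∧
    HasDerivAt (innerExp p kp kd 0 1)
      (innerExp p kp kd 0 0 t - kd / p.Iu * innerExp p kp kd 0 1 t) t := by
  constructor
  · refine (hasDerivAt_exp_smul_apply (innerMatrix p kp kd) 0 0 t).1.congr_deriv ?_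
    simp [innerExp, Matrix.mul_apply, innerMatrix]; ring
  · refine (hasDerivAt_exp_smul_apply (innerMatrix p kp kd) 0 1 t).1.congr_deriv ?_
    simp [innerExp, Matrix.mul_apply, innerMatrix]; ring

theorem hasDerivAt_innerExp_col (p : Plant) (kp kd : ℝ) (j : Fin 2) (t : ℝ) :
    HasDerivAt (innerExp p kp kd 0 j) (innerExp p kp kd 1 j t) t ∧
    HasDerivAt (innerExp p kp kd 1 j)
      (-(kp / p.Iu) * innerExp p kp kd 0 j t - kd / p.Iu * innerExp p kp kd 1 j t) t := by
  constructor
  · refine (hasDerivAt_exp_smul_apply (innerMatrix p kp kd) 0 j t).2.congr_deriv ?_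
    simp [innerExp, Matrix.mul_apply, innerMatrix]
  · refine (hasDerivAt_exp_smul_apply (innerMatrix p kp kd) 1 j t).2.congr_deriv ?_
    simp [innerExp, Matrix.mul_apply, innerMatrix]; ring

theorem continuous_innerExp (p : Plant) (kp kd : ℝ) (j : Fin 2) :
    Continuous (innerExp p kp kd 0 j) :=
  continuous_iff_continuousAt.2 fun t => (hasDerivAt_innerExp_col p kp kd j t).1.continuousAt

theorem exists_innerExp_decay (p : Plant) {kp kd : ℝ} (hkp : 0 < kp) (hkd : 0 < kd) :
    ∃ c > 0, ∃ C > 0, ∀ j t, 0 ≤ t → |innerExp p kp kd 0 j t| ≤ C * Real.exp (-c * t) := by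
  have hI := p.Iu_pos
  obtain ⟨κ, hκ, c, hc, C, hC, h⟩ := second_order_bound (div_pos hkp hI) (div_pos hkd hI)
  refine ⟨c, hc, C, hC, fun j t ht => ?_⟩
  have := h (innerExp p kp kd 0 j) (innerExp p kp kd 1 j) _
    (fun t _ => (hasDerivAt_innerExp_col p kp kd j t).1.hasDerivWithinAt)
    (fun t _ => (hasDerivAt_innerExp_col p kp kd j t).2.hasDerivWithinAt) 0 t 0 le_rfl le_rfl
    (fun τ _ => by
      have e : -(kp / p.Iu) * innerExp p kp kd 0 j τ - kd / p.Iu * innerExp p kp kd 1 j τ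
        + kp / p.Iu * innerExp p kp kd 0 j τ + kd / p.Iu * innerExp p kp kd 1 j τ = 0 := by ring
      rw [e, abs_zero]; positivity) t ⟨ht, le_rfl⟩
  have e0 : |innerExp p kp kd 0 j 0| + |innerExp p kp kd 1 j 0| = 1 := by
    rw [innerExp_zero, innerExp_zero]; fin_cases j <;> simp
  rw [e0] at this
  have h2 := abs_nonneg (innerExp p kp kd 1 j t)
  simp only [sub_zero, mul_one, mul_zero, add_zero] at this
  linarith

theorem integrableOn_innerExp (p : Plant) {kp kd : ℝ} (hkp : 0 < kp) (hkd : 0 < kd) :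
    MeasureTheory.IntegrableOn (fun t => |innerExp p kp kd 0 0 t|) (Ioi 0) := by
  obtain ⟨c, hc, C, hC, h⟩ := exists_innerExp_decay p hkp hkd
  refine MeasureTheory.Integrable.mono' ((exp_neg_integrableOn_Ioi 0 hc).const_mul C)
    (continuous_innerExp p kp kd 0).abs.aestronglyMeasurable ?_
  refine (MeasureTheory.ae_restrict_iff' measurableSet_Ioi).2 (MeasureTheory.ae_of_all _ fun t ht => ?_)
  simpa using h 0 t (le_of_lt ht)

theorem gammaIn_nonneg (p : Plant) (kp kd : ℝ) : 0 ≤ gammaIn p kp kd := by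
  rw [gammaIn_eq]
  exact MeasureTheory.integral_nonneg fun t => abs_nonneg _

theorem integral_innerExp_le_gammaIn (p : Plant) {kp kd : ℝ} (hkp : 0 < kp) (hkd : 0 < kd)
    {t : ℝ} (ht : 0 ≤ t) : ∫ τ in (0 : ℝ)..t, |innerExp p kp kd 0 0 τ| ≤ gammaIn p kp kd := by
  rw [gammaIn_eq, intervalIntegral.integral_of_le ht]
  exact MeasureTheory.setIntegral_mono_set (integrableOn_innerExp p hkp hkd)
    (MeasureTheory.ae_of_all _ fun t => abs_nonneg _) (Ioc_subset_Ioi_self.eventuallyLE)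

/-- Strict positivity lets the small-gain bound, where the outer state is weighted by `gammaIn`,
control that state. -/
theorem gammaIn_pos (p : Plant) {kp kd : ℝ} (hkp : 0 < kp) (hkd : 0 < kd) :
    0 < gammaIn p kp kd := by
  refine lt_of_lt_of_le ?_ (integral_innerExp_le_gammaIn p hkp hkd zero_le_one)
  refine intervalIntegral.integral_pos zero_lt_one
    (continuous_innerExp p kp kd 0).abs.continuousOn (fun _ _ => abs_nonneg _)
    ⟨0, by simp, ?_⟩
  simp [innerExp_zero]

/-- Variation of constants: τ ↦ h(t−τ) y(τ) + k(t−τ) w(τ) has derivative −h(t−τ) ρ(τ). Comparing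
norms of derivatives instead of integrating requires only a pointwise bound on ρ, no measurability.
-/
theorem abs_sub_innerExp_le (p : Plant) (kp kd : ℝ) {y w w' ρ : ℝ → ℝ}
    (hy : HasFwdDeriv y (fun t => w t - ρ t)) (hw : HasFwdDeriv w w') {s t R : ℝ}
    (hs : 0 ≤ s) (hst : s ≤ t)
    (hw' : ∀ τ ∈ Icc s t, w' τ = -(kp / p.Iu) * y τ - kd / p.Iu * w τ)
    (hρ : ∀ τ ∈ Icc s t, |ρ τ| ≤ R) :
    |y t - (innerExp p kp kd 0 0 (t - s) * y s + innerExp p kp kd 0 1 (t - s) * w s)|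
      ≤ R * ∫ τ in (0 : ℝ)..t - s, |innerExp p kp kd 0 0 τ| := by
  set h := innerExp p kp kd 0 0 with hh
  set k := innerExp p kp kd 0 1 with hk
  have hsub : ∀ τ, HasDerivAt (fun τ : ℝ => t - τ) (-1) τ := fun τ => by
    simpa using (hasDerivAt_id τ).const_sub t
  have hder : ∀ τ ∈ Ico s t, HasDerivWithinAt
      (fun τ => h (t - τ) * y τ + k (t - τ) * w τ - (h (t - s) * y s + k (t - s) * w s))
      (-h (t - τ) * ρ τ) (Ici τ) τ := by
    intro τ hτ
    have h0 := hs.trans hτ.1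
    have h1 := ((hasDerivAt_innerExp_row p kp kd (t - τ)).1.comp τ (hsub τ)).hasDerivWithinAt
      (s := Ici τ)
    have h2 := ((hasDerivAt_innerExp_row p kp kd (t - τ)).2.comp τ (hsub τ)).hasDerivWithinAt
      (s := Ici τ)
    refine (((h1.fun_mul (hy.right h0)).fun_add (h2.fun_mul (hw.right h0))).sub_const
      _).congr_deriv ?_
    rw [hw' τ ⟨hτ.1, hτ.2.le⟩]
    simp only [Function.comp, ← hh, ← hk]
    ring
  have hc : Continuous fun τ => |h (t - τ)| :=
    ((continuous_innerExp p kp kd 0).comp (continuous_sub_left t)).abs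
  have hB : ∀ τ, HasDerivAt (fun τ => R * ∫ σ in s..τ, |h (t - σ)|) (R * |h (t - τ)|) τ :=
    fun τ => (hc.integral_hasStrictDerivAt s τ).hasDerivAt.const_mul R
  have hch : Continuous h := continuous_innerExp p kp kd 0
  have hck : Continuous k := continuous_innerExp p kp kd 1
  have key := image_norm_le_of_norm_deriv_right_le_deriv_boundary (a := s) (b := t)
    ((((hch.comp (continuous_sub_left t)).continuousOn.mul (hy.continuousOn hs)).add
      ((hck.comp (continuous_sub_left t)).continuousOn.mul (hw.continuousOn hs))).sub
        continuousOn_const) hder (B := fun τ => R * ∫ σ in s..τ, |h (t - σ)|)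
    (by simp) hB
    (fun τ hτ => by
      rw [norm_mul, norm_neg, mul_comm]
      exact mul_le_mul_of_nonneg_right (hρ τ ⟨hτ.1, hτ.2.le⟩) (abs_nonneg _))
    (right_mem_Icc.2 hst)
  have e1 : h 0 = 1 := by simp [hh, innerExp_zero]
  have e2 : k 0 = 0 := by simp [hk, innerExp_zero]
  have e3 : ∫ σ in s..t, |h (t - σ)| = ∫ τ in (0 : ℝ)..t - s, |h τ| := by
    rw [intervalIntegral.integral_comp_sub_left (fun τ => |h τ|) t, sub_self]
  simp only [e3, Real.norm_eq_abs] at key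
  simpa [e1, e2] using key

/-- The `L¹` norm of the impulse response bounds the gain of the inner loop. -/
theorem inner_bound (p : Plant) {kp kd : ℝ} (hkp : 0 < kp) (hkd : 0 < kd) :
    ∃ c > 0, ∃ C > 0, ∀ y w w' ρ : ℝ → ℝ, HasFwdDeriv y (fun t => w t - ρ t) →
      HasFwdDeriv w w' → ∀ s T R : ℝ, 0 ≤ s → 0 ≤ R →
      (∀ t ∈ Icc s T, w' t = -(kp / p.Iu) * y t - kd / p.Iu * w t) →
      (∀ t ∈ Icc s T, |ρ t| ≤ R) →
      ∀ t ∈ Icc s T,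
        |y t| ≤ C * Real.exp (-c * (t - s)) * (|y s| + |w s|) + gammaIn p kp kd * R := by
  obtain ⟨c, hc, C, hC, h⟩ := exists_innerExp_decay p hkp hkd
  refine ⟨c, hc, C, hC, ?_⟩
  intro y w w' ρ hy hw s T R hs hR hw' hρ t ht
  have h1 := abs_sub_innerExp_le p kp kd hy hw hs ht.1
    (fun τ hτ => hw' τ ⟨hτ.1, hτ.2.trans ht.2⟩) (fun τ hτ => hρ τ ⟨hτ.1, hτ.2.trans ht.2⟩)
  have h2 := mul_le_mul_of_nonneg_left
    (integral_innerExp_le_gammaIn p hkp hkd (sub_nonneg.2 ht.1)) hR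
  have h3 := mul_le_mul_of_nonneg_right (h 0 (t - s) (sub_nonneg.2 ht.1)) (abs_nonneg (y s))
  have h4 := mul_le_mul_of_nonneg_right (h 1 (t - s) (sub_nonneg.2 ht.1)) (abs_nonneg (w s))
  rw [← abs_mul] at h3 h4
  have h5 := abs_add_le (y t - (innerExp p kp kd 0 0 (t - s) * y s
    + innerExp p kp kd 0 1 (t - s) * w s)) (innerExp p kp kd 0 0 (t - s) * y s
    + innerExp p kp kd 0 1 (t - s) * w s)
  have h6 := abs_add_le (innerExp p kp kd 0 0 (t - s) * y s) (innerExp p kp kd 0 1 (t - s) * w s)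
  rw [sub_add_cancel] at h5
  linarith

/-- These gains place the poles at −a and −2a. The impulse response is then 2e^{−at} − e^{−2at},
which is nonnegative and below 2e^{−at}. -/
theorem gammaIn_le_two_div (p : Plant) {a : ℝ} (ha : 0 < a) :
    gammaIn p (2 * a ^ 2 * p.Iu) (3 * a * p.Iu) ≤ 2 / a := by
  have hI := p.Iu_pos
  have hexp : ∀ b t : ℝ, HasDerivAt (fun t => Real.exp (-b * t)) (-b * Real.exp (-b * t)) t := by
    intro b t
    have := ((hasDerivAt_id t).const_mul (-b)).exp
    simpa [mul_comm] using this
  have heq : ∀ t, 0 ≤ t → innerExp p (2 * a ^ 2 * p.Iu) (3 * a * p.Iu) 0 0 t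
      = 2 * Real.exp (-a * t) - Real.exp (-(2 * a) * t) := by
    intro t ht
    have hy : HasFwdDeriv (fun t => 2 * Real.exp (-a * t) - Real.exp (-(2 * a) * t))
        (fun t => 2 * a * (Real.exp (-(2 * a) * t) - Real.exp (-a * t)) - 0) := fun t _ => by
      refine (((hexp a t).const_mul 2).sub (hexp (2 * a) t)).hasDerivWithinAt.congr_deriv ?_
      ring
    have hw : HasFwdDeriv (fun t => 2 * a * (Real.exp (-(2 * a) * t) - Real.exp (-a * t)))
        (fun t => 2 * a * (-(2 * a) * Real.exp (-(2 * a) * t) - -a * Real.exp (-a * t))) :=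
      fun t _ => (((hexp (2 * a) t).sub (hexp a t)).const_mul (2 * a)).hasDerivWithinAt
    have := abs_sub_innerExp_le p (2 * a ^ 2 * p.Iu) (3 * a * p.Iu) hy hw (R := 0) le_rfl ht
      (fun τ _ => by field_simp; ring) (fun τ _ => by simp)
    simp only [zero_mul, abs_nonpos_iff, sub_zero, mul_zero, Real.exp_zero] at this
    linarith
  rw [gammaIn_eq]
  calc _ ≤ ∫ t in Ioi (0 : ℝ), 2 * Real.exp (-a * t) := by
        refine MeasureTheory.setIntegral_mono_on
          (integrableOn_innerExp p (by positivity) (by positivity))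
          ((exp_neg_integrableOn_Ioi 0 ha).const_mul 2) measurableSet_Ioi fun t ht => ?_
        have ht' : (0 : ℝ) < t := ht
        have h1 : Real.exp (-(2 * a) * t) ≤ Real.exp (-a * t) := by
          apply Real.exp_le_exp.2; nlinarith
        have h2 := Real.exp_pos (-(2 * a) * t)
        rw [heq t ht'.le, abs_of_nonneg] <;> linarith
    _ = 2 / a := by
        rw [MeasureTheory.integral_const_mul, integral_exp_mul_Ioi (by linarith) 0]
        simp
        ring

theorem exists_gains_gammaIn_lt (p : Plant) {γ₀ : ℝ} (hγ : 0 < γ₀) (K : ℝ) :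
    ∃ kp kd : ℝ, K ≤ kp ∧ K ≤ kd ∧ 0 < kp ∧ 0 < kd ∧ gammaIn p kp kd < γ₀ := by
  have hI := p.Iu_pos
  -- The three terms ensure a² ≥ a, gains above K, and 2/a < γ₀.
  obtain ⟨a, ha⟩ : ∃ a, a = 1 + |K| / p.Iu + 2 / γ₀ := ⟨_, rfl⟩
  have h1 : 0 ≤ |K| / p.Iu := by positivity
  have h2 : 0 < 2 / γ₀ := by positivity
  have ha1 : 1 ≤ a := by linarith
  have h3 : |K| ≤ a * p.Iu := by rw [← div_le_iff₀ hI]; linarith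
  have h4 := le_abs_self K
  refine ⟨2 * a ^ 2 * p.Iu, 3 * a * p.Iu, by nlinarith [mul_pos (zero_lt_one.trans_le ha1) hI],
    by nlinarith [mul_pos (zero_lt_one.trans_le ha1) hI], by positivity, by positivity,
    (gammaIn_le_two_div p (zero_lt_one.trans_le ha1)).trans_lt ?_⟩
  rw [div_lt_comm₀ (by linarith) hγ]
  linarith

/-! ### Global convergence of the saturated double integrator -/

theorem HasFwdDeriv.antitoneOn {f f' : ℝ → ℝ} (h : HasFwdDeriv f f')
    (hf : ∀ t, 0 ≤ t → f' t ≤ 0) {s t : ℝ} (hs : 0 ≤ s) (hst : s ≤ t) : f t ≤ f s :=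
  image_le_of_deriv_right_le_deriv_boundary (h.continuousOn hs)
    (fun _ hx => h.right (hs.trans hx.1)) (B := fun _ => f s) (B' := fun _ => 0) le_rfl
    continuousOn_const (fun _ _ => hasDerivWithinAt_const _ _ _)
    (fun x hx => hf x (hs.trans hx.1)) (right_mem_Icc.2 hst)

/-- The primitive of `f` that vanishes at `0`. -/
noncomputable def primitive (f : ℝ → ℝ) (x : ℝ) : ℝ := ∫ ξ in (0 : ℝ)..x, f ξ

theorem hasDerivAt_primitive {f : ℝ → ℝ} (hf : Continuous f) (x : ℝ) :
    HasDerivAt (primitive f) (f x) x :=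
  (hf.integral_hasStrictDerivAt 0 x).hasDerivAt

theorem continuous_primitive {f : ℝ → ℝ} (hf : Continuous f) : Continuous (primitive f) :=
  continuous_iff_continuousAt.2 fun x => (hasDerivAt_primitive hf x).continuousAt

theorem primitive_abs_of_odd {f : ℝ → ℝ} (hf : ∀ x, f (-x) = -f x) (x : ℝ) :
    primitive f |x| = primitive f x := by
  rcases abs_choice x with h | h <;> rw [h]
  unfold primitive
  have h1 := intervalIntegral.integral_comp_neg (a := 0) (b := x) f
  rw [neg_zero] at h1
  rw [intervalIntegral.integral_symm, ← h1, ← intervalIntegral.integral_neg]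
  simp [hf]

/-- On the outer half of the interval up to |x| the integrand is at least f(r/2). The resulting
linear growth makes the energy proper. -/
theorem primitive_lower_bound {f : ℝ → ℝ} (hc : Continuous f) (hm : Monotone f)
    (hodd : ∀ x, f (-x) = -f x) {r x : ℝ} (hr : 0 ≤ r) (hx : r ≤ |x|) :
    |x| / 2 * f (r / 2) ≤ primitive f x := by
  rw [← primitive_abs_of_odd hodd]
  have hf0 : f 0 = 0 := by have := hodd 0; rw [neg_zero] at this; linarith
  have hx0 : 0 ≤ |x| / 2 := by positivity
  have h1 : 0 ≤ ∫ ξ in (0 : ℝ)..|x| / 2, f ξ :=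
    intervalIntegral.integral_nonneg hx0 fun u hu => by rw [← hf0]; exact hm hu.1
  have h2 : ∫ _ in |x| / 2..|x|, f (r / 2) ≤ ∫ ξ in |x| / 2..|x|, f ξ :=
    intervalIntegral.integral_mono_on (by linarith) (by simp) (hc.intervalIntegrable _ _)
      fun u hu => hm (by linarith [hu.1])
  have h3 := intervalIntegral.integral_add_adjacent_intervals
    (hc.intervalIntegrable (μ := MeasureTheory.volume) 0 (|x| / 2))
    (hc.intervalIntegrable (|x| / 2) |x|)
  rw [intervalIntegral.integral_const, smul_eq_mul] at h2
  unfold primitive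
  linarith

/-- Parameters of the double integrator `m x'' = -sat l₁ (kd x' + sat l₂ (kp x))`. -/
structure SatIntegrator where
  m : ℝ
  l₁ : ℝ
  l₂ : ℝ
  kp : ℝ
  kd : ℝ
  m_pos : 0 < m
  l₁_pos : 0 < l₁
  l₂_pos : 0 < l₂
  kp_pos : 0 < kp
  kd_pos : 0 < kd

namespace SatIntegrator

variable (S : SatIntegrator)

/-- The feedback acceleration. -/
noncomputable def acc (x y : ℝ) : ℝ := -sat S.l₁ (S.kd * y + sat S.l₂ (S.kp * x)) / S.m

/-- The restoring force at zero velocity. -/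
noncomputable def restoring (x : ℝ) : ℝ := sat S.l₁ (sat S.l₂ (S.kp * x))

/-- The mechanical energy. -/
noncomputable def energy (z : ℝ × ℝ) : ℝ := S.m / 2 * z.2 ^ 2 + primitive S.restoring z.1

/-- The rate of dissipation of the energy. -/
noncomputable def dissipation (z : ℝ × ℝ) : ℝ :=
  z.2 * (sat S.l₁ (S.kd * z.2 + sat S.l₂ (S.kp * z.1)) - S.restoring z.1)

/-- A bump function whose primitive weights the velocity in the cross term. -/
noncomputable def bump (x : ℝ) : ℝ := max 0 ((S.l₁ / S.kp) ^ 2 - x ^ 2)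

/-- The derivative of the cross term `y * primitive bump x`. -/
noncomputable def crossRate (z : ℝ × ℝ) : ℝ :=
  S.acc z.1 z.2 * primitive S.bump z.1 + z.2 * (S.bump z.1 * z.2)

theorem continuous_sat {l : ℝ} (hl : 0 ≤ l) : Continuous (sat l) := (isLip_sat hl).continuous

theorem continuous_restoring : Continuous S.restoring :=
  (continuous_sat S.l₁_pos.le).comp ((continuous_sat S.l₂_pos.le).comp (continuous_const_mul _))

theorem continuous_bump : Continuous S.bump := by unfold bump; fun_prop

theorem continuous_command : Continuous fun z : ℝ × ℝ =>
    sat S.l₁ (S.kd * z.2 + sat S.l₂ (S.kp * z.1)) := by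
  have h1 := continuous_sat S.l₁_pos.le
  have h2 := continuous_sat S.l₂_pos.le
  fun_prop

theorem continuous_energy : Continuous S.energy := by
  have := continuous_primitive S.continuous_restoring
  unfold energy; fun_prop

theorem continuous_dissipation : Continuous S.dissipation := by
  have h1 := S.continuous_command
  have h2 := S.continuous_restoring
  unfold dissipation; fun_prop

theorem continuous_crossRate : Continuous S.crossRate := by
  have h1 := S.continuous_command
  have h2 := S.continuous_bump
  have h3 := continuous_primitive S.continuous_bump
  unfold crossRate acc; fun_prop

theorem restoring_mono : Monotone S.restoring := fun _ _ h =>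
  sat_mono S.l₁_pos.le (sat_mono S.l₂_pos.le (mul_le_mul_of_nonneg_left h S.kp_pos.le))

theorem restoring_neg (x : ℝ) : S.restoring (-x) = -S.restoring x := by
  simp [restoring, sat_neg]

theorem sat_pos {l x : ℝ} (hl : 0 < l) (hx : 0 < x) : 0 < sat l x := by
  rw [sat_eq hl.le]
  exact lt_max_of_lt_right (lt_min hl hx)

theorem restoring_pos {x : ℝ} (hx : 0 < x) : 0 < S.restoring x :=
  sat_pos S.l₁_pos (sat_pos S.l₂_pos (mul_pos S.kp_pos hx))

theorem dissipation_nonneg (z : ℝ × ℝ) : 0 ≤ S.dissipation z := by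
  unfold dissipation restoring
  have hk := S.kd_pos
  rcases le_total 0 z.2 with h | h
  · exact mul_nonneg h (sub_nonneg.2 (sat_mono S.l₁_pos.le (by nlinarith)))
  · exact mul_nonneg_of_nonpos_of_nonpos h (sub_nonpos.2 (sat_mono S.l₁_pos.le (by nlinarith)))

theorem primitive_bump_pos {x : ℝ} (hx : 0 < x) : 0 < primitive S.bump x := by
  refine intervalIntegral.integral_pos hx S.continuous_bump.continuousOn
    (fun _ _ => le_max_left _ _) ⟨0, ⟨le_rfl, hx.le⟩, ?_⟩
  have := div_pos S.l₁_pos S.kp_pos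
  refine lt_max_of_lt_right ?_
  simp only [ne_eq, OfNat.ofNat_ne_zero, not_false_eq_true, zero_pow, sub_zero]
  positivity

theorem primitive_bump_neg (x : ℝ) : primitive S.bump (-x) = -primitive S.bump x := by
  unfold primitive
  have h1 := intervalIntegral.integral_comp_neg (a := 0) (b := x) S.bump
  rw [neg_zero] at h1
  rw [intervalIntegral.integral_symm, ← h1]
  simp [bump]

theorem symmetric_crossRate (z : ℝ × ℝ) : S.crossRate (-z) = S.crossRate z := by
  have : S.kd * -z.2 + sat S.l₂ (S.kp * -z.1) = -(S.kd * z.2 + sat S.l₂ (S.kp * z.1)) := by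
    rw [mul_neg, mul_neg, sat_neg]; ring
  simp only [crossRate, acc, Prod.fst_neg, Prod.snd_neg, primitive_bump_neg, this, sat_neg]
  simp only [bump, neg_sq]
  ring

theorem symmetric_dissipation (z : ℝ × ℝ) : S.dissipation (-z) = S.dissipation z := by
  have : S.kd * -z.2 + sat S.l₂ (S.kp * -z.1) = -(S.kd * z.2 + sat S.l₂ (S.kp * z.1)) := by
    rw [mul_neg, mul_neg, sat_neg]; ring
  simp only [dissipation, Prod.fst_neg, Prod.snd_neg, this, sat_neg, restoring_neg]
  ring

theorem bump_eq_zero {x : ℝ} (h : S.l₁ ≤ S.kp * x) : S.bump x = 0 := by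
  refine max_eq_left (sub_nonpos.2 (pow_le_pow_left₀ (div_pos S.l₁_pos S.kp_pos).le ?_ 2))
  rwa [div_le_iff₀' S.kp_pos]

/-- Dissipation vanishes either at zero velocity or when the command is saturated at both velocities
y and 0. In the first case only the restoring term of the cross rate remains. In the second case kp
x ≥ l₁ is beyond the support of `bump`, so the term bump(x) y² of unfavourable sign is absent. -/
theorem crossRate_neg_of_pos {z : ℝ × ℝ} (hx : 0 < z.1) (hq : S.dissipation z = 0) :
    S.crossRate z < 0 := by
  have hB := S.primitive_bump_pos hx
  have hkx := mul_pos S.kp_pos hx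
  have hs : 0 < sat S.l₂ (S.kp * z.1) := sat_pos S.l₂_pos hkx
  have key : ∀ y, 0 < sat S.l₁ (S.kd * y + sat S.l₂ (S.kp * z.1)) →
      S.acc z.1 y * primitive S.bump z.1 < 0 := fun y h =>
    mul_neg_of_neg_of_pos (div_neg_of_neg_of_pos (neg_neg_of_pos h) S.m_pos) hB
  rcases mul_eq_zero.1 hq with h | h
  · have := key z.2 (by rw [h, mul_zero, zero_add]; exact S.restoring_pos hx)
    unfold crossRate
    rw [h] at this ⊢
    linarith
  · have h' : sat S.l₁ (S.kd * z.2 + sat S.l₂ (S.kp * z.1)) = S.restoring z.1 := sub_eq_zero.1 h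
    have h1 := key z.2 (by rw [h']; exact S.restoring_pos hx)
    rcases lt_or_ge (sat S.l₂ (S.kp * z.1)) S.l₁ with h2 | h2
    · have h3 : z.2 = 0 := by
        rw [restoring, sat_of_abs_le (x := sat S.l₂ (S.kp * z.1))
          (by rw [abs_of_pos hs]; exact h2.le), sat_eq S.l₁_pos.le] at h'
        rcases le_total S.l₁ (S.kd * z.2 + sat S.l₂ (S.kp * z.1)) with h4 | h4
        · rw [min_eq_left h4, max_eq_right (by linarith [S.l₁_pos])] at h'; linarith
        · rw [min_eq_right h4] at h'
          rcases le_total (-S.l₁) (S.kd * z.2 + sat S.l₂ (S.kp * z.1)) with h5 | h5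
          · rw [max_eq_right h5] at h'
            have : S.kd * z.2 = 0 := by linarith
            exact (mul_eq_zero.1 this).resolve_left S.kd_pos.ne'
          · rw [max_eq_left h5] at h'; linarith [S.l₁_pos]
      unfold crossRate
      rw [h3] at h1 ⊢
      linarith
    · have h3 : S.l₁ ≤ S.kp * z.1 := h2.trans ((le_abs_self _).trans
        ((abs_sat_le_abs S.l₂_pos.le _).trans (abs_of_pos hkx).le))
      unfold crossRate
      rw [S.bump_eq_zero h3]
      linarith

theorem crossRate_neg {z : ℝ × ℝ} (hz : 0 < S.energy z) (hq : S.dissipation z = 0) :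
    S.crossRate z < 0 := by
  rcases lt_trichotomy z.1 0 with h | h | h
  · rw [← S.symmetric_crossRate]
    exact S.crossRate_neg_of_pos (by simpa using h) (by rwa [S.symmetric_dissipation])
  · exfalso
    have hy : z.2 ≠ 0 := by
      intro hy
      simp [energy, h, hy, primitive] at hz
    have h1 : sat S.l₁ (S.kd * z.2) = 0 := by
      simpa [dissipation, h, hy, restoring, sat_zero] using hq
    rcases hy.lt_or_gt with h2 | h2
    · have := sat_pos S.l₁_pos (mul_pos S.kd_pos (neg_pos.2 h2))
      rw [mul_neg, sat_neg] at this
      linarith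
    · have := sat_pos S.l₁_pos (mul_pos S.kd_pos h2)
      linarith
  · exact S.crossRate_neg_of_pos h hq

theorem velocity_le_energy (z : ℝ × ℝ) : S.m / 2 * z.2 ^ 2 ≤ S.energy z := by
  have := primitive_lower_bound S.continuous_restoring S.restoring_mono S.restoring_neg le_rfl
    (abs_nonneg z.1)
  have h0 : S.restoring (0 / 2) = 0 := by simp [restoring, sat_zero]
  rw [h0, mul_zero] at this
  unfold energy
  linarith

theorem position_le_energy {r : ℝ} (hr : 0 ≤ r) {z : ℝ × ℝ} (hz : r ≤ |z.1|) :
    |z.1| / 2 * S.restoring (r / 2) ≤ S.energy z := by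
  have := primitive_lower_bound S.continuous_restoring S.restoring_mono S.restoring_neg hr hz
  have := mul_nonneg (half_pos S.m_pos).le (sq_nonneg z.2)
  unfold energy
  linarith

/-- The energy dominates y² and, for |x| ≥ 1, a multiple of |x|, so its sublevel sets are bounded.
-/
theorem isCompact_energy_shell (e E : ℝ) : IsCompact {z | e ≤ S.energy z ∧ S.energy z ≤ E} := by
  have hm := S.m_pos
  have hpos := S.restoring_pos (x := 1 / 2) (by norm_num)
  refine Metric.isCompact_of_isClosed_isBounded
    ((isClosed_le continuous_const S.continuous_energy).inter
      (isClosed_le S.continuous_energy continuous_const)) ?_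
  rw [isBounded_iff_forall_norm_le]
  refine ⟨max (max 1 (2 * E / S.restoring (1 / 2))) (1 + 2 * E / S.m), fun z hz => ?_⟩
  have h1 := S.velocity_le_energy z
  have h2 : z.2 ^ 2 ≤ 2 * E / S.m := by
    rw [le_div_iff₀ hm]; nlinarith [hz.2]
  rw [Prod.norm_def]
  refine max_le ((?_ : ‖z.1‖ ≤ _).trans (le_max_left _ _))
    ((?_ : ‖z.2‖ ≤ _).trans (le_max_right _ _))
  · rcases le_total |z.1| 1 with h | h
    · exact h.trans (le_max_left _ _)
    · refine le_trans ?_ (le_max_right _ _)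
      have := S.position_le_energy zero_le_one h
      rw [Real.norm_eq_abs, le_div_iff₀ hpos]
      linarith [hz.2]
  · rw [Real.norm_eq_abs]
    have := sq_abs z.2
    nlinarith [abs_nonneg z.2]

variable {S}

theorem hasFwdDeriv_energy {x y : ℝ → ℝ} (hx : HasFwdDeriv x y)
    (hy : HasFwdDeriv y (fun t => S.acc (x t) (y t))) :
    HasFwdDeriv (fun t => S.energy (x t, y t)) (fun t => -S.dissipation (x t, y t)) := by
  intro t ht
  have h1 := (hasDerivAt_primitive S.continuous_restoring (x t)).comp_hasDerivWithinAt t (hx t ht)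
  refine ((((hy t ht).fun_pow 2).const_mul (S.m / 2)).fun_add h1).congr_deriv ?_
  have := S.m_pos
  unfold dissipation acc
  field_simp
  push_cast
  ring

theorem hasFwdDeriv_cross {x y : ℝ → ℝ} (hx : HasFwdDeriv x y)
    (hy : HasFwdDeriv y (fun t => S.acc (x t) (y t))) :
    HasFwdDeriv (fun t => y t * primitive S.bump (x t)) (fun t => S.crossRate (x t, y t)) :=
  fun t ht => (hy t ht).fun_mul
    ((hasDerivAt_primitive S.continuous_bump (x t)).comp_hasDerivWithinAt t (hx t ht))

/-- Otherwise the orbit stays in a compact energy shell where the cross rate minus A times the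
dissipation is at most −η. The cross term plus A times the energy then tends to −∞, although it is
bounded below on the shell. -/
theorem exists_energy_lt {x y : ℝ → ℝ} (hx : HasFwdDeriv x y)
    (hy : HasFwdDeriv y (fun t => S.acc (x t) (y t))) {e : ℝ} (he : 0 < e) :
    ∃ t, 0 ≤ t ∧ S.energy (x t, y t) < e := by
  by_contra! hcon
  set E := S.energy (x 0, y 0)
  have hmem : ∀ t, 0 ≤ t → (x t, y t) ∈ {z | e ≤ S.energy z ∧ S.energy z ≤ E} := fun t ht =>
    ⟨hcon t ht, (hasFwdDeriv_energy hx hy).antitoneOn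
      (fun t _ => neg_nonpos.2 (S.dissipation_nonneg _)) le_rfl ht⟩
  have hK := S.isCompact_energy_shell e E
  obtain ⟨A, hA, η, hη, h⟩ := exists_sub_mul_le_neg hK S.continuous_crossRate
    S.continuous_dissipation (fun z _ => S.dissipation_nonneg z)
    (fun z hz hq => S.crossRate_neg (he.trans_le hz.1) hq)
  have hcc : Continuous fun z : ℝ × ℝ => z.2 * primitive S.bump z.1 := by
    have := continuous_primitive S.continuous_bump
    fun_prop
  obtain ⟨N, hN⟩ := hK.exists_bound_of_continuousOn hcc.continuousOn
  have hW : HasFwdDeriv (fun t => y t * primitive S.bump (x t) + A * S.energy (x t, y t) + η * t)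
      (fun t => S.crossRate (x t, y t) + A * -S.dissipation (x t, y t) + η * 1) := fun t ht =>
    ((hasFwdDeriv_cross hx hy t ht).fun_add
      ((hasFwdDeriv_energy hx hy t ht).const_mul A)).fun_add
        ((hasDerivWithinAt_id t _).const_mul η)
  have hanti : ∀ t, 0 ≤ t → y t * primitive S.bump (x t) + A * S.energy (x t, y t) + η * t
      ≤ y 0 * primitive S.bump (x 0) + A * S.energy (x 0, y 0) + η * 0 := fun t ht =>
    hW.antitoneOn (fun t ht => by linarith [h _ (hmem t ht)]) le_rfl ht
  obtain ⟨t, ht, ht'⟩ : ∃ t, 0 ≤ t ∧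
      N + (y 0 * primitive S.bump (x 0) + A * S.energy (x 0, y 0)) < η * t := by
    refine ⟨|N + (y 0 * primitive S.bump (x 0) + A * S.energy (x 0, y 0))| / η + 1,
      by positivity, ?_⟩
    have := le_abs_self (N + (y 0 * primitive S.bump (x 0) + A * S.energy (x 0, y 0)))
    rw [mul_add, mul_div_cancel₀ _ hη.ne']
    linarith
  have h1 := hanti t ht
  have h2 := (abs_le.1 (hN _ (hmem t ht))).1
  have h3 : 0 ≤ A * S.energy (x t, y t) := mul_nonneg hA (he.le.trans (hmem t ht).1)
  simp only at h2
  linarith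

theorem tendsto_zero {x y : ℝ → ℝ} (hx : HasFwdDeriv x y)
    (hy : HasFwdDeriv y (fun t => S.acc (x t) (y t))) :
    Tendsto x atTop (𝓝 0) ∧ Tendsto y atTop (𝓝 0) := by
  have hm := S.m_pos
  have hE : ∀ e > 0, ∀ᶠ t in atTop, S.energy (x t, y t) < e := by
    intro e he
    obtain ⟨s, hs, h⟩ := exists_energy_lt hx hy he
    filter_upwards [eventually_ge_atTop s] with t ht
    exact ((hasFwdDeriv_energy hx hy).antitoneOn
      (fun t _ => neg_nonpos.2 (S.dissipation_nonneg _)) hs ht).trans_lt h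
  constructor
  · rw [Metric.tendsto_nhds]
    intro r hr
    have hp := S.restoring_pos (half_pos hr)
    filter_upwards [hE (r / 2 * S.restoring (r / 2)) (by positivity)] with t ht
    rw [Real.dist_eq, sub_zero]
    by_contra! hcon
    have h1 := S.position_le_energy hr.le (z := (x t, y t)) hcon
    have h2 : r / 2 * S.restoring (r / 2) ≤ |x t| / 2 * S.restoring (r / 2) := by gcongr
    linarith
  · rw [Metric.tendsto_nhds]
    intro r hr
    filter_upwards [hE (S.m / 2 * r ^ 2) (by positivity)] with t ht
    rw [Real.dist_eq, sub_zero]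
    by_contra! hcon
    have h1 := S.velocity_le_energy (x t, y t)
    have h2 : S.m / 2 * r ^ 2 ≤ S.m / 2 * |y t| ^ 2 := by gcongr
    rw [sq_abs] at h2
    linarith

end SatIntegrator

/-! ### Pointwise estimates for the outer loop -/

theorem abs_cos_sub_one_le (b : ℝ) : |Real.cos b - 1| ≤ min |b| 2 := by
  refine le_min ?_ ?_
  · have := Real.abs_cos_sub_cos_le b 0
    simpa using this
  · rw [abs_le]
    constructor <;> linarith [Real.cos_le_one b, Real.neg_one_le_cos b]

theorem abs_sin_le_min (b : ℝ) : |Real.sin b| ≤ min |b| 2 :=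
  le_min Real.abs_sin_le_abs ((Real.abs_sin_le_one b).trans (by norm_num))

theorem Gains.thrust_mul_sin_add (c : Gains p) (f b : ℝ) :
    c.thrust f * Real.sin (c.thetaRef f + b)
      = f + (f * (Real.cos b - 1) + c.thrust f * Real.cos (c.thetaRef f) * Real.sin b) := by
  rw [Real.sin_add]
  linear_combination Real.cos b * c.thrust_mul_sin f

/-- The factor min(|b|, 2) serves twice: it is linear for small errors and bounded for arbitrary
ones. -/
theorem Gains.abs_thrust_mul_sin_add_sub_le (c : Gains p) (f b : ℝ) :
    |c.thrust f * Real.sin (c.thetaRef f + b) - f| ≤ (|f| + p.Umax) * min |b| 2 := by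
  rw [c.thrust_mul_sin_add, add_sub_cancel_left, add_mul]
  refine (abs_add_le _ _).trans (add_le_add ?_ ?_)
  · rw [abs_mul]; exact mul_le_mul_of_nonneg_left (abs_cos_sub_one_le b) (abs_nonneg _)
  · rw [abs_mul]
    exact mul_le_mul (c.abs_thrust_mul_cos_le f) (abs_sin_le_min b) (abs_nonneg _) p.Umax_pos.le

theorem Gains.abs_force_le (c : Gains p) (ab a v : ℝ) :
    |c.force ab a v| ≤ (c.kpa + c.kda) * (|a - ab| + |v|) + p.M * p.g := by
  have hM := mul_pos p.M_pos p.g_pos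
  have h1 := c.kpa_pos
  have h2 := c.kda_pos
  unfold Gains.force
  calc _ ≤ |-c.kpa * (a - ab)| + |c.kda * v| + |p.M * p.g * Real.cos a| :=
        (abs_add_le _ _).trans (add_le_add_left (abs_sub _ _) _)
    _ = c.kpa * |a - ab| + c.kda * |v| + p.M * p.g * |Real.cos a| := by
        rw [abs_mul, abs_mul, abs_mul, abs_neg, abs_of_pos h1, abs_of_pos h2, abs_of_pos hM]
    _ ≤ _ := by
        have := mul_le_of_le_one_right hM.le (Real.abs_cos_le_one a)
        nlinarith [mul_nonneg h1.le (abs_nonneg v), mul_nonneg h2.le (abs_nonneg (a - ab))]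

theorem Gains.abs_outerAcc_add_le (c : Gains p) (ab a v b : ℝ) :
    |c.outerAcc ab a v b + c.kpa / p.I0 * (a - ab) + c.kda / p.I0 * v|
      ≤ (|c.force ab a v| + p.Umax) * min |b| 2 / p.I0 := by
  have hI := p.I0_pos
  have e : c.outerAcc ab a v b + c.kpa / p.I0 * (a - ab) + c.kda / p.I0 * v
      = (c.thrust (c.force ab a v) * Real.sin (c.thetaRef (c.force ab a v) + b)
          - c.force ab a v) / p.I0 := by
    unfold Gains.outerAcc
    rw [eq_div_iff hI.ne']
    field_simp
    unfold Gains.force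
    ring
  rw [e, abs_div, abs_of_pos hI]
  exact div_le_div_of_nonneg_right (c.abs_thrust_mul_sin_add_sub_le _ _) hI.le

/-- As long as the thrust is not clipped, the closed loop differs from the outer loop only by the
coupling with the UGV acceleration. -/
theorem accA_eq_outerAcc (c : Gains p) (xb ab : ℝ) {s : Fin 6 → ℝ}
    (hs : |c.force ab (s 2) (s 3)| ≤ p.Umax) :
    accA c xb ab s = c.outerAcc ab (s 2) (s 3) (attErr c ab s)
      + p.M * Real.sin (s 2) * accX c xb s / p.I0 := by
  unfold accA cmd1
  rw [posSat_of_nonneg p.Umax_pos.le (c.thrust_pos _).le, min_eq_left (c.thrust_le hs),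
    Gains.outerAcc, attErr, Gains.betaRef,
    show ∀ A B C : ℝ, A + (B - (C + A)) = B - C from fun A B C => by ring]
  ring

theorem abs_accA_add_le (c : Gains p) (xb ab : ℝ) {s : Fin 6 → ℝ}
    (hs : |c.force ab (s 2) (s 3)| ≤ p.Umax) :
    |accA c xb ab s + c.kpa / p.I0 * (s 2 - ab) + c.kda / p.I0 * s 3|
      ≤ 2 * p.Umax / p.I0 * min |attErr c ab s| 2 + p.M / p.I0 * |accX c xb s| := by
  have hI := p.I0_pos
  have hM := p.M_pos
  have h1 := c.abs_outerAcc_add_le ab (s 2) (s 3) (attErr c ab s)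
  have h2 : (|c.force ab (s 2) (s 3)| + p.Umax) * min |attErr c ab s| 2 / p.I0
      ≤ 2 * p.Umax / p.I0 * min |attErr c ab s| 2 := by
    rw [mul_div_right_comm]
    gcongr
    linarith
  have h3 : |p.M * Real.sin (s 2) * accX c xb s / p.I0| ≤ p.M / p.I0 * |accX c xb s| := by
    rw [abs_div, abs_mul, abs_mul, abs_of_pos hM, abs_of_pos hI, div_mul_eq_mul_div]
    gcongr
    exact mul_le_of_le_one_right hM.le (Real.abs_sin_le_one _)
  rw [accA_eq_outerAcc c xb ab hs]
  have h4 := abs_add_le (c.outerAcc ab (s 2) (s 3) (attErr c ab s)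
    + c.kpa / p.I0 * (s 2 - ab) + c.kda / p.I0 * s 3) (p.M * Real.sin (s 2) * accX c xb s / p.I0)
  rw [show ∀ A B C D : ℝ, A + B + C + D = A + D + B + C from fun A B C D => by ring] at h4
  linarith

/-- A bound of the sensitivity of the desired attitude. -/
noncomputable def Gains.sens (c : Gains p) : ℝ :=
  1 + c.gam * c.eps * (c.kpa + c.kda + p.M * p.g)

theorem Gains.sens_pos (c : Gains p) : 0 < c.sens := by
  have := c.gam_pos; have := c.eps_pos; have := c.kpa_pos; have := c.kda_pos
  have := p.M_pos; have := p.g_pos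
  unfold Gains.sens; positivity

theorem Gains.abs_refRate_le (c : Gains p) {D : ℝ} (hD : |D| ≤ c.gam * c.eps) (a v w : ℝ) :
    |v + D * (-c.kpa * v - c.kda * w - p.M * p.g * Real.sin a * v)|
      ≤ c.sens * (|v| + |w|) := by
  have hM := mul_pos p.M_pos p.g_pos
  have h1 := c.kpa_pos
  have h2 := c.kda_pos
  have hge := mul_pos c.gam_pos c.eps_pos
  have e1 : |-c.kpa * v - c.kda * w - p.M * p.g * Real.sin a * v|
      ≤ (c.kpa + c.kda + p.M * p.g) * (|v| + |w|) := by
    calc _ ≤ |-c.kpa * v| + |c.kda * w| + |p.M * p.g * Real.sin a * v| :=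
          (abs_sub _ _).trans (add_le_add_left (abs_sub _ _) _)
      _ = c.kpa * |v| + c.kda * |w| + p.M * p.g * |Real.sin a| * |v| := by
          rw [abs_mul, abs_mul, abs_mul, abs_mul, abs_neg, abs_of_pos h1, abs_of_pos h2,
            abs_of_pos hM]
      _ ≤ c.kpa * |v| + c.kda * |w| + p.M * p.g * 1 * |v| := by
          gcongr; exact Real.abs_sin_le_one a
      _ ≤ _ := by
          nlinarith [mul_nonneg h1.le (abs_nonneg w), mul_nonneg h2.le (abs_nonneg v),
            mul_nonneg hM.le (abs_nonneg w)]
  calc _ ≤ |v| + |D| * |-c.kpa * v - c.kda * w - p.M * p.g * Real.sin a * v| := by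
        rw [← abs_mul]; exact abs_add_le _ _
    _ ≤ (|v| + |w|) + c.gam * c.eps * ((c.kpa + c.kda + p.M * p.g) * (|v| + |w|)) := by
        gcongr
        linarith [abs_nonneg w]
    _ = _ := by unfold Gains.sens; ring

theorem Gains.abs_betaRefRate_le (c : Gains p) (ab a v w : ℝ) :
    |c.betaRefRate ab a v w| ≤ c.sens * (|v| + |w|) :=
  c.abs_refRate_le (c.abs_deriv_thetaRef_le _) a v w

theorem Gains.abs_betaRef_sub_le (c : Gains p) (ab a v : ℝ) :
    |c.betaRef ab a v - c.betaEq ab| ≤ c.sens * (|a - ab| + |v|) := by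
  have hM := mul_pos p.M_pos p.g_pos
  have h1 := c.kpa_pos
  have h2 := c.kda_pos
  have hge := mul_pos c.gam_pos c.eps_pos
  have e1 : |c.force ab a v - c.force ab ab 0|
      ≤ (c.kpa + c.kda + p.M * p.g) * (|a - ab| + |v|) := by
    have : c.force ab a v - c.force ab ab 0
        = -c.kpa * (a - ab) - c.kda * v + p.M * p.g * (Real.cos a - Real.cos ab) := by
      unfold Gains.force; ring
    rw [this]
    calc _ ≤ |-c.kpa * (a - ab)| + |c.kda * v| + |p.M * p.g * (Real.cos a - Real.cos ab)| :=
          (abs_add_le _ _).trans (add_le_add_left (abs_sub _ _) _)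
      _ = c.kpa * |a - ab| + c.kda * |v| + p.M * p.g * |Real.cos a - Real.cos ab| := by
          rw [abs_mul, abs_mul, abs_mul, abs_neg, abs_of_pos h1, abs_of_pos h2, abs_of_pos hM]
      _ ≤ c.kpa * |a - ab| + c.kda * |v| + p.M * p.g * |a - ab| := by
          exact add_le_add_right
            (mul_le_mul_of_nonneg_left (Real.abs_cos_sub_cos_le a ab) hM.le) _
      _ ≤ _ := by
          nlinarith [mul_nonneg h1.le (abs_nonneg v), mul_nonneg h2.le (abs_nonneg (a - ab)),
            mul_nonneg hM.le (abs_nonneg v)]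
  have e2 := c.abs_thetaRef_sub_le (c.force ab a v) (c.force ab ab 0)
  have e3 : c.betaRef ab a v - c.betaEq ab
      = (a - ab) + (c.thetaRef (c.force ab a v) - c.thetaRef (c.force ab ab 0)) := by
    unfold Gains.betaEq Gains.betaRef; ring
  rw [e3]
  calc _ ≤ |a - ab| + |c.thetaRef (c.force ab a v) - c.thetaRef (c.force ab ab 0)| :=
        abs_add_le _ _
    _ ≤ (|a - ab| + |v|) + c.gam * c.eps * ((c.kpa + c.kda + p.M * p.g) * (|a - ab| + |v|)) := by
        refine add_le_add (by linarith [abs_nonneg v]) (e2.trans (by gcongr))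
    _ = _ := by unfold Gains.sens; ring

/-! ### The asymptotic gain of the outer loop -/

theorem Gains.abs_accel_le (c : Gains p) {a v w D : ℝ}
    (h : |w + c.kpa / p.I0 * a + c.kda / p.I0 * v| ≤ D) :
    |w| ≤ (c.kpa / p.I0 + c.kda / p.I0) * (|a| + |v|) + D := by
  have h1 := div_pos c.kpa_pos p.I0_pos
  have h2 := div_pos c.kda_pos p.I0_pos
  have e : w = (w + c.kpa / p.I0 * a + c.kda / p.I0 * v) - c.kpa / p.I0 * a - c.kda / p.I0 * v := by
    ring
  rw [e]
  calc _ ≤ |w + c.kpa / p.I0 * a + c.kda / p.I0 * v| + |c.kpa / p.I0 * a| + |c.kda / p.I0 * v| :=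
        (abs_sub _ _).trans (add_le_add_left (abs_sub _ _) _)
    _ ≤ _ := by
        rw [abs_mul, abs_mul, abs_of_pos h1, abs_of_pos h2]
        nlinarith [mul_nonneg h1.le (abs_nonneg v), mul_nonneg h2.le (abs_nonneg a)]

/-- The perturbation (|f| + Umax)|b| contains a part proportional to the state, since f is
affine-bounded in it. Restricting |b| makes this part small enough to be absorbed by input-to-state
stability; the remainder is linear in b. -/
theorem Gains.exists_isOuterGain (c : Gains p) (ab : ℝ) :
    ∃ θ₀ ∈ Ioo 0 (Real.pi / 2), ∃ Γ > 0, ∀ θm ∈ Ioc 0 θ₀, c.IsOuterGain ab θm Γ := by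
  have hI := p.I0_pos
  have hU := p.Umax_pos
  have hMg := mul_pos p.M_pos p.g_pos
  have hsens := c.sens_pos
  have hP := div_pos c.kpa_pos hI
  have hQ := div_pos c.kda_pos hI
  have hk : 0 < c.kpa + c.kda := add_pos c.kpa_pos c.kda_pos
  obtain ⟨κ, hκ, r, hr, C, hC, hiss⟩ := second_order_bound hP hQ
  obtain ⟨N, hN⟩ : ∃ N, N = (p.M * p.g + p.Umax) / p.I0 := ⟨_, rfl⟩
  have hN0 : 0 < N := by rw [hN]; positivity
  obtain ⟨H, hH⟩ : ∃ H, H = c.kpa / p.I0 + c.kda / p.I0 + κ := ⟨_, rfl⟩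
  have hH0 : 0 < H := by rw [hH]; positivity
  -- The second bound on θ₀ makes (kpa + kda)|b| / I0 ≤ κ, the tolerated linear gain; the first
  -- keeps θ₀ below π/2.
  refine ⟨min 1 (κ * p.I0 / (c.kpa + c.kda)), ⟨by positivity, ?_⟩,
    c.sens * ((1 + H) * (C * N) + N), by positivity, ?_⟩
  · exact (min_le_left _ _).trans_lt (by linarith [Real.pi_gt_three])
  intro θm hθm
  refine ⟨by positivity, ?_⟩
  intro a v b hb hbθ ha hv k hk' η hη
  have hk0 : 0 ≤ k := by
    obtain ⟨t, ht⟩ := hk'.exists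
    exact (abs_nonneg _).trans ht
  obtain ⟨w, hw⟩ : ∃ w : ℝ → ℝ, w = fun t => c.outerAcc ab (a t) (v t) (b t) := ⟨_, rfl⟩
  have hpert : ∀ t, 0 ≤ t → |b t| ≤ k →
      |w t + c.kpa / p.I0 * (a t - ab) + c.kda / p.I0 * v t| ≤ κ * (|a t - ab| + |v t|) + N * k := by
    intro t ht htk
    rw [hw]
    refine (c.abs_outerAcc_add_le ab (a t) (v t) (b t)).trans ?_
    have h1 : min |b t| 2 ≤ κ * p.I0 / (c.kpa + c.kda) :=
      (min_le_left _ _).trans ((hbθ t ht).trans (hθm.2.trans (min_le_right _ _)))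
    have h2 : min |b t| 2 ≤ k := (min_le_left _ _).trans htk
    have h0 : 0 ≤ min |b t| 2 := le_min (abs_nonneg _) zero_le_two
    have h3 := c.abs_force_le ab (a t) (v t)
    rw [div_le_iff₀ hI]
    calc _ ≤ ((c.kpa + c.kda) * (|a t - ab| + |v t|) + p.M * p.g + p.Umax) * min |b t| 2 := by
          gcongr
      _ = (c.kpa + c.kda) * (|a t - ab| + |v t|) * min |b t| 2
          + (p.M * p.g + p.Umax) * min |b t| 2 := by ring
      _ ≤ (c.kpa + c.kda) * (|a t - ab| + |v t|) * (κ * p.I0 / (c.kpa + c.kda))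
          + (p.M * p.g + p.Umax) * k := by gcongr
      _ = _ := by rw [hN]; field_simp
  obtain ⟨s, hs⟩ := eventually_atTop.1 hk'
  have hs' : ∀ t, max s 0 ≤ t → |b t| ≤ k := fun t ht => hs t ((le_max_left _ _).trans ht)
  have hbound : ∀ t, max s 0 ≤ t → |a t - ab| + |v t|
      ≤ C * (|a (max s 0) - ab| + |v (max s 0)|) * Real.exp (-r * (t - max s 0)) + C * (N * k) := by
    intro t ht
    have := hiss (fun t => a t - ab) v w (fun t ht => (ha t ht).sub_const ab)
      (fun t ht => by rw [hw]; exact hv t ht) (max s 0) t (N * k) (le_max_right _ _)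
      (by positivity)
      (fun τ hτ => hpert τ ((le_max_right _ _).trans hτ.1) (hs' τ hτ.1)) t ⟨ht, le_rfl⟩
    linarith
  have hη' : 0 < η / (c.sens * (1 + H)) := by positivity
  filter_upwards [eventually_le_of_exp_bound hr hbound hη', eventually_ge_atTop (max s 0)]
    with t h1 h2
  have h3 := hpert t ((le_max_right _ _).trans h2) (hs' t h2)
  have h4 := c.abs_accel_le h3
  have h5 := c.abs_betaRefRate_le ab (a t) (v t) (w t)
  rw [hw] at h5
  refine h5.trans ?_
  rw [hw] at h4
  have h6 : |v t| + |c.outerAcc ab (a t) (v t) (b t)|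
      ≤ (1 + H) * (C * (N * k) + η / (c.sens * (1 + H))) + N * k := by
    calc _ ≤ (1 + H) * (|a t - ab| + |v t|) + N * k := by
          rw [hH]; linarith [abs_nonneg (a t - ab)]
      _ ≤ _ := by gcongr
  calc _ ≤ c.sens * ((1 + H) * (C * (N * k) + η / (c.sens * (1 + H))) + N * k) := by gcongr
    _ = _ := by field_simp; ring

theorem Gains.gammaOut_nonneg (c : Gains p) (ab θm : ℝ) : 0 ≤ c.gammaOut ab θm :=
  Real.sInf_nonneg fun _ h => h.1

theorem Gains.gammaOut_le (c : Gains p) {ab θm Γ : ℝ} (h : c.IsOuterGain ab θm Γ) :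
    c.gammaOut ab θm ≤ Γ :=
  csInf_le ⟨0, fun _ h => h.1⟩ h

/-! ### Estimates along unsaturated solutions -/

theorem IsSolution.coord {n : ℕ} {F : (Fin n → ℝ) → Fin n → ℝ} {φ : ℝ → Fin n → ℝ}
    (h : IsSolution F φ) (i : Fin n) : HasFwdDeriv (fun t => φ t i) (fun t => F (φ t) i) :=
  fun t ht => hasDerivWithinAt_pi.1 (h t ht) i

theorem IsSolution.continuousOn {n : ℕ} {F : (Fin n → ℝ) → Fin n → ℝ} {φ : ℝ → Fin n → ℝ}
    (h : IsSolution F φ) (T : ℝ) : ContinuousOn φ (Icc 0 T) :=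
  fun t ht => (h t ht.1).continuousWithinAt.mono Icc_subset_Ici_self

/-- The rate of the desired attitude in the absence of saturation. -/
noncomputable def refRate (c : Gains p) (xb ab : ℝ) (s : Fin 6 → ℝ) : ℝ :=
  s 3 + c.thetaLinDeriv (c.force ab (s 2) (s 3)) *
    (-c.kpa * s 3 - c.kda * accA c xb ab s - p.M * p.g * Real.sin (s 2) * s 3)

/-- The attitude error in the absence of saturation. -/
noncomputable def attErrLin (c : Gains p) (ab : ℝ) (s : Fin 6 → ℝ) : ℝ :=
  s 4 - (s 2 + c.thetaLin (c.force ab (s 2) (s 3)))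

theorem attErrLin_eq (c : Gains p) (ab : ℝ) {s : Fin 6 → ℝ}
    (hs : |c.force ab (s 2) (s 3)| ≤ p.Umax) : attErrLin c ab s = attErr c ab s := by
  rw [attErrLin, ← c.thetaRef_of_abs_le hs]; rfl

theorem hasFwdDeriv_attErrLin {c : Gains p} {xb ab kp kd : ℝ} {φ : ℝ → Fin 6 → ℝ}
    (h : IsSolution (closedLoop c xb ab kp kd) φ) :
    HasFwdDeriv (fun t => attErrLin c ab (φ t)) (fun t => φ t 5 - refRate c xb ab (φ t)) := by
  intro t ht
  have h2 : HasDerivWithinAt (fun t => φ t 2) (φ t 3) (Ici 0) t := h.coord 2 t ht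
  have h3 : HasDerivWithinAt (fun t => φ t 3) (accA c xb ab (φ t)) (Ici 0) t := h.coord 3 t ht
  have h4 : HasDerivWithinAt (fun t => φ t 4) (φ t 5) (Ici 0) t := h.coord 4 t ht
  have hf : HasDerivWithinAt (fun t => c.force ab (φ t 2) (φ t 3))
      (-c.kpa * φ t 3 - c.kda * accA c xb ab (φ t) - p.M * p.g * Real.sin (φ t 2) * φ t 3)
      (Ici 0) t := by
    refine ((((h2.sub_const ab).const_mul (-c.kpa)).sub (h3.const_mul c.kda)).add
      (h2.cos.const_mul (p.M * p.g))).congr_deriv ?_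
    ring
  exact h4.fun_sub (h2.fun_add ((c.hasDerivAt_thetaLin _).comp_hasDerivWithinAt t hf))

theorem abs_refRate_le (c : Gains p) (xb ab : ℝ) (s : Fin 6 → ℝ) :
    |refRate c xb ab s| ≤ c.sens * (|s 3| + |accA c xb ab s|) :=
  c.abs_refRate_le (by
    rw [abs_of_nonneg (c.thetaLinDeriv_nonneg _)]; exact c.thetaLinDeriv_le _) _ _ _

theorem accB_eq {c : Gains p} {ab kp kd : ℝ} {s : Fin 6 → ℝ} (hs : |cmd2 c ab kp kd s| ≤ p.Tmax) :
    accB c ab kp kd s = -(kp / p.Iu) * attErr c ab s - kd / p.Iu * s 5 := by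
  rw [accB, sat_of_abs_le hs, cmd2_eq]; ring

/-- Since |f| ≤ Umax here, no smallness of the attitude error is needed. The bound B on min(|b|, 2)
may be the crude 2 or an actual bound of the error, and the UGV acceleration enters as a second
input. -/
theorem exists_outer_bound (c : Gains p) (ab : ℝ) :
    ∃ r > 0, ∃ C > 0, ∀ xb kp kd φ, IsSolution (closedLoop c xb ab kp kd) φ →
      ∀ s T B D : ℝ, 0 ≤ s → 0 ≤ B → 0 ≤ D →
      (∀ t ∈ Icc s T, |c.force ab (φ t 2) (φ t 3)| ≤ p.Umax) →
      (∀ t ∈ Icc s T, min |attErr c ab (φ t)| 2 ≤ B) →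
      (∀ t ∈ Icc s T, |accX c xb (φ t)| ≤ D) →
      ∀ t ∈ Icc s T,
        |φ t 2 - ab| + |φ t 3|
          ≤ C * Real.exp (-r * (t - s)) * (|φ s 2 - ab| + |φ s 3|) + C * (B + D) ∧
        |refRate c xb ab (φ t)|
          ≤ C * Real.exp (-r * (t - s)) * (|φ s 2 - ab| + |φ s 3|) + C * (B + D) := by
  have hI := p.I0_pos
  have hU := p.Umax_pos
  have hM := p.M_pos
  have hsens := c.sens_pos
  have hP := div_pos c.kpa_pos hI
  have hQ := div_pos c.kda_pos hI
  obtain ⟨κ, hκ, r, hr, C₁, hC₁, hiss⟩ := second_order_bound hP hQ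
  obtain ⟨N, hN⟩ : ∃ N, N = 2 * p.Umax / p.I0 + p.M / p.I0 := ⟨_, rfl⟩
  have hN0 : 0 < N := by rw [hN]; positivity
  obtain ⟨H, hH⟩ : ∃ H, H = c.kpa / p.I0 + c.kda / p.I0 := ⟨_, rfl⟩
  have hH0 : 0 < H := by rw [hH]; positivity
  obtain ⟨G, hG⟩ : ∃ G, G = C₁ * (1 + N) := ⟨_, rfl⟩
  have hG0 : 0 < G := by rw [hG]; positivity
  refine ⟨r, hr, G + c.sens * ((1 + H) * G + N), by positivity, ?_⟩
  intro xb kp kd φ hφ s T B D hs hB hD hf hatt hacc t ht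
  have hpert : ∀ t ∈ Icc s T,
      |accA c xb ab (φ t) + c.kpa / p.I0 * (φ t 2 - ab) + c.kda / p.I0 * φ t 3| ≤ N * (B + D) := by
    intro t ht
    refine (abs_accA_add_le c xb ab (hf t ht)).trans ?_
    have h1 : 2 * p.Umax / p.I0 * min |attErr c ab (φ t)| 2 ≤ 2 * p.Umax / p.I0 * B := by
      gcongr; exact hatt t ht
    have h2 : p.M / p.I0 * |accX c xb (φ t)| ≤ p.M / p.I0 * D := by
      gcongr; exact hacc t ht
    have h3 : 0 ≤ 2 * p.Umax / p.I0 * D := by positivity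
    have h4 : 0 ≤ p.M / p.I0 * B := by positivity
    rw [hN]; linarith
  have hS := hiss (fun t => φ t 2 - ab) (fun t => φ t 3) (fun t => accA c xb ab (φ t))
    (fun t ht => (hφ.coord 2 t ht).sub_const ab) (hφ.coord 3) s T (N * (B + D)) hs (by positivity)
    (fun t ht => (hpert t ht).trans (le_add_of_nonneg_left (by positivity))) t ht
  obtain ⟨X, hX⟩ : ∃ X, X = Real.exp (-r * (t - s)) * (|φ s 2 - ab| + |φ s 3|) := ⟨_, rfl⟩
  have hX0 : 0 ≤ X := by rw [hX]; positivity
  have hBD : 0 ≤ B + D := by positivity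
  simp only [mul_assoc, ← hX] at hS ⊢
  have hS' : |φ t 2 - ab| + |φ t 3| ≤ G * X + G * (B + D) := by
    have h1 : 0 ≤ C₁ * N * X := by positivity
    have h2 : 0 ≤ C₁ * (B + D) := by positivity
    rw [hG]; linarith
  have hw := c.abs_accel_le (hpert t ht)
  rw [← hH] at hw
  have hrate := abs_refRate_le c xb ab (φ t)
  have hrate' : |refRate c xb ab (φ t)|
      ≤ c.sens * ((1 + H) * (G * X + G * (B + D)) + N * (B + D)) := by
    refine hrate.trans (mul_le_mul_of_nonneg_left ?_ hsens.le)
    calc _ ≤ (1 + H) * (|φ t 2 - ab| + |φ t 3|) + N * (B + D) := by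
          linarith [abs_nonneg (φ t 2 - ab)]
      _ ≤ _ := by gcongr
  have h0 : 0 ≤ c.sens * N * X := by positivity
  have h1 : 0 ≤ c.sens * ((1 + H) * G + N) * X := by positivity
  have h2 : 0 ≤ c.sens * ((1 + H) * G + N) * (B + D) := by positivity
  have h3 : 0 ≤ G * X := by positivity
  have h4 : 0 ≤ G * (B + D) := by positivity
  constructor <;> linarith

/-- `attErrLin` is differentiable everywhere and equals `attErr` while |f| ≤ Umax, so the corners of
`thetaRef` cause no difficulty. -/
theorem exists_inner_bound (c : Gains p) (ab : ℝ) {kp kd : ℝ} (hkp : 0 < kp) (hkd : 0 < kd) :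
    ∃ r > 0, ∃ C > 0, ∀ xb φ, IsSolution (closedLoop c xb ab kp kd) φ →
      ∀ s T R : ℝ, 0 ≤ s → 0 ≤ R →
      (∀ t ∈ Icc s T, |c.force ab (φ t 2) (φ t 3)| ≤ p.Umax) →
      (∀ t ∈ Icc s T, |cmd2 c ab kp kd (φ t)| ≤ p.Tmax) →
      (∀ t ∈ Icc s T, |refRate c xb ab (φ t)| ≤ R) →
      ∀ t ∈ Icc s T, |attErr c ab (φ t)|
        ≤ C * Real.exp (-r * (t - s)) * (|attErr c ab (φ s)| + |φ s 5|) + gammaIn p kp kd * R := by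
  obtain ⟨r, hr, C, hC, h⟩ := inner_bound p hkp hkd
  refine ⟨r, hr, C, hC, ?_⟩
  intro xb φ hφ s T R hs hR hf hc hρ t ht
  have := h (fun t => attErrLin c ab (φ t)) (fun t => φ t 5) (fun t => accB c ab kp kd (φ t))
    (fun t => refRate c xb ab (φ t)) (hasFwdDeriv_attErrLin hφ) (hφ.coord 5) s T R hs hR
    (fun t ht => by simp only [accB_eq (hc t ht), attErrLin_eq c ab (hf t ht)]) hρ t ht
  simpa only [attErrLin_eq c ab (hf t ht),
    attErrLin_eq c ab (hf s (left_mem_Icc.2 (ht.1.trans ht.2)))] using this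

/-! ### Convergence of unsaturated solutions -/

theorem Unsaturated.abs_force_le {c : Gains p} {xb ab kp kd : ℝ} {s : Fin 6 → ℝ}
    (h : Unsaturated c xb ab kp kd s) : |c.force ab (s 2) (s 3)| ≤ p.Umax :=
  c.abs_le_of_thrust_le h.1.2

/-- The UGV as a saturated double integrator. -/
def Gains.ugv (c : Gains p) : SatIntegrator where
  m := p.mc
  l₁ := c.l1
  l₂ := c.l2
  kp := c.kpx
  kd := c.kdx
  m_pos := p.mc_pos
  l₁_pos := c.l1_pos
  l₂_pos := c.l2_pos
  kp_pos := c.kpx_pos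
  kd_pos := c.kdx_pos

theorem tendsto_ugv {c : Gains p} {xb ab kp kd : ℝ} {φ : ℝ → Fin 6 → ℝ}
    (h : IsSolution (closedLoop c xb ab kp kd) φ) :
    Tendsto (fun t => φ t 0) atTop (𝓝 xb) ∧ Tendsto (fun t => φ t 1) atTop (𝓝 0) := by
  have := SatIntegrator.tendsto_zero (S := c.ugv) (x := fun t => φ t 0 - xb) (y := fun t => φ t 1)
    (fun t ht => (h.coord 0 t ht).sub_const xb)
    (fun t ht => (h.coord 1 t ht).congr_deriv (accX_eq c xb (φ t)))
  exact ⟨by simpa using this.1.add_const xb, this.2⟩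

theorem abs_accX_le_linear (c : Gains p) (xb : ℝ) (s : Fin 6 → ℝ) :
    |accX c xb s| ≤ (c.kpx + c.kdx) / p.mc * (|s 0 - xb| + |s 1|) := by
  have hm := p.mc_pos
  have h1 := c.kpx_pos
  have h2 := c.kdx_pos
  rw [accX_eq, abs_div, abs_of_pos hm, div_mul_eq_mul_div]
  gcongr
  unfold cmd3
  rw [abs_neg]
  refine (abs_sat_le_abs c.l1_pos.le _).trans ((abs_add_le _ _).trans ?_)
  have h3 := abs_sat_le_abs c.l2_pos.le (c.kpx * (s 0 - xb))
  rw [abs_mul, abs_of_pos h1] at h3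
  rw [abs_mul, abs_of_pos h2]
  nlinarith [mul_nonneg h1.le (abs_nonneg (s 1)), mul_nonneg h2.le (abs_nonneg (s 0 - xb))]

theorem eventually_abs_accX_le {c : Gains p} {xb ab kp kd : ℝ} {φ : ℝ → Fin 6 → ℝ}
    (h : IsSolution (closedLoop c xb ab kp kd) φ) {η : ℝ} (hη : 0 < η) :
    ∀ᶠ t in atTop, |accX c xb (φ t)| ≤ η := by
  obtain ⟨h0, h1⟩ := tendsto_ugv h
  have h2 : Tendsto (fun t => (c.kpx + c.kdx) / p.mc * (|φ t 0 - xb| + |φ t 1|)) atTop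
      (𝓝 ((c.kpx + c.kdx) / p.mc * (|xb - xb| + |0|))) :=
    (((h0.sub_const xb).abs).add h1.abs).const_mul _
  simp only [sub_self, abs_zero, add_zero, mul_zero] at h2
  filter_upwards [h2.eventually (gt_mem_nhds hη)] with t ht
  exact (abs_accX_le_linear c xb (φ t)).trans ht.le

/-- Small-gain theorem with a gain of the outer loop that is independent of the attitude gains. -/
theorem exists_tendsto_of_unsaturated (c : Gains p) (ab : ℝ) :
    ∃ Γ > 0, ∀ kp kd : ℝ, 0 < kp → 0 < kd → gammaIn p kp kd * Γ < 1 →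
      ∀ xb φ, IsSolution (closedLoop c xb ab kp kd) φ →
      (∀ t, 0 ≤ t → Unsaturated c xb ab kp kd (φ t)) →
      Tendsto φ atTop (𝓝 (eqState c xb ab)) := by
  obtain ⟨r, hr, C, hC, hout⟩ := exists_outer_bound c ab
  refine ⟨C, hC, ?_⟩
  intro kp kd hkp hkd hγ xb φ hφ hun
  obtain ⟨ri, hri, Ci, hCi, hin⟩ := exists_inner_bound c ab hkp hkd
  have hγ0 := gammaIn_nonneg p kp kd
  set γ := gammaIn p kp kd
  have hf : ∀ s T : ℝ, 0 ≤ s → ∀ t ∈ Icc s T, |c.force ab (φ t 2) (φ t 3)| ≤ p.Umax :=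
    fun s T hs t ht => (hun t (hs.trans ht.1)).abs_force_le
  have hc2 : ∀ s T : ℝ, 0 ≤ s → ∀ t ∈ Icc s T, |cmd2 c ab kp kd (φ t)| ≤ p.Tmax :=
    fun s T hs t ht => (hun t (hs.trans ht.1)).2.1
  have hD : 0 ≤ c.l1 / p.mc := (div_pos c.l1_pos p.mc_pos).le
  -- A priori boundedness: taking 2 as bound of min(|b|, 2) bounds the reference rate, and hence the
  -- error, without a small-gain condition.
  have hbdd : ∃ k, ∀ᶠ t in atTop, |attErr c ab (φ t)| ≤ k := by
    obtain ⟨R, hR⟩ : ∃ R, R = C * (|φ 0 2 - ab| + |φ 0 3|) + C * (2 + c.l1 / p.mc) := ⟨_, rfl⟩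
    have hR0 : 0 ≤ R := by rw [hR]; positivity
    refine ⟨Ci * (|attErr c ab (φ 0)| + |φ 0 5|) + γ * R, ?_⟩
    filter_upwards [eventually_ge_atTop 0] with T hT
    have hρ : ∀ t ∈ Icc 0 T, |refRate c xb ab (φ t)| ≤ R := by
      intro t ht
      have := (hout xb kp kd φ hφ 0 T 2 (c.l1 / p.mc) le_rfl zero_le_two hD (hf 0 T le_rfl)
        (fun t _ => min_le_right _ _) (fun t _ => abs_accX_le c xb _) t ht).2
      refine this.trans ?_
      rw [hR]
      gcongr
      refine mul_le_of_le_one_right hC.le (Real.exp_le_one_iff.2 ?_)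
      nlinarith [ht.1]
    refine (hin xb φ hφ 0 T R le_rfl hR0 (hf 0 T le_rfl) (hc2 0 T le_rfl) hρ T ⟨hT, le_rfl⟩).trans ?_
    gcongr
    refine mul_le_of_le_one_right hCi.le (Real.exp_le_one_iff.2 ?_)
    nlinarith
  have houter : ∀ k, (∀ᶠ t in atTop, |attErr c ab (φ t)| ≤ k) → ∀ η > 0,
      ∀ᶠ t in atTop, |φ t 2 - ab| + |φ t 3| ≤ C * k + η ∧ |refRate c xb ab (φ t)| ≤ C * k + η := by
    intro k hk η hη
    have hk0 : 0 ≤ k := by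
      obtain ⟨t, ht⟩ := hk.exists
      exact (abs_nonneg _).trans ht
    have hη' : 0 < η / (2 * C) := by positivity
    obtain ⟨s, hs⟩ := eventually_atTop.1 ((hk.and (eventually_abs_accX_le hφ hη')).and
      (eventually_ge_atTop 0))
    have hs0 : 0 ≤ s := (hs s le_rfl).2
    have key : ∀ t, s ≤ t → _ := fun t ht => hout xb kp kd φ hφ s t k (η / (2 * C)) hs0 hk0 hη'.le
      (hf s t hs0) (fun τ hτ => (min_le_left _ _).trans (hs τ hτ.1).1.1)
      (fun τ hτ => (hs τ hτ.1).1.2) t ⟨ht, le_rfl⟩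
    have e : C * (k + η / (2 * C)) = C * k + η / 2 := by field_simp
    filter_upwards [
      eventually_le_of_exp_bound (f := fun t => |φ t 2 - ab| + |φ t 3|)
        (A := C * (|φ s 2 - ab| + |φ s 3|)) (B := C * (k + η / (2 * C))) (s := s) hr
        (fun t ht => by linarith [(key t ht).1]) (half_pos hη),
      eventually_le_of_exp_bound (f := fun t => |refRate c xb ab (φ t)|)
        (A := C * (|φ s 2 - ab| + |φ s 3|)) (B := C * (k + η / (2 * C))) (s := s) hr
        (fun t ht => by linarith [(key t ht).2]) (half_pos hη)] with t h1 h2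
    rw [e] at h1 h2
    constructor <;> linarith
  -- Chaining both loops multiplies an eventual bound of the error by γ C < 1, up to an arbitrary η.
  have hy : Tendsto (fun t => attErr c ab (φ t)) atTop (𝓝 0) := by
    refine tendsto_zero_of_contraction (mul_nonneg hγ0 hC.le) hγ hbdd ?_
    intro k hk η hη
    have hk0 : 0 ≤ k := by
      obtain ⟨t, ht⟩ := hk.exists
      exact (abs_nonneg _).trans ht
    obtain ⟨η', hη'⟩ : ∃ η', η' = η / (2 * (γ + 1)) := ⟨_, rfl⟩
    have hη'0 : 0 < η' := by rw [hη']; positivity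
    obtain ⟨s, hs⟩ := eventually_atTop.1 ((houter k hk η' hη'0).and (eventually_ge_atTop 0))
    have hs0 : 0 ≤ s := (hs s le_rfl).2
    have key : ∀ t, s ≤ t → _ := fun t ht => hin xb φ hφ s t (C * k + η') hs0 (by positivity)
      (hf s t hs0) (hc2 s t hs0) (fun τ hτ => (hs τ hτ.1).1.2) t ⟨ht, le_rfl⟩
    filter_upwards [
      eventually_le_of_exp_bound (f := fun t => |attErr c ab (φ t)|)
        (A := Ci * (|attErr c ab (φ s)| + |φ s 5|)) (B := γ * (C * k + η')) (s := s) hri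
        (fun t ht => by linarith [key t ht]) (half_pos hη)] with t h1
    have e : γ * η' ≤ η / 2 := by
      have : η / 2 = γ * η' + η' := by rw [hη']; field_simp
      linarith
    linarith
  have hsmall : ∀ η > 0, ∀ᶠ t in atTop, |φ t 2 - ab| + |φ t 3| ≤ η := by
    intro η hη
    have h1 : ∀ᶠ t in atTop, |attErr c ab (φ t)| ≤ η / (2 * C) := by
      have := hy.abs.eventually (gt_mem_nhds (show |(0 : ℝ)| < η / (2 * C) by
        rw [abs_zero]; positivity))
      filter_upwards [this] with t ht using ht.le
    filter_upwards [houter _ h1 (η / 2) (half_pos hη)] with t ht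
    have e : C * (η / (2 * C)) = η / 2 := by field_simp
    rw [e] at ht
    linarith [ht.1]
  have h2 : Tendsto (fun t => φ t 2) atTop (𝓝 ab) := by
    rw [Metric.tendsto_nhds]
    intro ε hε
    filter_upwards [hsmall (ε / 2) (half_pos hε)] with t ht
    rw [Real.dist_eq]; linarith [abs_nonneg (φ t 3)]
  have h3 : Tendsto (fun t => φ t 3) atTop (𝓝 0) := by
    rw [Metric.tendsto_nhds]
    intro ε hε
    filter_upwards [hsmall (ε / 2) (half_pos hε)] with t ht
    rw [Real.dist_eq, sub_zero]; linarith [abs_nonneg (φ t 2 - ab)]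
  have h4 : Tendsto (fun t => φ t 4) atTop (𝓝 (c.betaEq ab)) := by
    have hz : Tendsto (fun t => c.sens * (|φ t 2 - ab| + |φ t 3|)) atTop (𝓝 0) := by
      have := (((h2.sub_const ab).abs).add h3.abs).const_mul c.sens
      simpa using this
    have hr' : Tendsto (fun t => c.betaRef ab (φ t 2) (φ t 3) - c.betaEq ab) atTop (𝓝 0) :=
      squeeze_zero_norm (fun t => c.abs_betaRef_sub_le ab (φ t 2) (φ t 3)) hz
    have := (hy.add hr').add_const (c.betaEq ab)
    simpa [attErr] using this
  -- The UAV rate is a stable first-order filter driven by the attitude error, which already tends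
  -- to zero.
  have h5 : Tendsto (fun t => φ t 5) atTop (𝓝 0) := by
    have hP := div_pos hkp p.Iu_pos
    have hQ := div_pos hkd p.Iu_pos
    rw [Metric.tendsto_nhds]
    intro ε hε
    obtain ⟨D, hD⟩ : ∃ D, D = ε / 4 * (kd / p.Iu) := ⟨_, rfl⟩
    have hD0 : 0 < D := by rw [hD]; positivity
    have h1 : ∀ᶠ t in atTop, |attErr c ab (φ t)| < D / (kp / p.Iu) :=
      hy.abs.eventually (gt_mem_nhds (by rw [abs_zero]; positivity))
    obtain ⟨s, hs⟩ := eventually_atTop.1 (h1.and (eventually_ge_atTop 0))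
    have hs0 : 0 ≤ s := (hs s le_rfl).2
    have key : ∀ t, s ≤ t → |φ t 5| ≤ Real.exp (-(kd / p.Iu / 2) * (t - s)) * |φ s 5|
        + D / (kd / p.Iu) := fun t ht =>
      first_order_bound hQ (hφ.coord 5) hs0 hD0.le (fun τ hτ => by
        have e : closedLoop c xb ab kp kd (φ τ) 5 + kd / p.Iu * φ τ 5
            = -(kp / p.Iu) * attErr c ab (φ τ) := by
          rw [show closedLoop c xb ab kp kd (φ τ) 5 = accB c ab kp kd (φ τ) from rfl,
            accB_eq (hc2 s t hs0 τ hτ)]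
          ring
        rw [e, abs_mul, abs_neg, abs_of_pos hP, ← le_div_iff₀' hP]
        exact (hs τ hτ.1).1.le) ⟨ht, le_rfl⟩
    filter_upwards [eventually_le_of_exp_bound (f := fun t => |φ t 5|) (A := |φ s 5|)
      (half_pos hQ) (fun t ht => (key t ht).trans_eq (by rw [mul_comm |φ s 5|]))
      (show 0 < ε / 4 by positivity)] with t ht
    have e : D / (kd / p.Iu) = ε / 4 := by rw [hD, mul_div_cancel_right₀ _ hQ.ne']
    rw [e] at ht
    rw [Real.dist_eq, sub_zero]
    linarith
  obtain ⟨h0, h1⟩ := tendsto_ugv hφ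
  rw [tendsto_pi_nhds]
  intro i
  fin_cases i
  exacts [h0, h1, h2, h3, h4, h5]

/-! ### Local stability -/

theorem eqState_apply (c : Gains p) (xb ab : ℝ) :
    eqState c xb ab 0 = xb ∧ eqState c xb ab 1 = 0 ∧ eqState c xb ab 2 = ab ∧
      eqState c xb ab 3 = 0 ∧ eqState c xb ab 4 = c.betaEq ab ∧ eqState c xb ab 5 = 0 :=
  ⟨rfl, rfl, rfl, rfl, rfl, rfl⟩

theorem abs_coord_sub_eqState_le (c : Gains p) (xb ab : ℝ) (s : Fin 6 → ℝ) :
    |s 0 - xb| ≤ ‖s - eqState c xb ab‖ ∧ |s 1| ≤ ‖s - eqState c xb ab‖ ∧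
    |s 2 - ab| ≤ ‖s - eqState c xb ab‖ ∧ |s 3| ≤ ‖s - eqState c xb ab‖ ∧
    |s 4 - c.betaEq ab| ≤ ‖s - eqState c xb ab‖ ∧ |s 5| ≤ ‖s - eqState c xb ab‖ := by
  have h : ∀ i, |s i - eqState c xb ab i| ≤ ‖s - eqState c xb ab‖ :=
    fun i => norm_le_pi_norm (s - eqState c xb ab) i
  obtain ⟨e0, e1, e2, e3, e4, e5⟩ := eqState_apply c xb ab
  refine ⟨?_, ?_, ?_, ?_, ?_, ?_⟩
  · simpa [e0] using h 0
  · simpa [e1] using h 1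
  · simpa [e2] using h 2
  · simpa [e3] using h 3
  · simpa [e4] using h 4
  · simpa [e5] using h 5

theorem norm_sub_eqState_le (c : Gains p) (xb ab : ℝ) {s : Fin 6 → ℝ} {K : ℝ}
    (h0 : |s 0 - xb| ≤ K) (h1 : |s 1| ≤ K) (h2 : |s 2 - ab| ≤ K) (h3 : |s 3| ≤ K)
    (h4 : |s 4 - c.betaEq ab| ≤ K) (h5 : |s 5| ≤ K) : ‖s - eqState c xb ab‖ ≤ K := by
  obtain ⟨e0, e1, e2, e3, e4, e5⟩ := eqState_apply c xb ab
  rw [pi_norm_le_iff_of_nonneg ((abs_nonneg _).trans h0)]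
  intro i
  rw [Pi.sub_apply, Real.norm_eq_abs]
  fin_cases i
  · simpa [e0] using h0
  · simpa [e1] using h1
  · simpa [e2] using h2
  · simpa [e3] using h3
  · simpa [e4] using h4
  · simpa [e5] using h5

theorem abs_beta_sub_le (c : Gains p) (ab : ℝ) (s : Fin 6 → ℝ) :
    |s 4 - c.betaEq ab| ≤ |attErr c ab s| + c.sens * (|s 2 - ab| + |s 3|) := by
  have e : s 4 - c.betaEq ab = attErr c ab s + (c.betaRef ab (s 2) (s 3) - c.betaEq ab) := by
    unfold attErr; ring
  rw [e]
  exact (abs_add_le _ _).trans (add_le_add_right (c.abs_betaRef_sub_le ab _ _) _)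

theorem abs_attErr_le (c : Gains p) (ab : ℝ) (s : Fin 6 → ℝ) :
    |attErr c ab s| ≤ |s 4 - c.betaEq ab| + c.sens * (|s 2 - ab| + |s 3|) := by
  have e : attErr c ab s = (s 4 - c.betaEq ab) - (c.betaRef ab (s 2) (s 3) - c.betaEq ab) := by
    unfold attErr; ring
  rw [e]
  exact (abs_sub _ _).trans (add_le_add_right (c.abs_betaRef_sub_le ab _ _) _)

/-- None of the saturations, internal or of the actuators, is active. -/
def LinearRegime (c : Gains p) (xb ab kp kd : ℝ) (s : Fin 6 → ℝ) : Prop :=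
  |c.force ab (s 2) (s 3)| ≤ p.Umax ∧ |cmd2 c ab kp kd s| ≤ p.Tmax ∧
    |c.kpx * (s 0 - xb)| ≤ c.l2 ∧ |c.kdx * s 1 + c.kpx * (s 0 - xb)| ≤ c.l1

theorem LinearRegime.unsaturated {c : Gains p} {xb ab kp kd : ℝ} {s : Fin 6 → ℝ}
    (h : LinearRegime c xb ab kp kd s) : Unsaturated c xb ab kp kd s :=
  ⟨⟨(c.thrust_pos _).le, c.thrust_le h.1⟩, h.2.1, (abs_cmd3_le c xb s).trans c.l1_le⟩

theorem LinearRegime.accX_eq {c : Gains p} {xb ab kp kd : ℝ} {s : Fin 6 → ℝ}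
    (h : LinearRegime c xb ab kp kd s) :
    accX c xb s + c.kpx / p.mc * (s 0 - xb) + c.kdx / p.mc * s 1 = 0 := by
  rw [UavUgv.accX_eq, cmd3, sat_of_abs_le h.2.2.1, sat_of_abs_le h.2.2.2]
  ring

theorem exists_linearRegime (c : Gains p) {ab : ℝ} (hab : |p.M * p.g * Real.cos ab| < p.Umax)
    (xb kp kd : ℝ) :
    ∃ ρ > 0, ∀ s, ‖s - eqState c xb ab‖ ≤ ρ → LinearRegime c xb ab kp kd s := by
  have h1 : Continuous fun s : Fin 6 → ℝ => |c.force ab (s 2) (s 3)| :=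
    (c.isLip_force ab).continuous.abs
  have h2 : Continuous fun s : Fin 6 → ℝ => |cmd2 c ab kp kd s| :=
    (isLip_cmd2 c ab kp kd).continuous.abs
  have h3 : Continuous fun s : Fin 6 → ℝ => |c.kpx * (s 0 - xb)| := by fun_prop
  have h4 : Continuous fun s : Fin 6 → ℝ => |c.kdx * s 1 + c.kpx * (s 0 - xb)| := by fun_prop
  obtain ⟨e0, e1, e2, e3, e4, e5⟩ := eqState_apply c xb ab
  have hev : ∀ᶠ s in 𝓝 (eqState c xb ab), LinearRegime c xb ab kp kd s := by
    filter_upwards [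
      (h1.tendsto (eqState c xb ab)).eventually_lt_const (u := p.Umax) (by
        rw [e2, e3]; simpa [Gains.force] using hab),
      (h2.tendsto (eqState c xb ab)).eventually_lt_const (u := p.Tmax) (by
        have : attErr c ab (eqState c xb ab) = 0 := by
          rw [attErr, e2, e3, e4, Gains.betaEq, sub_self]
        rw [cmd2_eq, this, e5]; simpa using p.Tmax_pos),
      (h3.tendsto (eqState c xb ab)).eventually_lt_const (u := c.l2) (by
        rw [e0]; simpa using c.l2_pos),
      (h4.tendsto (eqState c xb ab)).eventually_lt_const (u := c.l1) (by
        rw [e0, e1]; simpa using c.l1_pos)] with s a1 a2 a3 a4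
    exact ⟨a1.le, a2.le, a3.le, a4.le⟩
  obtain ⟨ρ, hρ, h⟩ := Metric.eventually_nhds_iff.1 hev
  exact ⟨ρ / 2, half_pos hρ, fun s hs => h (by rw [dist_eq_norm]; linarith)⟩

/-- The maximum b of |attErr| over [0, T] satisfies b ≤ const · δ + γ C b, with δ the initial
distance to the equilibrium. Solving for b gives a bound linear in δ whose constant does not depend
on T. -/
theorem exists_linear_bound (c : Gains p) (ab : ℝ) :
    ∃ Γ > 0, ∀ kp kd : ℝ, 0 < kp → 0 < kd → gammaIn p kp kd * Γ < 1 → ∃ K > 0,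
      ∀ xb φ, IsSolution (closedLoop c xb ab kp kd) φ →
      ∀ T, 0 ≤ T → (∀ t ∈ Icc 0 T, LinearRegime c xb ab kp kd (φ t)) →
      ‖φ T - eqState c xb ab‖ ≤ K * ‖φ 0 - eqState c xb ab‖ := by
  obtain ⟨r, hr, C, hC, hout⟩ := exists_outer_bound c ab
  refine ⟨C, hC, ?_⟩
  intro kp kd hkp hkd hγ
  obtain ⟨ri, hri, Ci, hCi, hin⟩ := exists_inner_bound c ab hkp hkd
  have hγ0 := gammaIn_nonneg p kp kd
  obtain ⟨γ, hγe⟩ : ∃ γ, γ = gammaIn p kp kd := ⟨_, rfl⟩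
  rw [← hγe] at hγ hγ0
  have hm := p.mc_pos
  have hkpx := c.kpx_pos
  have hkdx := c.kdx_pos
  have hsens := c.sens_pos
  have hP := div_pos hkp p.Iu_pos
  have hQ := div_pos hkd p.Iu_pos
  obtain ⟨κ, hκ, r₀, hr₀, C₀, hC₀, hiss⟩ :=
    second_order_bound (div_pos hkpx hm) (div_pos hkdx hm)
  obtain ⟨X, hX⟩ : ∃ X, X = C₀ * 2 := ⟨_, rfl⟩
  obtain ⟨Y, hY⟩ : ∃ Y, Y = (c.kpx + c.kdx) / p.mc * X := ⟨_, rfl⟩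
  -- In units of the initial distance, X, Y, B, Z, W bound the UGV state, its acceleration, the
  -- attitude error, the inclination state and the UAV rate. The denominator 1 − γ C comes from
  -- closing the loop.
  obtain ⟨B, hB⟩ : ∃ B, B = (Ci * (2 + c.sens * 2) + γ * (C * 2 + C * Y)) / (1 - γ * C) := ⟨_, rfl⟩
  obtain ⟨Z, hZ⟩ : ∃ Z, Z = C * 2 + C * (B + Y) := ⟨_, rfl⟩
  obtain ⟨W, hW⟩ : ∃ W, W = 1 + kp / p.Iu * B / (kd / p.Iu) := ⟨_, rfl⟩
  have hγ1 : 0 < 1 - γ * C := by linarith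
  have hX0 : 0 < X := by rw [hX]; positivity
  have hY0 : 0 < Y := by rw [hY]; positivity
  have hB0 : 0 < B := by rw [hB]; positivity
  have hZ0 : 0 < Z := by rw [hZ]; positivity
  have hW0 : 0 < W := by rw [hW]; positivity
  refine ⟨X + Z + (B + c.sens * Z) + W, by positivity, ?_⟩
  intro xb φ hφ T hT hlin
  obtain ⟨δ, hδ⟩ : ∃ δ, δ = ‖φ 0 - eqState c xb ab‖ := ⟨_, rfl⟩
  have hδ0 : 0 ≤ δ := hδ ▸ norm_nonneg _
  obtain ⟨a0, a1, a2, a3, a4, a5⟩ := abs_coord_sub_eqState_le c xb ab (φ 0)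
  rw [← hδ] at a0 a1 a2 a3 a4 a5 ⊢
  have hexp : ∀ q t : ℝ, 0 < q → 0 ≤ t → Real.exp (-q * (t - 0)) ≤ 1 := fun q t hq ht =>
    Real.exp_le_one_iff.2 (by nlinarith)
  have hf : ∀ t ∈ Icc 0 T, |c.force ab (φ t 2) (φ t 3)| ≤ p.Umax := fun t ht => (hlin t ht).1
  have hc2 : ∀ t ∈ Icc 0 T, |cmd2 c ab kp kd (φ t)| ≤ p.Tmax := fun t ht => (hlin t ht).2.1
  have hTm : T ∈ Icc 0 T := ⟨hT, le_rfl⟩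
  have hugv : ∀ t ∈ Icc 0 T, |φ t 0 - xb| + |φ t 1| ≤ X * δ := by
    intro t ht
    have := hiss (fun t => φ t 0 - xb) (fun t => φ t 1) (fun t => accX c xb (φ t))
      (fun t ht => (hφ.coord 0 t ht).sub_const xb) (hφ.coord 1) 0 T 0 le_rfl le_rfl
      (fun τ hτ => by rw [(hlin τ hτ).accX_eq, abs_zero]; positivity) t ht
    rw [mul_zero, add_zero] at this
    calc _ ≤ C₀ * Real.exp (-r₀ * (t - 0)) * (|φ 0 0 - xb| + |φ 0 1|) := this
      _ ≤ C₀ * 1 * (δ + δ) := by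
          gcongr
          exact hexp r₀ t hr₀ ht.1
      _ = X * δ := by rw [hX]; ring
  have hacc : ∀ t ∈ Icc 0 T, |accX c xb (φ t)| ≤ Y * δ := by
    intro t ht
    refine (abs_accX_le_linear c xb (φ t)).trans ?_
    rw [hY, mul_assoc]
    gcongr
    exact hugv t ht
  have hatt0 : |attErr c ab (φ 0)| ≤ (1 + c.sens * 2) * δ := by
    calc _ ≤ |φ 0 4 - c.betaEq ab| + c.sens * (|φ 0 2 - ab| + |φ 0 3|) := abs_attErr_le c ab _
      _ ≤ δ + c.sens * (δ + δ) := by gcongr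
      _ = _ := by ring
  have houter : ∀ b, 0 ≤ b → (∀ t ∈ Icc 0 T, |attErr c ab (φ t)| ≤ b) → ∀ t ∈ Icc 0 T,
      |φ t 2 - ab| + |φ t 3| ≤ C * 2 * δ + C * (b + Y * δ) ∧
        |refRate c xb ab (φ t)| ≤ C * 2 * δ + C * (b + Y * δ) := by
    intro b hb hatt t ht
    have h := hout xb kp kd φ hφ 0 T b (Y * δ) le_rfl hb (by positivity) hf
      (fun t ht => (min_le_left _ _).trans (hatt t ht)) hacc t ht
    have e : C * Real.exp (-r * (t - 0)) * (|φ 0 2 - ab| + |φ 0 3|) ≤ C * 2 * δ := by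
      calc _ ≤ C * 1 * (δ + δ) := by
            gcongr
            exact hexp r t hr ht.1
        _ = _ := by ring
    exact ⟨h.1.trans (by linarith), h.2.trans (by linarith)⟩
  have hatt : ∀ t ∈ Icc 0 T, |attErr c ab (φ t)| ≤ B * δ := by
    obtain ⟨τ, hτ, hmax⟩ := isCompact_Icc.exists_isMaxOn (nonempty_Icc.2 hT)
      (((isLip_attErr c ab).continuous.comp_continuousOn (hφ.continuousOn T)).abs)
    obtain ⟨b, hb⟩ : ∃ b, b = |attErr c ab (φ τ)| := ⟨_, rfl⟩
    have hb0 : 0 ≤ b := hb ▸ abs_nonneg _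
    have hle : ∀ t ∈ Icc 0 T, |attErr c ab (φ t)| ≤ b := fun t ht => hb ▸ hmax ht
    have h := hin xb φ hφ 0 T (C * 2 * δ + C * (b + Y * δ)) le_rfl (by positivity) hf hc2
      (fun t ht => (houter b hb0 hle t ht).2) τ hτ
    rw [← hb, ← hγe] at h
    have e : Ci * Real.exp (-ri * (τ - 0)) * (|attErr c ab (φ 0)| + |φ 0 5|)
        ≤ Ci * (2 + c.sens * 2) * δ := by
      calc _ ≤ Ci * 1 * ((1 + c.sens * 2) * δ + δ) := by
            gcongr
            exact hexp ri τ hri hτ.1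
        _ = _ := by ring
    have hbB : b ≤ B * δ := by
      rw [hB, div_mul_eq_mul_div, le_div_iff₀ hγ1]
      linarith
    exact fun t ht => (hle t ht).trans hbB
  have hz : |φ T 2 - ab| + |φ T 3| ≤ Z * δ := by
    refine (houter (B * δ) (by positivity) hatt T hTm).1.trans (le_of_eq ?_)
    rw [hZ]; ring
  have hw : |φ T 5| ≤ W * δ := by
    have := first_order_bound hQ (hφ.coord 5) (s := 0) (T := T) (D := kp / p.Iu * (B * δ)) le_rfl
      (by positivity) (fun τ hτ => by
        have e : closedLoop c xb ab kp kd (φ τ) 5 + kd / p.Iu * φ τ 5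
            = -(kp / p.Iu) * attErr c ab (φ τ) := by
          rw [show closedLoop c xb ab kp kd (φ τ) 5 = accB c ab kp kd (φ τ) from rfl,
            accB_eq (hc2 τ hτ)]
          ring
        rw [e, abs_mul, abs_neg, abs_of_pos hP]
        exact mul_le_mul_of_nonneg_left (hatt τ hτ) hP.le) hTm
    have e1 : Real.exp (-(kd / p.Iu / 2) * (T - 0)) * |φ 0 5| ≤ 1 * δ := by
      gcongr
      exact hexp _ T (half_pos hQ) hT
    have e2 : W * δ = 1 * δ + kp / p.Iu * (B * δ) / (kd / p.Iu) := by rw [hW]; ring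
    linarith
  have hβ : |φ T 4 - c.betaEq ab| ≤ (B + c.sens * Z) * δ := by
    calc _ ≤ |attErr c ab (φ T)| + c.sens * (|φ T 2 - ab| + |φ T 3|) := abs_beta_sub_le c ab _
      _ ≤ B * δ + c.sens * (Z * δ) := by gcongr; exact hatt T hTm
      _ = _ := by ring
  have hx := hugv T hTm
  have p1 : 0 ≤ X * δ := by positivity
  have p2 : 0 ≤ Z * δ := by positivity
  have p3 : 0 ≤ (B + c.sens * Z) * δ := by positivity
  have p4 : 0 ≤ W * δ := by positivity
  have e : (X + Z + (B + c.sens * Z) + W) * δ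
      = X * δ + Z * δ + (B + c.sens * Z) * δ + W * δ := by ring
  rw [e]
  refine norm_sub_eqState_le c xb ab ?_ ?_ ?_ ?_ ?_ ?_
  · linarith [abs_nonneg (φ T 1)]
  · linarith [abs_nonneg (φ T 0 - xb)]
  · linarith [abs_nonneg (φ T 3)]
  · linarith [abs_nonneg (φ T 2 - ab)]
  · linarith
  · linarith

/-- A continuous function that contracts its bound as long as it is small remains small. -/
theorem forall_lt_of_bootstrap {g : ℝ → ℝ} (hg : ContinuousOn g (Ici 0)) {R : ℝ}
    (h0 : g 0 < R) (h : ∀ T, 0 ≤ T → (∀ t ∈ Icc 0 T, g t ≤ R) → g T < R) :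
    ∀ t, 0 ≤ t → g t < R := by
  intro t ht
  by_contra! hcon
  have hcl : IsCompact (Icc 0 t ∩ g ⁻¹' Ici R) :=
    isCompact_Icc.of_isClosed_subset
      ((hg.mono Icc_subset_Ici_self).preimage_isClosed_of_isClosed isClosed_Icc isClosed_Ici)
      inter_subset_left
  -- T is the first time at which g reaches R; the hypothesis on [0, T] contradicts g T ≥ R.
  obtain ⟨T, ⟨hT, hgT⟩, hleast⟩ := hcl.exists_isLeast ⟨t, ⟨ht, le_rfl⟩, hcon⟩
  have hlt : ∀ τ, 0 ≤ τ → τ < T → g τ < R := by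
    intro τ h1 h2
    by_contra! h3
    exact absurd (hleast ⟨⟨h1, h2.le.trans hT.2⟩, h3⟩) (not_le.2 h2)
  have hgT' : g T ≤ R := by
    by_contra! h1
    obtain ⟨τ, hτ, hτR⟩ := intermediate_value_Icc hT.1
      (hg.mono (Icc_subset_Ici_self)) ⟨h0.le, h1.le⟩
    have hne : τ ≠ T := by rintro rfl; linarith
    linarith [hlt τ hτ.1 (lt_of_le_of_ne hτ.2 hne)]
  have : g T < R := h T hT.1 fun τ hτ => by
    rcases hτ.2.lt_or_eq with h1 | h1
    · exact (hlt τ hτ.1 h1).le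
    · exact h1 ▸ hgT'
  exact absurd hgT (not_le.2 this)

theorem exists_forall_norm_lt (c : Gains p) {ab : ℝ}
    (hab : |p.M * p.g * Real.cos ab| < p.Umax) :
    ∃ Γ > 0, ∀ kp kd : ℝ, 0 < kp → 0 < kd → gammaIn p kp kd * Γ < 1 → ∀ xb,
      ∀ r > 0, ∃ δ > 0, ∀ φ, IsSolution (closedLoop c xb ab kp kd) φ →
        ‖φ 0 - eqState c xb ab‖ < δ → ∀ t, 0 ≤ t →
          ‖φ t - eqState c xb ab‖ < r ∧ Unsaturated c xb ab kp kd (φ t) := by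
  obtain ⟨Γ, hΓ, h⟩ := exists_linear_bound c ab
  refine ⟨Γ, hΓ, fun kp kd hkp hkd hγ xb r hr => ?_⟩
  obtain ⟨K, hK, hb⟩ := h kp kd hkp hkd hγ
  obtain ⟨ρ, hρ, hlin⟩ := exists_linearRegime c hab xb kp kd
  have hR : 0 < min r ρ := lt_min hr hρ
  refine ⟨min r ρ / (K + 1), by positivity, fun φ hφ h0 => ?_⟩
  rw [lt_div_iff₀ (by positivity)] at h0
  have hn := norm_nonneg (φ 0 - eqState c xb ab)
  have hlt : ∀ t, 0 ≤ t → ‖φ t - eqState c xb ab‖ < min r ρ := by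
    refine forall_lt_of_bootstrap (g := fun t => ‖φ t - eqState c xb ab‖)
      (fun t ht => ((hφ t ht).continuousWithinAt.sub continuousWithinAt_const).norm)
      (by linarith [mul_nonneg hn hK.le]) fun T hT hle => ?_
    have := hb xb φ hφ T hT fun t ht => hlin _ ((hle t ht).trans (min_le_right _ _))
    linarith
  exact fun t ht => ⟨(hlt t ht).trans_le (min_le_left _ _),
    (hlin _ ((hlt t ht).le.trans (min_le_right _ _))).unsaturated⟩

/-! ### Initial conditions satisfying the small-gain bound -/

/-- The margin μ > 0 and strict monotonicity of the cosine on [0, π] make the inequality strict,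
which opens a neighbourhood without saturation. -/
theorem abs_mul_cos_lt_Umax (p : Plant) {μ ab : ℝ} (hμ : 0 < μ)
    (hab : ab ∈ Icc (p.alphaMin + μ) (p.alphaMax - μ)) : |p.M * p.g * Real.cos ab| < p.Umax := by
  have hMg := mul_pos p.M_pos p.g_pos
  have hU := p.Umax_pos
  have h1 : p.alphaMin < ab := by linarith [hab.1]
  have h2 : ab < p.alphaMax := by linarith [hab.2]
  unfold Plant.alphaMin at h1
  unfold Plant.alphaMax at h2
  rw [abs_lt]
  split_ifs at h1 h2 with h
  · have hr : p.Umax / (p.M * p.g) ≤ 1 := (div_le_one hMg).2 h.le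
    have hr0 : 0 < p.Umax / (p.M * p.g) := by positivity
    rw [neg_div] at h2
    have hab0 : 0 ≤ ab := (Real.arccos_nonneg _).trans h1.le
    have habπ : ab ≤ Real.pi := h2.le.trans (Real.arccos_le_pi _)
    have c1 := Real.strictAntiOn_cos ⟨Real.arccos_nonneg _, Real.arccos_le_pi _⟩ ⟨hab0, habπ⟩ h1
    have c2 := Real.strictAntiOn_cos ⟨hab0, habπ⟩ ⟨Real.arccos_nonneg _, Real.arccos_le_pi _⟩ h2
    rw [Real.cos_arccos (by linarith) hr, lt_div_iff₀ hMg] at c1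
    rw [Real.cos_arccos (by linarith) (by linarith), ← neg_div, div_lt_iff₀ hMg] at c2
    constructor <;> linarith
  · have c1 := Real.strictAntiOn_cos ⟨le_rfl, Real.pi_pos.le⟩ ⟨h1.le, h2.le⟩ h1
    have c2 := Real.strictAntiOn_cos ⟨h1.le, h2.le⟩ ⟨Real.pi_pos.le, le_rfl⟩ h2
    rw [Real.cos_zero] at c1
    rw [Real.cos_pi] at c2
    constructor <;> nlinarith

theorem accA_eqState (c : Gains p) {ab : ℝ} (hab : |p.M * p.g * Real.cos ab| < p.Umax) (xb : ℝ) :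
    accA c xb ab (eqState c xb ab) = 0 := by
  obtain ⟨e0, e1, e2, e3, e4, e5⟩ := eqState_apply c xb ab
  have hf : c.force ab (eqState c xb ab 2) (eqState c xb ab 3) = p.M * p.g * Real.cos ab := by
    rw [e2, e3]; simp [Gains.force]
  have hatt : attErr c ab (eqState c xb ab) = 0 := by
    rw [attErr, e2, e3, e4, Gains.betaEq, sub_self]
  have hx : accX c xb (eqState c xb ab) = 0 := by
    rw [accX_eq, cmd3, e0, e1]; simp [sat_zero]
  have h := abs_accA_add_le c xb ab (s := eqState c xb ab) (by rw [hf]; exact hab.le)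
  rw [hatt, hx, e2, e3] at h
  simpa using h

/-- The angular acceleration of the object does not involve `s 5`, so that coordinate may be
replaced by its equilibrium value 0. This matters because `s 5` is itself estimated through `accA`.
-/
theorem exists_abs_accA_le (c : Gains p) {ab : ℝ} (hab : |p.M * p.g * Real.cos ab| < p.Umax)
    (xb : ℝ) : ∃ K > 0, ∀ (s : Fin 6 → ℝ) (d : ℝ), |s 0 - xb| ≤ d → |s 1| ≤ d → |s 2 - ab| ≤ d →
      |s 3| ≤ d → |s 4 - c.betaEq ab| ≤ d → |accA c xb ab s| ≤ K * d := by
  obtain ⟨K, hK, h⟩ := isLip_accA c xb ab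
  refine ⟨K + 1, by positivity, fun s d h0 h1 h2 h3 h4 => ?_⟩
  have hd : 0 ≤ d := (abs_nonneg _).trans h0
  have e : accA c xb ab s = accA c xb ab ![s 0, s 1, s 2, s 3, s 4, 0] := rfl
  have hn := norm_sub_eqState_le c xb ab (s := ![s 0, s 1, s 2, s 3, s 4, 0]) (K := d)
    h0 h1 h2 h3 h4 (by simpa using hd)
  have hl := h ![s 0, s 1, s 2, s 3, s 4, 0] (eqState c xb ab)
  rw [accA_eqState c hab, sub_zero, ← e, dist_eq_norm] at hl
  refine hl.trans ((mul_le_mul_of_nonneg_left hn hK).trans ?_)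
  linarith

/-- The small-gain bound confines the initial state to a neighbourhood of the equilibrium. -/
theorem exists_norm_lt_of_smallGain (c : Gains p) {ab : ℝ}
    (hab : |p.M * p.g * Real.cos ab| < p.Umax) (xb : ℝ) {kp kd : ℝ} (hkp : 0 < kp) (hkd : 0 < kd)
    {δ : ℝ} (hδ : 0 < δ) :
    ∃ r > 0, ∀ θm ∈ Ioc 0 r, ∀ s : Fin 6 → ℝ, |s 0 - xb| < r → |s 1| < r →
      SmallGain c xb ab kp kd θm s → ‖s - eqState c xb ab‖ < δ := by
  have hγ := gammaIn_pos p hkp hkd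
  have hsens := c.sens_pos
  obtain ⟨K, hK, hacc⟩ := exists_abs_accA_le c hab xb
  obtain ⟨γ, hγe⟩ : ∃ γ, γ = gammaIn p kp kd := ⟨_, rfl⟩
  rw [← hγe] at hγ
  obtain ⟨Z, hZ⟩ : ∃ Z, Z = 1 + 1 / γ + (1 + c.sens * (1 / γ + 1 / γ)) := ⟨_, rfl⟩
  have hZ0 : 0 < Z := by rw [hZ]; positivity
  obtain ⟨W, hW⟩ : ∃ W, W = Z + (1 + c.sens * (Z + K * Z)) := ⟨_, rfl⟩
  have hW0 : 0 < W := by rw [hW]; positivity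
  refine ⟨δ / (2 * W), by positivity, ?_⟩
  intro θm hθ s h0 h1 hsg
  obtain ⟨r, hr⟩ : ∃ r, r = δ / (2 * W) := ⟨_, rfl⟩
  rw [← hr] at hθ h0 h1
  have hr0 : 0 ≤ r := hθ.1.le.trans hθ.2
  unfold SmallGain at hsg
  rw [← hγe, abs_of_pos hθ.1] at hsg
  -- Both gains are nonnegative, so the right side is at most θm; this bounds each square root
  -- separately.
  have hrhs : (1 - γ * c.gammaOut ab θm) * θm ≤ r := by
    have := mul_nonneg (mul_nonneg hγ.le (c.gammaOut_nonneg ab θm)) hθ.1.le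
    linarith [hθ.2]
  have q1 := Real.sqrt_nonneg (attErr c ab s ^ 2 + attErrRate c xb ab s ^ 2)
  have q2 := Real.sqrt_nonneg ((s 2 - ab) ^ 2 + s 3 ^ 2)
  have k1 : √(attErr c ab s ^ 2 + attErrRate c xb ab s ^ 2) ≤ r := by
    linarith [mul_nonneg hγ.le q2]
  have k2 : √((s 2 - ab) ^ 2 + s 3 ^ 2) ≤ 1 / γ * r := by
    rw [one_div, ← div_eq_inv_mul, le_div_iff₀' hγ]
    linarith
  have b1 : |attErr c ab s| ≤ r :=
    (Real.abs_le_sqrt (le_add_of_nonneg_right (sq_nonneg _))).trans k1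
  have b2 : |attErrRate c xb ab s| ≤ r :=
    (Real.abs_le_sqrt (le_add_of_nonneg_left (sq_nonneg _))).trans k1
  have b3 : |s 2 - ab| ≤ 1 / γ * r :=
    (Real.abs_le_sqrt (le_add_of_nonneg_right (sq_nonneg _))).trans k2
  have b4 : |s 3| ≤ 1 / γ * r :=
    (Real.abs_le_sqrt (le_add_of_nonneg_left (sq_nonneg _))).trans k2
  have b5 : |s 4 - c.betaEq ab| ≤ (1 + c.sens * (1 / γ + 1 / γ)) * r := by
    calc _ ≤ |attErr c ab s| + c.sens * (|s 2 - ab| + |s 3|) := abs_beta_sub_le c ab s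
      _ ≤ r + c.sens * (1 / γ * r + 1 / γ * r) := by gcongr
      _ = _ := by ring
  have n1 : 0 ≤ 1 / γ * r := by positivity
  have n2 : 0 ≤ (1 + c.sens * (1 / γ + 1 / γ)) * r := by positivity
  have e1 : Z * r = r + 1 / γ * r + (1 + c.sens * (1 / γ + 1 / γ)) * r := by rw [hZ]; ring
  have n3 : 0 ≤ (1 + c.sens * (Z + K * Z)) * r := by positivity
  have e2 : W * r = Z * r + (1 + c.sens * (Z + K * Z)) * r := by rw [hW]; ring
  have b6 := hacc s (Z * r) (by linarith) (by linarith) (by linarith) (by linarith) (by linarith)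
  -- The UAV rate is recovered from the error rate and the reference rate, which the other five
  -- coordinates control.
  have b7 : |s 5| ≤ (1 + c.sens * (Z + K * Z)) * r := by
    have e : s 5 = attErrRate c xb ab s + c.betaRefRate ab (s 2) (s 3) (accA c xb ab s) := by
      unfold attErrRate; ring
    rw [e]
    calc _ ≤ |attErrRate c xb ab s| + |c.betaRefRate ab (s 2) (s 3) (accA c xb ab s)| :=
          abs_add_le _ _
      _ ≤ r + c.sens * (|s 3| + |accA c xb ab s|) :=
          add_le_add b2 (c.abs_betaRefRate_le ab _ _ _)
      _ ≤ r + c.sens * (Z * r + K * (Z * r)) := by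
          gcongr
          linarith
      _ = _ := by ring
  have hfin : ‖s - eqState c xb ab‖ ≤ W * r :=
    norm_sub_eqState_le c xb ab (by linarith) (by linarith) (by linarith) (by linarith)
      (by linarith) (by linarith)
  have e3 : W * r = δ / 2 := by rw [hr]; field_simp
  linarith


end UavUgv

/-! ### Assembly of the result. -/

theorem corollary1 (p : UavUgv.Plant) (c : UavUgv.Gains p) (μ : ℝ) (hμ : 0 < μ)
    (xb ab : ℝ) (hab : ab ∈ Set.Icc (p.alphaMin + μ) (p.alphaMax - μ)) :
    ∃ θ₀ ∈ Set.Ioo 0 (Real.pi / 2), ∃ γ₀ > 0,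
      -- the outer loop has a finite gain under each restriction `θm ≤ θ₀`
      (∀ θm ∈ Set.Ioc 0 θ₀, ∃ γ, c.IsOuterGain ab θm γ) ∧
      -- there are arbitrarily large attitude gains with a small inner gain
      (∀ K : ℝ, ∃ kp kd : ℝ, K ≤ kp ∧ K ≤ kd ∧ 0 < kp ∧ 0 < kd ∧
        UavUgv.gammaIn p kp kd < γ₀) ∧
      ∀ kp kd : ℝ, 0 < kp → 0 < kd → UavUgv.gammaIn p kp kd < γ₀ →
        -- the small-gain condition holds
        (∀ θm ∈ Set.Ioc 0 θ₀, UavUgv.gammaIn p kp kd * c.gammaOut ab θm < 1) ∧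
        -- asymptotic stability with the saturations present
        UavUgv.AsymptoticallyStable (UavUgv.closedLoop c xb ab kp kd) (UavUgv.eqState c xb ab) ∧
        -- convergence from every initial condition satisfying the small-gain bound from which
        -- the saturations do not occur
        (∀ θm ∈ Set.Ioc 0 θ₀, ∀ φ, UavUgv.IsSolution (UavUgv.closedLoop c xb ab kp kd) φ →
          UavUgv.SmallGain c xb ab kp kd θm (φ 0) →
          (∀ t, 0 ≤ t → UavUgv.Unsaturated c xb ab kp kd (φ t)) →
          Filter.Tendsto φ Filter.atTop (nhds (UavUgv.eqState c xb ab))) ∧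
        -- for small `θm` and a UGV starting near its target, the small-gain bound alone
        -- excludes the saturations and gives convergence
        (∃ θ₁ ∈ Set.Ioc 0 θ₀, ∃ r > 0, ∀ θm ∈ Set.Ioc 0 θ₁, ∀ φ,
          UavUgv.IsSolution (UavUgv.closedLoop c xb ab kp kd) φ →
          |φ 0 0 - xb| < r → |φ 0 1| < r →
          UavUgv.SmallGain c xb ab kp kd θm (φ 0) →
          (∀ t, 0 ≤ t → UavUgv.Unsaturated c xb ab kp kd (φ t)) ∧
          Filter.Tendsto φ Filter.atTop (nhds (UavUgv.eqState c xb ab))) := by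
  have hcos := UavUgv.abs_mul_cos_lt_Umax p hμ hab
  obtain ⟨θ₀, hθ₀, Γ, hΓ, hgain⟩ := c.exists_isOuterGain ab
  obtain ⟨Γ₁, hΓ₁, hconv⟩ := UavUgv.exists_tendsto_of_unsaturated c ab
  obtain ⟨Γ₂, hΓ₂, hstab⟩ := UavUgv.exists_forall_norm_lt c hcos
  have hsum : 0 < Γ + Γ₁ + Γ₂ := by positivity
  -- The sum makes the product of γ_in with each of the three constants (outer gain, convergence,
  -- stability) less than 1.
  refine ⟨θ₀, hθ₀, 1 / (Γ + Γ₁ + Γ₂), by positivity, fun θm hθm => ⟨Γ, hgain θm hθm⟩,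
    UavUgv.exists_gains_gammaIn_lt p (by positivity), ?_⟩
  intro kp kd hkp hkd hγ
  have hγ0 := UavUgv.gammaIn_nonneg p kp kd
  rw [lt_div_iff₀ hsum, mul_add, mul_add] at hγ
  have m0 := mul_nonneg hγ0 hΓ.le
  have m1 := mul_nonneg hγ0 hΓ₁.le
  have m2 := mul_nonneg hγ0 hΓ₂.le
  have hconv' := hconv kp kd hkp hkd (by linarith) xb
  have hstab' := hstab kp kd hkp hkd (by linarith) xb
  -- The radius 1 is immaterial: δ serves only to guarantee that no actuator saturates along the
  -- solution.
  obtain ⟨δ, hδ, hδ'⟩ := hstab' 1 one_pos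
  refine ⟨fun θm hθm => ?_, ⟨UavUgv.exists_isSolution c xb ab kp kd, fun r hr => ?_, δ, hδ, ?_⟩,
    fun _ _ φ hφ _ hun => hconv' φ hφ hun, ?_⟩
  · have := mul_le_mul_of_nonneg_left (c.gammaOut_le (hgain θm hθm)) hγ0
    linarith
  · obtain ⟨δ', hδ0, h⟩ := hstab' r hr
    exact ⟨δ', hδ0, fun φ hφ h0 t ht => (h φ hφ h0 t ht).1⟩
  · exact fun φ hφ h0 => hconv' φ hφ fun t ht => (hδ' φ hφ h0 t ht).2
  · obtain ⟨r, hr, h⟩ := UavUgv.exists_norm_lt_of_smallGain c hcos xb hkp hkd hδ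
    refine ⟨min θ₀ r, ⟨lt_min hθ₀.1 hr, min_le_left _ _⟩, r, hr, ?_⟩
    intro θm hθm φ hφ h0 h1 hsg
    have hun : ∀ t, 0 ≤ t → UavUgv.Unsaturated c xb ab kp kd (φ t) := fun t ht =>
      (hδ' φ hφ (h θm ⟨hθm.1, hθm.2.trans (min_le_right _ _)⟩ (φ 0) h0 h1 hsg) t ht).2
    exact ⟨hun, hconv' φ hφ hun⟩
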